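/- **Energy estimate for the SVV Fourier–Galerkin approximation.** *Setting.* Let $d\ge1$, $\Lambda=(0,2\pi)^d$, $T>0$, $D_T=\Lambda\times(0,T)$. For $\xi\in\mathbb Z^d$ let $|\xi|$ be the Euclidean length, $\hat\varphi_\xi=(2\pi)^{-d}\int_\Lambda\varphi(x)e^{-i\xi\cdot x}\,dx$ and $P_N\varphi=\sum_{|\xi|\le N}\hat\varphi_\xi e^{i\xi\cdot x}$. Write $\|\partial_x^s\varphi\|^2=\sum_{|\alpha|=s}\|\partial_x^\alpha\varphi\|^2_{L^2}$ (for vectors, also summed over the components). Let $\mu\ge0$ be a measure on $\mathbb R^d\setminus\{0\}$ with $\int_{|z|>0}|z|^2\wedge1\,d\mu<\infty$ that is symmetric, $\mu(-B)=\mu(B)$, and let $$\mathcal L^\mu[\varphi](x)=\int_{|z|>0}\varphi(x+z)-\varphi(x)-z\cdot\partial_x\varphi(x)\mathbf 1_{|z|<1}\,d\mu(z),\qquad G^\mu(\xi)=\int_{|z|>0}e^{i\xi\cdot z}-1-i\xi\cdot z\,\mathbf 1_{|z|<1}\,d\mu(z);$$ by symmetry $G^\mu(\xi)$ is real and non-positive.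 Let $s\ge0$ be an integer, $f=(f_1,\dots,f_d)$ with $f_j\in C^{s+1}(\mathbb R)$, and $u_0\in L^\infty(\Lambda)$. Let $m_N>0$ and let the kernels $Q_N^{j,k}(x,t)=\sum_{m_N\le|\xi|\le N}\hat Q^{j,k}_\xi(t)e^{i\xi\cdot x}$ have real coefficients that depend on $\xi$ only through $|\xi|$, increase with $|\xi|$, and satisfy $|\hat Q^{j,k}_\xi-\delta_{jk}|\le C_Q\,m_N^2|\xi|^{-2}$ for $m_N\le|\xi|\le N$. Let $u_N$ be a real solution on $[0,T]$, $u_N(x,t)=\sum_{|\xi|\le N}\hat u_\xi(t)e^{i\xi\cdot x}$ with $\hat u_\xi$ continuous on $[0,T]$ and differentiable on $(0,T)$, of $$\partial_tu_N+\partial_x\cdot P_Nf(u_N)=\mathcal L^\mu[u_N]+\varepsilon_N\sum_{j,k=1}^d\partial^2_{jk}Q_N^{j,k}*u_N,\qquad u_N(\cdot,0)=P_Nu_0,$$ where $*$ is the periodic convolution normalized by $(2\pi)^{-d}$. *Constants $\mathcal K_k$.* There are $c_k>0$, depending only on $d$ and $k$, such that for all $k\ge1$, all $f\in C^k(\mathbb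 R;\mathbb R^d)$ and all real trigonometric polynomials $\varphi$ with $|\varphi|\le U$, $$\|\partial_x^kf(\varphi)\|_{L^2(\Lambda)}\le\mathcal K_k\|\partial_x^k\varphi\|_{L^2(\Lambda)},\qquad \mathcal K_k=c_k\sum_{j=1}^k\Big(\sup_{|v|\le U}|f^{(j)}(v)|\Big)U^{j-1}.$$ Below, $\mathcal K_k$ is this constant with these $c_k$ and $U=\|u_N\|_{L^\infty(D_T)}$. *Estimate.* Assume $$\varepsilon_N>\frac{8\,d^{s/2}\mathcal K_{s+1}}N,\qquad \varepsilon_N\,m_N^2(\log N)^d\le C_A .$$ There are $N_0$ and $C>0$, depending only on $d,s,T,C_Q,C_A$ (and the choice of the $c_k$), such that for all such data with $N\ge N_0$ and all $t\in[0,T]$ $$\varepsilon_N^s\|\partial_x^su_N(\cdot,t)\|_{L^2(\Lambda)}+\varepsilon_N^s\Big(-\sum_{|\alpha|=s}\sum_{|\xi|\le N}G^\mu(\xi)|\xi^\alpha|^2\int_0^t|\hat u_\xi(\tau)|^2d\tau\Big)^{1/2}+\varepsilon_N^{s+\frac12}\|\partial_x^{s+1}u_N\|_{L^2(D_T)}\le\mathcal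 B_s+3\varepsilon_N^s\|\partial_x^su_N(\cdot,0)\|_{L^2(\Lambda)}$$ with $\mathcal B_0=C\|u_N\|_{L^\infty(D_T)}$ and $\mathcal B_s=C\|u_0\|_{L^2(\Lambda)}\prod_{k=1}^s\mathcal K_s=C\|u_0\|_{L^2(\Lambda)}\,\mathcal K_s^{\,s}$ for $s\ge1$. Moreover, if $s\ge1$ and, for some $C_0$ and $\kappa>0$, $\varepsilon_N^k\|\partial_x^ku_N(\cdot,0)\|_{L^2(\Lambda)}\le C_0$ for $0\le k<s$ and $\mathcal K_1\ge\kappa$, then the same estimate holds with $\mathcal B_s=C'\prod_{k=1}^s\mathcal K_k$, where $C'>0$ depends only on $C_0$, $\kappa$ and the quantities on which $C$ depends. -/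

import Mathlib

open MeasureTheory

noncomputable section

namespace SVV

/-- Physical space `ℝ^d`, with the Euclidean norm and Lebesgue measure. -/
abbrev Space (d : ℕ) : Type := EuclideanSpace ℝ (Fin d)

/-- The periodicity cell `Λ = (0, 2π)^d`. -/
def cell (d : ℕ) : Set (Space d) := {x | ∀ i, 0 < x i ∧ x i < 2 * Real.pi}

/-! ### Frequencies, Fourier coefficients and the Fourier projection -/

/-- The Euclidean length `|ξ|` of a frequency `ξ ∈ ℤ^d`. -/
def freqNorm {d : ℕ} (ξ : Fin d → ℤ) : ℝ := Real.sqrt (∑ i, (ξ i : ℝ) ^ 2)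

/-- The phase `ξ · x`. -/
def phase {d : ℕ} (ξ : Fin d → ℤ) (x : Space d) : ℝ := ∑ i, (ξ i : ℝ) * x i

/-- The character `x ↦ e^{i ξ·x}`. -/
def character {d : ℕ} (ξ : Fin d → ℤ) (x : Space d) : ℂ :=
  Complex.exp (Complex.I * (phase ξ x : ℂ))

/-- The finite set of frequencies `ξ ∈ ℤ^d` with `|ξ| ≤ N` (see `mem_modes`). -/
def modes (d N : ℕ) : Finset (Fin d → ℤ) :=
  (Fintype.piFinset fun _ => Finset.Icc (-(N : ℤ)) (N : ℤ)).filter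
    fun ξ => ∑ i, ξ i ^ 2 ≤ (N : ℤ) ^ 2

theorem mem_modes {d N : ℕ} {ξ : Fin d → ℤ} : ξ ∈ modes d N ↔ freqNorm ξ ≤ N := by
  have key : freqNorm ξ ≤ N ↔ ∑ i, ξ i ^ 2 ≤ (N : ℤ) ^ 2 := by
    unfold freqNorm
    rw [Real.sqrt_le_left (by positivity)]
    exact_mod_cast Iff.rfl
  rw [key, modes, Finset.mem_filter, and_iff_right_iff_imp]
  intro h
  rw [Fintype.mem_piFinset]
  intro i
  rw [Finset.mem_Icc]
  have h1 : ξ i ^ 2 ≤ (N : ℤ) ^ 2 :=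
    (Finset.single_le_sum (f := fun j => ξ j ^ 2) (fun j _ => sq_nonneg (ξ j))
      (Finset.mem_univ i)).trans h
  exact abs_le.mp (abs_le_of_sq_le_sq h1 (by positivity))

/-- The Fourier coefficient `φ̂_ξ = (2π)^{-d} ∫_Λ φ(x) e^{-iξ·x} dx`. -/
def coeff {d : ℕ} (φ : Space d → ℝ) (ξ : Fin d → ℤ) : ℂ :=
  ((2 * Real.pi : ℝ) ^ d : ℂ)⁻¹ * ∫ x in cell d, (φ x : ℂ) * character (-ξ) x

/-- The Fourier projection `P_N φ = ∑_{|ξ| ≤ N} φ̂_ξ e^{iξ·x}`. -/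
def proj {d : ℕ} (N : ℕ) (φ : Space d → ℝ) (x : Space d) : ℂ :=
  ∑ ξ ∈ modes d N, coeff φ ξ * character ξ x

/-- `φ` is a real `N`-trigonometric polynomial. -/
def IsTrigPoly {d : ℕ} (N : ℕ) (φ : Space d → ℝ) : Prop := ∀ x, (φ x : ℂ) = proj N φ x

/-! ### Derivatives and norms -/

/-- The partial derivative `∂_j g`. -/
def pderiv {d : ℕ} {F : Type*} [NormedAddCommGroup F] [NormedSpace ℝ F]
    (j : Fin d) (g : Space d → F) (x : Space d) : F :=
  fderiv ℝ g x (EuclideanSpace.single j 1)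

/-- The multi-index derivative `∂_1^{α_1} ⋯ ∂_d^{α_d} φ`. -/
def multiDeriv {d : ℕ} (α : Fin d → ℕ) (φ : Space d → ℝ) : Space d → ℝ :=
  (List.finRange d).foldr (fun j g => (pderiv j)^[α j] g) φ

/-- The multi-indices `α` with `|α| = s`. -/
def multiIndices (d s : ℕ) : Finset (Fin d → ℕ) := Finset.piAntidiag Finset.univ s

/-- The norm `‖φ‖_{L²(Λ)}`. -/
def normL2 {d : ℕ} (φ : Space d → ℝ) : ℝ := Real.sqrt (∫ x in cell d, φ x ^ 2)

/-- `‖∂_x^s φ‖_{L²(Λ)} = (∑_{|α| = s} ‖∂_x^α φ‖²_{L²(Λ)})^{1/2}`. -/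
def derivNorm {d : ℕ} (s : ℕ) (φ : Space d → ℝ) : ℝ :=
  Real.sqrt (∑ α ∈ multiIndices d s, normL2 (multiDeriv α φ) ^ 2)

/-- `‖∂_x^s g(φ)‖_{L²(Λ)}` for a vector `g = (g_1, …, g_d)`, summed over all components. -/
def derivNormVec {d : ℕ} (s : ℕ) (f : ℝ → Space d) (φ : Space d → ℝ) : ℝ :=
  Real.sqrt (∑ j, derivNorm s (fun x => f (φ x) j) ^ 2)

/-- `‖∂_x^s u‖_{L²(D_T)}` with `D_T = Λ × (0,T)`. -/
def derivNormDT {d : ℕ} (s : ℕ) (T : ℝ) (u : ℝ → Space d → ℝ) : ℝ :=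
  Real.sqrt (∑ α ∈ multiIndices d s, ∫ t in (0 : ℝ)..T, normL2 (multiDeriv α (u t)) ^ 2)

/-- `‖u‖_{L^∞(D_T)}` (for continuous `u` the essential supremum is the supremum). -/
def supNormDT {d : ℕ} (T : ℝ) (u : ℝ → Space d → ℝ) : ℝ :=
  sSup {r | ∃ t ∈ Set.Ioo 0 T, ∃ x ∈ cell d, r = |u t x|}

/-- `|f|_{C^k} = sup_{|v| ≤ U} |f^{(k)}(v)|`. -/
def fluxNorm {d : ℕ} (f : ℝ → Space d) (k : ℕ) (U : ℝ) : ℝ :=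
  sSup {r | ∃ v : ℝ, |v| ≤ U ∧ r = ‖iteratedDeriv k f v‖}

/-- `𝒦_k = c_k ∑_{j=1}^k |f|_{C^j} U^{j-1}`, where `U` bounds the argument of `f`. -/
def composConst {d : ℕ} (c : ℕ → ℝ) (f : ℝ → Space d) (U : ℝ) (k : ℕ) : ℝ :=
  c k * ∑ j ∈ Finset.Icc 1 k, fluxNorm f j U * U ^ (j - 1)

/-! ### The Lévy operator -/

/-- `μ` is a Lévy measure: `∫_{|z|>0} |z|² ∧ 1 dμ(z) < ∞`. -/
def IsLevy {d : ℕ} (μ : Measure (Space d)) : Prop :=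
  ∫⁻ z in {0}ᶜ, ENNReal.ofReal (min (‖z‖ ^ 2) 1) ∂μ < ⊤

/-- `μ(-B) = μ(B)` for all Borel sets `B ⊆ ℝ^d ∖ {0}`. -/
def IsSymm {d : ℕ} (μ : Measure (Space d)) : Prop :=
  ∀ B : Set (Space d), MeasurableSet B → 0 ∉ B → μ ((fun z => -z) ⁻¹' B) = μ B

/-- `ℒ^μ[φ](x) = ∫_{|z|>0} φ(x+z) - φ(x) - z·∂_xφ(x) 1_{|z|<1} dμ(z)`. -/
def levy {d : ℕ} (μ : Measure (Space d)) (φ : Space d → ℝ) (x : Space d) : ℝ :=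
  ∫ z in {0}ᶜ, (φ (x + z) - φ x - (Metric.ball 0 1).indicator (fun z => fderiv ℝ φ x z) z) ∂μ

/-- `G^μ(ξ) = ∫_{|z|>0} e^{iξ·z} - 1 - iξ·z 1_{|z|<1} dμ(z)`. -/
def levySymbol {d : ℕ} (μ : Measure (Space d)) (ξ : Fin d → ℤ) : ℂ :=
  ∫ z in {0}ᶜ, (character ξ z - 1 -
    (Metric.ball 0 1).indicator (fun z => Complex.I * (phase ξ z : ℂ)) z) ∂μ

/-! ### The spectral vanishing viscosity approximation -/

/-- The viscosity kernel `Q_N^{j,k}(x) = ∑_{m ≤ |ξ| ≤ N} Q̂_ξ e^{iξ·x}` with symbol `q`. -/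
def kernel {d : ℕ} (N : ℕ) (m : ℝ) (q : (Fin d → ℤ) → ℝ) (x : Space d) : ℂ :=
  ∑ ξ ∈ (modes d N).filter (fun ξ => m ≤ freqNorm ξ), (q ξ : ℂ) * character ξ x

/-- The periodic convolution `(K ∗ φ)(x) = (2π)^{-d} ∫_Λ K(x-y) φ(y) dy`, normalized so that it
multiplies Fourier coefficients. -/
def conv {d : ℕ} (K : Space d → ℂ) (φ : Space d → ℝ) (x : Space d) : ℂ :=
  ((2 * Real.pi : ℝ) ^ d : ℂ)⁻¹ * ∫ y in cell d, K (x - y) * (φ y : ℂ)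

/-- The conditions on the Fourier coefficients `Q̂_ξ^{j,k}(t)` of the viscosity kernels, with
viscosity-free spectrum `m` and constant `CQ`. -/
structure IsViscosity {d : ℕ} (N : ℕ) (T m CQ : ℝ)
    (Q : Fin d → Fin d → ℝ → (Fin d → ℤ) → ℝ) : Prop where
  spherical : ∀ j k, ∀ t ∈ Set.Icc 0 T, ∀ ξ η : Fin d → ℤ,
    m ≤ freqNorm ξ → freqNorm ξ ≤ N → freqNorm ξ = freqNorm η → Q j k t ξ = Q j k t η
  monotone : ∀ j k, ∀ t ∈ Set.Icc 0 T, ∀ ξ η : Fin d → ℤ,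
    m ≤ freqNorm ξ → freqNorm ξ ≤ freqNorm η → freqNorm η ≤ N → Q j k t ξ ≤ Q j k t η
  bound : ∀ j k, ∀ t ∈ Set.Icc 0 T, ∀ ξ : Fin d → ℤ, m ≤ freqNorm ξ → freqNorm ξ ≤ N →
    |Q j k t ξ - (if j = k then 1 else 0)| ≤ CQ * m ^ 2 / freqNorm ξ ^ 2

/-- `u` is a solution on `[0,T]` of the SVV Fourier–Galerkin approximation
`∂_t u + ∂_x · P_N f(u) = ℒ^μ[u] + ε ∑_{j,k} ∂_{jk}² Q^{j,k} ∗ u`, `u(·,0) = P_N u₀`,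
where each `u(·,t)` is an `N`-trigonometric polynomial. -/
structure IsSolution {d : ℕ} (N : ℕ) (T ε m : ℝ) (μ : Measure (Space d)) (f : ℝ → Space d)
    (Q : Fin d → Fin d → ℝ → (Fin d → ℤ) → ℝ) (u₀ : Space d → ℝ)
    (u : ℝ → Space d → ℝ) : Prop where
  trigPoly : ∀ t ∈ Set.Icc 0 T, IsTrigPoly N (u t)
  continuousOn : ∀ ξ, ContinuousOn (fun t => coeff (u t) ξ) (Set.Icc 0 T)
  differentiableAt : ∀ ξ, ∀ t ∈ Set.Ioo 0 T, DifferentiableAt ℝ (fun τ => coeff (u τ) ξ) t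
  equation : ∀ t ∈ Set.Ioo 0 T, ∀ x,
    ((deriv (fun τ => u τ x) t : ℝ) : ℂ)
        + ∑ j, pderiv j (proj N (fun y => f (u t y) j)) x
      = (levy μ (u t) x : ℂ)
        + (ε : ℂ) * ∑ j, ∑ k, pderiv j (pderiv k (conv (kernel N m (Q j k t)) (u t))) x
  initial : ∀ x, (u 0 x : ℂ) = proj N u₀ x

/-- The energy
`ε^s ‖∂_x^s u(·,t)‖ + ε^s (-∑_{|α|=s} ∑_{|ξ|≤N} G^μ(ξ) |ξ^α|² ∫_0^t |û_ξ(τ)|² dτ)^{1/2}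
  + ε^{s+1/2} ‖∂_x^{s+1} u‖_{L²(D_T)}`.
For symmetric `μ` the symbol `G^μ(ξ)` is real, so it equals its real part. -/
def energy {d : ℕ} (s N : ℕ) (T ε : ℝ) (μ : Measure (Space d)) (u : ℝ → Space d → ℝ)
    (t : ℝ) : ℝ :=
  ε ^ s * derivNorm s (u t)
  + ε ^ s * Real.sqrt (-∑ α ∈ multiIndices d s, ∑ ξ ∈ modes d N,
      (levySymbol μ ξ).re * (∏ i, (ξ i : ℝ) ^ α i) ^ 2 * ∫ τ in (0 : ℝ)..t, ‖coeff (u τ) ξ‖ ^ 2)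
  + ε ^ ((s : ℝ) + 1 / 2) * derivNormDT (s + 1) T u

end SVV

end

open MeasureTheory

noncomputable section

namespace SVV

/-! ### The periodicity cell -/

/-! By Parseval the estimate concerns the finitely many functions |û_ξ(t)|², summed with the weights
w_s(ξ) = ∑_{|α|=s} |ξ^α|². Testing the equation mode by mode (`exists_hasDerivAt_sum_weight`) leaves
three contributions. The real part of the Lévy symbol is nonpositive, so that term dissipates. The
viscosity symbol is |ξ|² up to an error of size m² (`viscosity_lower_bound`): it dissipates ε|ξ|²
w_s at the price of a growth rate of size ε m². Since ε m² (log N)^d is bounded, this growth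
contributes over [0,T] at most a quarter of the maximal energy once N is large, and is absorbed
(`energy_inequality`).

The third contribution is the flux. At order 0 it is the integral of an exact derivative and
vanishes (`flux_zero`). At order s ≥ 1, Young's inequality, Bessel's inequality and the composition
inequality bound it by half of the viscous dissipation plus a remainder 𝒦_s²/ε ∑ w_s |û_ξ|²
(`abs_flux_le`).

This remainder is handled in two ways. Since w_s ≤ |ξ|² w_{s-1}, its rescaled time integral is at
most 𝒦_s² times the dissipation of order s-1 (`IsSVV.order_succ`); iterating produces ∏ 𝒦_k, and the
lower bound on 𝒦_1 lets the product absorb the initial data (`exists_le_mul_prod`). Alternatively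
the frequencies are split at ε|ξ| = 2𝒦_s (`weight_interpolation`): the high ones are absorbed by the
viscosity, the low ones cost only the dissipation of order 0, which gives 𝒦_s^s ‖u₀‖ with no control
of intermediate initial norms (`IsSVV.order_succ_direct`).

The composition inequality (`exists_derivNormVec_le`) comes from expanding the derivatives of f(φ),
applying Hölder with exponents 2k/|β| to the blocks β, and interpolating each factor between the
supremum and the top order L² norm. The interpolation rests on integrating ∂_j(g |∂_j g|^{p-2} ∂_j
g) over a period, which makes the norms of successive derivatives an almost log-convex sequence. -/

theorem cell_subset_closedBall (d : ℕ) :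
    cell d ⊆ Metric.closedBall 0 (Real.sqrt (∑ _i : Fin d, (2 * Real.pi) ^ 2)) := by
  intro x hx
  rw [mem_closedBall_zero_iff, EuclideanSpace.norm_eq]
  refine Real.sqrt_le_sqrt (Finset.sum_le_sum fun i _ => ?_)
  have := hx i
  rw [Real.norm_eq_abs, sq_abs]
  nlinarith [this.1, this.2]

theorem integrableOn_cell {d : ℕ} {E : Type*} [NormedAddCommGroup E] {g : Space d → E}
    (hg : Continuous g) : IntegrableOn g (cell d) :=
  (hg.continuousOn.integrableOn_compact (isCompact_closedBall _ _)).mono_set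
    (cell_subset_closedBall d)

theorem volume_cell_lt_top (d : ℕ) : volume (cell d) < ⊤ :=
  (measure_mono (cell_subset_closedBall d)).trans_lt measure_closedBall_lt_top

instance isFiniteMeasure_restrict_cell (d : ℕ) :
    IsFiniteMeasure (volume.restrict (cell d)) :=
  ⟨by simpa using volume_cell_lt_top d⟩

/-- The divergence theorem and the volume of a box live on plain functions `Fin d → ℝ`; the change
of norm preserves volume. -/
theorem setIntegral_cell {d : ℕ} {E : Type*} [NormedAddCommGroup E] [NormedSpace ℝ E]
    (g : Space d → E) :
    ∫ x in cell d, g x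
      = ∫ y in Set.univ.pi fun _ : Fin d => Set.Ioo (0 : ℝ) (2 * Real.pi), g (WithLp.toLp 2 y) := by
  rw [← (PiLp.volume_preserving_toLp (Fin d)).setIntegral_preimage_emb
    (MeasurableEquiv.toLp 2 (Fin d → ℝ)).measurableEmbedding]
  congr 2
  ext y
  simp [cell]

/-- `g` is `2π`-periodic in every coordinate. -/
def IsPeriodic {d : ℕ} {E : Type*} (g : Space d → E) : Prop :=
  ∀ x j, g (x + EuclideanSpace.single j (2 * Real.pi)) = g x

/-- Divergence theorem for the field g e_j: its normal component vanishes on the faces i ≠ j, and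
the two faces i = j cancel by periodicity. Every spatial integration by parts below goes back to
this. -/
theorem integral_pderiv_eq_zero {d : ℕ} {E : Type*} [NormedAddCommGroup E] [NormedSpace ℝ E]
    [CompleteSpace E] {g : Space d → E} (hg : ContDiff ℝ 1 g) (hp : IsPeriodic g) (j : Fin d) :
    ∫ x in cell d, pderiv j g x = 0 := by
  obtain _ | n := d
  · exact j.elim0
  rw [setIntegral_cell, volume_pi, setIntegral_congr_set Measure.univ_pi_Ioo_ae_eq_Icc,
    ← volume_pi]
  set L : (Fin (n + 1) → ℝ) →L[ℝ] Space (n + 1) :=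
    (PiLp.continuousLinearEquiv 2 ℝ (fun _ : Fin (n + 1) => ℝ)).symm.toContinuousLinearMap with hL
  have hLx : ∀ y, L y = WithLp.toLp 2 y := fun y => rfl
  have hgd : Differentiable ℝ g := hg.differentiable (by norm_num)
  have hcd : Continuous (fderiv ℝ g) := hg.continuous_fderiv (by norm_num)
  have key := integral_divergence_of_hasFDerivAt_off_countable
    (fun _ : Fin (n + 1) => (0 : ℝ)) (fun _ => 2 * Real.pi)
    (fun _ => by positivity)
    (fun y => Pi.single j (g (L y)))
    (fun y => (ContinuousLinearMap.single ℝ (fun _ => E) j).comp ((fderiv ℝ g (L y)).comp L))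
    ∅ Set.countable_empty ?_ ?_ ?_
  · have h1 : ∀ y : Fin (n + 1) → ℝ, (∑ i : Fin (n + 1),
        ((ContinuousLinearMap.single ℝ (fun _ => E) j).comp ((fderiv ℝ g (L y)).comp L))
          (Pi.single i 1) i) = pderiv j g (WithLp.toLp 2 y) := by
      intro y
      rw [Finset.sum_eq_single j]
      · simp [pderiv, hLx]
      · intro i _ hi
        simp [hi]
      · simp
    simp only [h1] at key
    refine key.trans (Finset.sum_eq_zero fun i _ => ?_)
    rw [sub_eq_zero]
    congr 1
    ext y
    by_cases hij : i = j
    · subst hij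
      simp only [Pi.single_eq_same, hLx]
      rw [← hp (WithLp.toLp 2 (i.insertNth 0 y)) i]
      congr 1
      ext k
      by_cases hk : k = i
      · subst hk; simp
      · obtain ⟨k', rfl⟩ := Fin.exists_succAbove_eq hk
        simp
    · simp [hij]
  · refine Continuous.continuousOn ?_
    exact (ContinuousLinearMap.single ℝ (fun _ => E) j).continuous.comp
      (hg.continuous.comp L.continuous)
  · intro y _
    exact (ContinuousLinearMap.single ℝ (fun _ => E) j).hasFDerivAt.comp y
      ((hgd (L y)).hasFDerivAt.comp y L.hasFDerivAt)
  · refine ContinuousOn.integrableOn_compact isCompact_Icc (Continuous.continuousOn ?_)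
    refine continuous_finsetSum _ fun i _ => ?_
    have : Continuous fun y => (fderiv ℝ g (L y)) (L (Pi.single i 1)) :=
      (hcd.comp L.continuous).clm_apply continuous_const
    exact (continuous_apply i).comp
      ((ContinuousLinearMap.single ℝ (fun _ => E) j).continuous.comp this)

/-! ### Characters -/

/-- The phase as a linear functional. -/
def phaseL {d : ℕ} (ξ : Fin d → ℤ) : Space d →L[ℝ] ℝ :=
  ∑ i, (ξ i : ℝ) • EuclideanSpace.proj i

theorem phaseL_apply {d : ℕ} (ξ : Fin d → ℤ) (x : Space d) : phaseL ξ x = phase ξ x := by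
  simp [phaseL, phase]

theorem phase_add {d : ℕ} (ξ : Fin d → ℤ) (x y : Space d) :
    phase ξ (x + y) = phase ξ x + phase ξ y := by
  simp [← phaseL_apply]

theorem phase_single {d : ℕ} (ξ : Fin d → ℤ) (j : Fin d) (r : ℝ) :
    phase ξ (EuclideanSpace.single j r) = ξ j * r := by
  rw [phase, Finset.sum_eq_single j] <;> simp +contextual

theorem character_add {d : ℕ} (ξ : Fin d → ℤ) (x y : Space d) :
    character ξ (x + y) = character ξ x * character ξ y := by
  simp only [character, phase_add]
  rw [← Complex.exp_add]; push_cast; ring_nf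

theorem character_mul {d : ℕ} (ξ η : Fin d → ℤ) (x : Space d) :
    character ξ x * character η x = character (ξ + η) x := by
  simp only [character, phase]
  rw [← Complex.exp_add]
  congr 1
  push_cast
  simp [Finset.sum_add_distrib, add_mul, mul_add]

theorem character_zero {d : ℕ} (x : Space d) : character 0 x = 1 := by
  simp [character, phase]

theorem phase_neg_left {d : ℕ} (ξ : Fin d → ℤ) (x : Space d) : phase (-ξ) x = -phase ξ x := by
  simp [phase]

theorem character_neg_right {d : ℕ} (ξ : Fin d → ℤ) (x : Space d) :
    character ξ (-x) = character (-ξ) x := by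
  simp [character, phase]

theorem star_character {d : ℕ} (ξ : Fin d → ℤ) (x : Space d) :
    (starRingEnd ℂ) (character ξ x) = character (-ξ) x := by
  simp [character, ← Complex.exp_conj, phase_neg_left]

theorem norm_character {d : ℕ} (ξ : Fin d → ℤ) (x : Space d) : ‖character ξ x‖ = 1 := by
  rw [character, mul_comm, Complex.norm_exp_ofReal_mul_I]

theorem isPeriodic_character {d : ℕ} (ξ : Fin d → ℤ) : IsPeriodic (character ξ) := by
  intro x j
  rw [character_add]
  have : character ξ (EuclideanSpace.single j (2 * Real.pi)) = 1 := by
    rw [character, phase_single, Complex.exp_eq_one_iff]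
    exact ⟨ξ j, by push_cast; ring⟩
  rw [this, mul_one]

theorem contDiff_character {d : ℕ} (ξ : Fin d → ℤ) {n : WithTop ℕ∞} :
    ContDiff ℝ n (character ξ) := by
  have : character ξ = fun x => Complex.exp (Complex.I * (Complex.ofRealCLM (phaseL ξ x))) := by
    ext x; simp [character, phaseL_apply]
  rw [this]
  exact Complex.contDiff_exp.comp (contDiff_const.mul
    (Complex.ofRealCLM.contDiff.comp (phaseL ξ).contDiff))

theorem continuous_character {d : ℕ} (ξ : Fin d → ℤ) : Continuous (character ξ) :=
  (contDiff_character ξ (n := 0)).continuous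

theorem hasFDerivAt_character {d : ℕ} (ξ : Fin d → ℤ) (x : Space d) :
    HasFDerivAt (character ξ)
      ((character ξ x * Complex.I) • (Complex.ofRealCLM.comp (phaseL ξ))) x := by
  have h1 : HasFDerivAt (fun x => Complex.I * (Complex.ofRealCLM (phaseL ξ x)))
      (Complex.I • (Complex.ofRealCLM.comp (phaseL ξ))) x :=
    (Complex.ofRealCLM.comp (phaseL ξ)).hasFDerivAt.const_mul Complex.I
  have h2 := h1.cexp
  have e : (fun x => Complex.exp (Complex.I * (Complex.ofRealCLM (phaseL ξ x)))) = character ξ := by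
    ext x; simp [character, phaseL_apply]
  rw [e] at h2
  refine h2.congr_fderiv ?_
  rw [smul_smul, ← e]

theorem pderiv_character {d : ℕ} (ξ : Fin d → ℤ) (j : Fin d) (x : Space d) :
    pderiv j (character ξ) x = Complex.I * ξ j * character ξ x := by
  rw [pderiv, (hasFDerivAt_character ξ x).fderiv]
  simp [phaseL_apply, phase_single]
  ring

/-- If ξ_j ≠ 0, the character is a multiple of its own j-th derivative, whose integral over a period
vanishes. -/
theorem integral_character {d : ℕ} (ξ : Fin d → ℤ) :
    ∫ x in cell d, character ξ x = if ξ = 0 then ((2 * Real.pi : ℝ) ^ d : ℂ) else 0 := by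
  split_ifs with h
  · subst h
    simp only [character_zero]
    rw [setIntegral_cell, volume_pi, setIntegral_congr_set Measure.univ_pi_Ioo_ae_eq_Icc,
      ← volume_pi]
    simp only [setIntegral_const, measureReal_def, Real.volume_Icc_pi_toReal
      (a := fun _ : Fin d => (0 : ℝ)) (b := fun _ => 2 * Real.pi) (fun _ => by positivity)]
    simp
  · obtain ⟨j, hj⟩ := Function.ne_iff.mp h
    have := integral_pderiv_eq_zero (contDiff_character ξ) (isPeriodic_character ξ) j
    simp only [pderiv_character] at this
    rw [integral_const_mul] at this
    refine (mul_eq_zero.mp this).resolve_left ?_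
    exact mul_ne_zero Complex.I_ne_zero (by exact_mod_cast hj)

/-! ### Trigonometric polynomials -/

/-- The trigonometric polynomial `∑_{ξ ∈ S} c_ξ e^{iξ·x}`. -/
def trig {d : ℕ} (S : Finset (Fin d → ℤ)) (c : (Fin d → ℤ) → ℂ) (x : Space d) : ℂ :=
  ∑ ξ ∈ S, c ξ * character ξ x

theorem contDiff_trig {d : ℕ} (S : Finset (Fin d → ℤ)) (c : (Fin d → ℤ) → ℂ) {n : WithTop ℕ∞} :
    ContDiff ℝ n (trig S c) :=
  ContDiff.sum fun ξ _ => contDiff_const.mul (contDiff_character ξ)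

theorem continuous_trig {d : ℕ} (S : Finset (Fin d → ℤ)) (c : (Fin d → ℤ) → ℂ) :
    Continuous (trig S c) := (contDiff_trig S c (n := 0)).continuous

theorem isPeriodic_trig {d : ℕ} (S : Finset (Fin d → ℤ)) (c : (Fin d → ℤ) → ℂ) :
    IsPeriodic (trig S c) := fun x j =>
  Finset.sum_congr rfl fun ξ _ => by rw [isPeriodic_character ξ x j]

theorem hasFDerivAt_trig {d : ℕ} (S : Finset (Fin d → ℤ)) (c : (Fin d → ℤ) → ℂ) (x : Space d) :
    HasFDerivAt (trig S c) (∑ ξ ∈ S,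
      c ξ • ((character ξ x * Complex.I) • (Complex.ofRealCLM.comp (phaseL ξ)))) x :=
  HasFDerivAt.fun_sum fun ξ _ => (hasFDerivAt_character ξ x).const_mul (c ξ)

theorem pderiv_trig {d : ℕ} (S : Finset (Fin d → ℤ)) (c : (Fin d → ℤ) → ℂ) (j : Fin d) :
    pderiv j (trig S c) = trig S (fun ξ => Complex.I * ξ j * c ξ) := by
  ext x
  rw [pderiv, (hasFDerivAt_trig S c x).fderiv, sum_apply]
  refine Finset.sum_congr rfl fun ξ _ => ?_
  simp [phaseL_apply, phase_single]
  ring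

theorem integral_trig_mul_character {d : ℕ} (S : Finset (Fin d → ℤ)) (c : (Fin d → ℤ) → ℂ)
    (η : Fin d → ℤ) :
    ∫ x in cell d, trig S c x * character (-η) x
      = if η ∈ S then ((2 * Real.pi : ℝ) ^ d : ℂ) * c η else 0 := by
  have h : ∀ x, trig S c x * character (-η) x = ∑ ξ ∈ S, c ξ * character (ξ + -η) x := by
    intro x
    simp only [trig, Finset.sum_mul, mul_assoc, character_mul]
  simp only [h]
  rw [integral_finsetSum _ fun ξ _ =>
    (integrableOn_cell ((continuous_character _).const_mul (c ξ)))]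
  simp only [integral_const_mul, integral_character]
  rw [← Finset.sum_ite_eq' S η (fun ξ => ((2 * Real.pi : ℝ) ^ d : ℂ) * c ξ)]
  refine Finset.sum_congr rfl fun ξ _ => ?_
  by_cases hξ : ξ = η
  · subst hξ; simp [mul_comm]
  · have : ξ + -η ≠ 0 := by rwa [← sub_eq_add_neg, sub_ne_zero]
    simp [hξ, this]

theorem two_pi_pow_ne_zero (d : ℕ) : ((2 * Real.pi : ℝ) ^ d : ℂ) ≠ 0 := by
  exact_mod_cast (pow_pos (by positivity : (0 : ℝ) < 2 * Real.pi) d).ne'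

theorem trig_coeff_eq {d : ℕ} {S : Finset (Fin d → ℤ)} {a b : (Fin d → ℤ) → ℂ}
    (h : ∀ x, trig S a x = trig S b x) {ξ : Fin d → ℤ} (hξ : ξ ∈ S) : a ξ = b ξ := by
  have h1 := integral_trig_mul_character S a ξ
  have h2 := integral_trig_mul_character S b ξ
  simp only [h] at h1
  rw [h1] at h2
  simp only [hξ, if_true] at h2
  exact mul_left_cancel₀ (two_pi_pow_ne_zero d) h2

theorem coeff_eq_of_eq_trig {d : ℕ} {S : Finset (Fin d → ℤ)} {c : (Fin d → ℤ) → ℂ}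
    {φ : Space d → ℝ} (h : ∀ x, (φ x : ℂ) = trig S c x) {ξ : Fin d → ℤ} (hξ : ξ ∈ S) :
    coeff φ ξ = c ξ := by
  rw [coeff]
  simp only [h]
  rw [integral_trig_mul_character, if_pos hξ, ← mul_assoc, inv_mul_cancel₀ (two_pi_pow_ne_zero d),
    one_mul]

/-- As g is merely integrable, the same pairing serves Parseval, Bessel and the vanishing of the
flux at order 0. -/
theorem integral_mul_star_trig {d : ℕ} (S : Finset (Fin d → ℤ)) (c : (Fin d → ℤ) → ℂ)
    {g : Space d → ℝ} (hg : IntegrableOn g (cell d)) :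
    ∫ x in cell d, (g x : ℂ) * (starRingEnd ℂ) (trig S c x)
      = ((2 * Real.pi : ℝ) ^ d : ℂ) * ∑ ξ ∈ S, coeff g ξ * (starRingEnd ℂ) (c ξ) := by
  have h : ∀ x, (g x : ℂ) * (starRingEnd ℂ) (trig S c x)
      = ∑ ξ ∈ S, (starRingEnd ℂ) (c ξ) * ((g x : ℂ) * character (-ξ) x) := by
    intro x
    simp only [trig, map_sum, map_mul, star_character, Finset.mul_sum]
    exact Finset.sum_congr rfl fun ξ _ => by ring
  simp only [h]
  rw [integral_finsetSum]
  · simp only [integral_const_mul, Finset.mul_sum, coeff]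
    refine Finset.sum_congr rfl fun ξ _ => ?_
    have := two_pi_pow_ne_zero d
    field_simp
  · intro ξ _
    refine Integrable.const_mul ?_ _
    exact hg.ofReal.mul_bdd (c := 1) (continuous_character _).aestronglyMeasurable
      (Filter.Eventually.of_forall fun x => (norm_character _ x).le)

/-- Parseval's identity for real trigonometric polynomials. -/
theorem integral_sq_of_eq_trig {d : ℕ} {S : Finset (Fin d → ℤ)} {c : (Fin d → ℤ) → ℂ}
    {φ : Space d → ℝ} (h : ∀ x, (φ x : ℂ) = trig S c x) :
    ∫ x in cell d, φ x ^ 2 = (2 * Real.pi) ^ d * ∑ ξ ∈ S, ‖c ξ‖ ^ 2 := by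
  have hφ : Continuous φ := by
    have : φ = fun x => (trig S c x).re := by ext x; rw [← h]; simp
    rw [this]; exact Complex.continuous_re.comp (continuous_trig S c)
  have h1 := integral_mul_star_trig S c (integrableOn_cell hφ)
  have h2 : ∀ x, (φ x : ℂ) * (starRingEnd ℂ) (trig S c x) = ((φ x ^ 2 : ℝ) : ℂ) := by
    intro x; rw [← h]; simp [sq]
  simp only [h2] at h1
  rw [integral_complex_ofReal] at h1
  have h3 : ∑ ξ ∈ S, coeff φ ξ * (starRingEnd ℂ) (c ξ) = ((∑ ξ ∈ S, ‖c ξ‖ ^ 2 : ℝ) : ℂ) := by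
    rw [Complex.ofReal_sum]
    refine Finset.sum_congr rfl fun ξ hξ => ?_
    rw [coeff_eq_of_eq_trig h hξ, Complex.mul_conj, Complex.normSq_eq_norm_sq]
  rw [h3] at h1
  exact_mod_cast h1

theorem star_coeff {d : ℕ} (g : Space d → ℝ) (ξ : Fin d → ℤ) :
    (starRingEnd ℂ) (coeff g ξ) = coeff g (-ξ) := by
  rw [coeff, coeff, map_mul, ← integral_conj]
  simp only [map_mul, star_character, Complex.conj_ofReal, map_inv₀, map_pow, neg_neg]

theorem neg_mem_modes {d N : ℕ} {ξ : Fin d → ℤ} (h : ξ ∈ modes d N) : -ξ ∈ modes d N := by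
  rw [mem_modes] at h ⊢
  simpa [freqNorm] using h

/-- The set of modes is symmetric, and conjugation exchanges the coefficients at ξ and -ξ. -/
theorem star_proj {d : ℕ} (N : ℕ) (g : Space d → ℝ) (x : Space d) :
    (starRingEnd ℂ) (proj N g x) = proj N g x := by
  simp only [proj, map_sum, map_mul, star_coeff, star_character]
  exact Finset.sum_bij' (fun ξ _ => -ξ) (fun ξ _ => -ξ) (fun _ h => neg_mem_modes h)
    (fun _ h => neg_mem_modes h) (by simp) (by simp) (by simp)

theorem proj_eq_trig {d : ℕ} (N : ℕ) (g : Space d → ℝ) :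
    proj N g = trig (modes d N) (coeff g) := rfl

/-- Bessel's inequality. -/
theorem sum_coeff_sq_le {d : ℕ} (N : ℕ) {g : Space d → ℝ}
    (hg : MemLp g 2 (volume.restrict (cell d))) :
    (2 * Real.pi) ^ d * ∑ ξ ∈ modes d N, ‖coeff g ξ‖ ^ 2 ≤ ∫ x in cell d, g x ^ 2 := by
  set p : Space d → ℝ := fun x => (proj N g x).re with hp
  have hpc : ∀ x, (p x : ℂ) = trig (modes d N) (coeff g) x := fun x => by
    rw [← proj_eq_trig]
    exact Complex.conj_eq_iff_re.mp (star_proj N g x)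
  have hpcont : Continuous p :=
    Complex.continuous_re.comp (continuous_trig (modes d N) (coeff g))
  have hgi : IntegrableOn g (cell d) := hg.integrable (by norm_num)
  have h1 := integral_mul_star_trig (modes d N) (coeff g) hgi
  have h2 : ∀ x, (g x : ℂ) * (starRingEnd ℂ) (trig (modes d N) (coeff g) x)
      = ((g x * p x : ℝ) : ℂ) := by
    intro x; rw [← hpc]; simp
  simp only [h2] at h1
  rw [integral_complex_ofReal] at h1
  have h3 : ∑ ξ ∈ modes d N, coeff g ξ * (starRingEnd ℂ) (coeff g ξ)
      = ((∑ ξ ∈ modes d N, ‖coeff g ξ‖ ^ 2 : ℝ) : ℂ) := by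
    rw [Complex.ofReal_sum]
    refine Finset.sum_congr rfl fun ξ _ => ?_
    rw [Complex.mul_conj, Complex.normSq_eq_norm_sq]
  rw [h3] at h1
  have h4 : ∫ x in cell d, g x * p x
      = (2 * Real.pi) ^ d * ∑ ξ ∈ modes d N, ‖coeff g ξ‖ ^ 2 := by exact_mod_cast h1
  have h5 := integral_sq_of_eq_trig hpc
  have hpm : MemLp p 2 (volume.restrict (cell d)) := by
    rw [memLp_two_iff_integrable_sq hpcont.aestronglyMeasurable]
    exact integrableOn_cell (hpcont.pow 2)
  -- In the expanded square, ∫ g p and ∫ p² are the same coefficient sum, so nonnegativity is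
  -- Bessel's inequality.
  have h6 : 0 ≤ ∫ x in cell d, (g x - p x) ^ 2 := integral_nonneg fun x => sq_nonneg _
  have h7 : ∫ x in cell d, (g x - p x) ^ 2
      = ∫ x in cell d, g x ^ 2 - 2 * (g x * p x) + p x ^ 2 := by
    congr 1; ext x; ring
  rw [h7, integral_add, integral_sub, integral_const_mul, h4, h5] at h6
  · linarith
  · exact hg.integrable_sq
  · exact (hg.integrable_mul hpm).const_mul 2
  · exact hg.integrable_sq.sub ((hg.integrable_mul hpm).const_mul 2)
  · exact hpm.integrable_sq

theorem memLp_two_of_continuous {d : ℕ} {g : Space d → ℝ} (hg : Continuous g) :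
    MemLp g 2 (volume.restrict (cell d)) := by
  rw [memLp_two_iff_integrable_sq hg.aestronglyMeasurable]
  exact integrableOn_cell (hg.pow 2)

/-! ### Iterated directional derivatives -/

/-- The derivative `∂_{l₁} ⋯ ∂_{lₙ} g` along a list of coordinate directions. -/
def dirDeriv {d : ℕ} (l : List (Fin d)) (g : Space d → ℝ) : Space d → ℝ :=
  l.foldr (fun j g => pderiv j g) g

/-- The factor `∏ (i ξ_j)` by which `dirDeriv l` multiplies Fourier coefficients. -/
def dirSymbol {d : ℕ} (l : List (Fin d)) (ξ : Fin d → ℤ) : ℂ :=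
  (l.map fun j => Complex.I * (ξ j : ℂ)).prod

theorem IsPeriodic.pderiv {d : ℕ} {E : Type*} [NormedAddCommGroup E] [NormedSpace ℝ E]
    {g : Space d → E} (hg : IsPeriodic g) (j : Fin d) : IsPeriodic (pderiv j g) := by
  intro x k
  have h : (fun y => g (y + EuclideanSpace.single k (2 * Real.pi))) = g := funext fun y => hg y k
  conv_rhs => rw [SVV.pderiv, ← h]
  rw [SVV.pderiv, fderiv_comp_add_right]

theorem ContDiff.pderiv {d : ℕ} {E : Type*} [NormedAddCommGroup E] [NormedSpace ℝ E]
    {g : Space d → E} {n : ℕ} (hg : ContDiff ℝ (n + 1 : ℕ) g) (j : Fin d) :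
    ContDiff ℝ n (pderiv j g) :=
  (hg.fderiv_right (m := n) (by norm_cast)).clm_apply contDiff_const

theorem contDiff_dirDeriv {d : ℕ} {g : Space d → ℝ} {n : ℕ} (l : List (Fin d))
    (hg : ContDiff ℝ (n + l.length : ℕ) g) : ContDiff ℝ n (dirDeriv l g) := by
  induction l generalizing n with
  | nil => simpa [dirDeriv] using hg
  | cons j l ih =>
    exact ContDiff.pderiv (ih (n := n + 1) (by convert hg using 2; simp; ring)) j

theorem isPeriodic_dirDeriv {d : ℕ} {g : Space d → ℝ} (hg : IsPeriodic g) (l : List (Fin d)) :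
    IsPeriodic (dirDeriv l g) := by
  induction l with
  | nil => exact hg
  | cons j l ih => exact ih.pderiv j

theorem pderiv_ofReal {d : ℕ} {g : Space d → ℝ} (hg : Differentiable ℝ g) (j : Fin d)
    (x : Space d) : ((pderiv j g x : ℝ) : ℂ) = pderiv j (fun y => (g y : ℂ)) x := by
  have h := Complex.ofRealCLM.hasFDerivAt.comp x (hg x).hasFDerivAt
  have e : (Complex.ofRealCLM ∘ g) = fun y => (g y : ℂ) := rfl
  rw [e] at h
  rw [pderiv, pderiv, h.fderiv]
  rfl

theorem pderiv_mul {d : ℕ} {𝔸 : Type*} [NormedRing 𝔸] [NormedAlgebra ℝ 𝔸] {g h : Space d → 𝔸}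
    (hg : Differentiable ℝ g) (hh : Differentiable ℝ h) (j : Fin d) (x : Space d) :
    pderiv j (fun y => g y * h y) x = pderiv j g x * h x + g x * pderiv j h x := by
  have h1 : fderiv ℝ (fun y => g y * h y) x = _ :=
    ((hg x).hasFDerivAt.mul' (hh x).hasFDerivAt).fderiv
  rw [pderiv, h1]
  simp [pderiv, add_comm]

theorem coeff_pderiv {d : ℕ} {g : Space d → ℝ} (hg : ContDiff ℝ 1 g) (hp : IsPeriodic g)
    (j : Fin d) (ξ : Fin d → ℤ) : coeff (pderiv j g) ξ = Complex.I * ξ j * coeff g ξ := by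
  have hgd : Differentiable ℝ g := hg.differentiable (by norm_num)
  have hgc : ContDiff ℝ 1 (fun y => (g y : ℂ)) := Complex.ofRealCLM.contDiff.comp hg
  have hprod : ContDiff ℝ 1 (fun y => (g y : ℂ) * character (-ξ) y) :=
    hgc.mul (contDiff_character _)
  have h := integral_pderiv_eq_zero hprod
    (fun x k => by beta_reduce; rw [hp x k, isPeriodic_character _ x k]) j
  have h2 : ∀ x, pderiv j (fun y => (g y : ℂ) * character (-ξ) y) x
      = ((pderiv j g x : ℝ) : ℂ) * character (-ξ) x
        - Complex.I * ξ j * ((g x : ℂ) * character (-ξ) x) := by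
    intro x
    rw [pderiv_mul (hgc.differentiable (by norm_num))
      ((contDiff_character (-ξ) (n := 1)).differentiable (by norm_num)), pderiv_character,
      pderiv_ofReal hgd]
    push_cast [Pi.neg_apply]
    ring
  simp only [h2] at h
  rw [integral_sub, integral_const_mul, sub_eq_zero] at h
  · rw [coeff, coeff, h]; ring
  · refine integrableOn_cell (Continuous.mul ?_ (continuous_character _))
    exact Complex.continuous_ofReal.comp (ContDiff.pderiv (n := 0) hg j).continuous
  · exact (integrableOn_cell (hgc.continuous.mul (continuous_character _))).const_mul _

theorem coeff_dirDeriv {d : ℕ} {g : Space d → ℝ} (l : List (Fin d))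
    (hg : ContDiff ℝ l.length g) (hp : IsPeriodic g) (ξ : Fin d → ℤ) :
    coeff (dirDeriv l g) ξ = dirSymbol l ξ * coeff g ξ := by
  induction l with
  | nil => simp [dirDeriv, dirSymbol]
  | cons j l ih =>
    have h1 : ContDiff ℝ (1 : ℕ) (dirDeriv l g) :=
      contDiff_dirDeriv l (by simpa [add_comm] using hg)
    have h2 := coeff_pderiv (by exact_mod_cast h1) (isPeriodic_dirDeriv hp l) j ξ
    rw [show dirDeriv (j :: l) g = pderiv j (dirDeriv l g) from rfl, h2,
      ih (hg.of_le (by simp))]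
    simp [dirSymbol, mul_assoc]

theorem contDiff_of_eq_trig {d : ℕ} {S : Finset (Fin d → ℤ)} {c : (Fin d → ℤ) → ℂ}
    {φ : Space d → ℝ} (h : ∀ x, (φ x : ℂ) = trig S c x) {n : WithTop ℕ∞} : ContDiff ℝ n φ := by
  have : φ = fun x => Complex.reCLM (trig S c x) := by ext x; rw [← h]; simp
  rw [this]
  exact Complex.reCLM.contDiff.comp (contDiff_trig S c)

theorem isPeriodic_of_eq_trig {d : ℕ} {S : Finset (Fin d → ℤ)} {c : (Fin d → ℤ) → ℂ}
    {φ : Space d → ℝ} (h : ∀ x, (φ x : ℂ) = trig S c x) : IsPeriodic φ := fun x j => by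
  have := isPeriodic_trig S c x j
  rw [← h, ← h] at this
  exact_mod_cast this

theorem dirDeriv_of_eq_trig {d : ℕ} {S : Finset (Fin d → ℤ)} {c : (Fin d → ℤ) → ℂ}
    {φ : Space d → ℝ} (h : ∀ x, (φ x : ℂ) = trig S c x) (l : List (Fin d)) (x : Space d) :
    (dirDeriv l φ x : ℂ) = trig S (fun ξ => dirSymbol l ξ * c ξ) x := by
  induction l generalizing x with
  | nil => simpa [dirDeriv, dirSymbol] using h x
  | cons j l ih =>
    have hd : Differentiable ℝ (dirDeriv l φ) :=
      (contDiff_of_eq_trig ih (n := 1)).differentiable (by norm_num)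
    rw [show dirDeriv (j :: l) φ = pderiv j (dirDeriv l φ) from rfl, pderiv_ofReal hd]
    simp only [ih]
    rw [show (fun y => trig S (fun ξ => dirSymbol l ξ * c ξ) y)
      = trig S (fun ξ => dirSymbol l ξ * c ξ) from rfl, pderiv_trig]
    simp [dirSymbol, mul_assoc]

/-- The list of directions of a multi-index. -/
def dirList {d : ℕ} (α : Fin d → ℕ) : List (Fin d) :=
  (List.finRange d).flatMap fun j => List.replicate (α j) j

/-- Lists of directions allow induction on one derivative at a time; multi-indices reappear only as
the counts of a list. -/
theorem multiDeriv_eq_dirDeriv {d : ℕ} (α : Fin d → ℕ) (φ : Space d → ℝ) :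
    multiDeriv α φ = dirDeriv (dirList α) φ := by
  rw [multiDeriv, dirDeriv, dirList]
  induction List.finRange d with
  | nil => rfl
  | cons j L ih =>
    rw [List.foldr_cons, List.flatMap_cons, List.foldr_append, ← ih]
    generalize List.foldr (fun j g => (SVV.pderiv j)^[α j] g) φ L = g
    induction α j with
    | zero => rfl
    | succ n ihn => rw [Function.iterate_succ_apply', ihn]; rfl

theorem length_dirList {d : ℕ} (α : Fin d → ℕ) : (dirList α).length = ∑ i, α i := by
  simp [dirList, List.length_flatMap, Fin.sum_univ_def]

theorem mem_multiIndices {d s : ℕ} {α : Fin d → ℕ} : α ∈ multiIndices d s ↔ ∑ i, α i = s := by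
  simp [multiIndices]

theorem norm_dirSymbol {d : ℕ} (l : List (Fin d)) (ξ : Fin d → ℤ) :
    ‖dirSymbol l ξ‖ ^ 2 = (∏ i, (ξ i : ℝ) ^ l.count i) ^ 2 := by
  have h : ‖dirSymbol l ξ‖ = |∏ i, (ξ i : ℝ) ^ l.count i| := by
    induction l with
    | nil => simp [dirSymbol]
    | cons j l ih =>
      have e : ∏ i, (ξ i : ℝ) ^ (j :: l).count i = ξ j * ∏ i, (ξ i : ℝ) ^ l.count i := by
        simp only [List.count_cons, pow_add, Finset.prod_mul_distrib]
        rw [mul_comm, Finset.prod_eq_single j (fun i _ hi => by simp [hi.symm]) (by simp)]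
        simp
      rw [e, abs_mul, ← ih]
      simp [dirSymbol]
  rw [h, sq_abs]

theorem count_dirList {d : ℕ} (α : Fin d → ℕ) (i : Fin d) : (dirList α).count i = α i := by
  simp only [dirList, List.count_flatMap, Function.comp_def, List.count_replicate]
  rw [← Fin.sum_univ_def]
  simp

/-- The weight `∑_{|α| = s} |ξ^α|²` of the `s`-th order seminorm. -/
def weight {d : ℕ} (s : ℕ) (ξ : Fin d → ℤ) : ℝ :=
  ∑ α ∈ multiIndices d s, (∏ i, (ξ i : ℝ) ^ α i) ^ 2

theorem weight_nonneg {d : ℕ} (s : ℕ) (ξ : Fin d → ℤ) : 0 ≤ weight s ξ :=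
  Finset.sum_nonneg fun _ _ => sq_nonneg _

theorem weight_zero {d : ℕ} (ξ : Fin d → ℤ) : weight 0 ξ = 1 := by
  simp [weight, multiIndices]

theorem freqNorm_sq {d : ℕ} (ξ : Fin d → ℤ) : freqNorm ξ ^ 2 = ∑ i, (ξ i : ℝ) ^ 2 :=
  Real.sq_sqrt (Finset.sum_nonneg fun _ _ => sq_nonneg _)

/-- A unit can be removed from any nonzero entry. The choice of entry is not unique, so this is only
a covering. -/
theorem multiIndices_succ_subset (d s : ℕ) :
    multiIndices d (s + 1) ⊆ ((Finset.univ : Finset (Fin d)) ×ˢ multiIndices d s).image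
      fun p => p.2 + (Pi.single p.1 1 : Fin d → ℕ) := by
  intro β hβ
  rw [mem_multiIndices] at hβ
  have : ∃ i, β i ≠ 0 := by
    by_contra! h
    simp [h] at hβ
  obtain ⟨i, hi⟩ := this
  have hle : (Pi.single i 1 : Fin d → ℕ) ≤ β := by
    intro j
    by_cases hj : j = i
    · subst hj
      rw [Pi.single_eq_same]
      exact Nat.one_le_iff_ne_zero.mpr hi
    · simp [hj]
  refine Finset.mem_image.mpr ⟨(i, β - Pi.single i 1), ?_, tsub_add_cancel_of_le hle⟩
  simp only [Finset.mem_product, Finset.mem_univ, true_and, mem_multiIndices]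
  have h2 : ∑ j, (β - Pi.single i 1 + Pi.single i 1 : Fin d → ℕ) j = s + 1 := by
    rw [tsub_add_cancel_of_le hle]; exact hβ
  simp only [Pi.add_apply, Finset.sum_add_distrib] at h2
  rw [Finset.sum_pi_single'] at h2
  simpa using h2

/-- Expanding |ξ|² w_s produces every monomial of order s+1 at least once. This links the
dissipation of order s to the norm of order s+1 without a combinatorial constant. -/
theorem weight_succ_le {d : ℕ} (s : ℕ) (ξ : Fin d → ℤ) :
    weight (s + 1) ξ ≤ freqNorm ξ ^ 2 * weight s ξ := by
  refine (Finset.sum_le_sum_of_subset_of_nonneg (multiIndices_succ_subset d s)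
    fun _ _ _ => sq_nonneg _).trans ?_
  refine (Finset.sum_image_le_of_nonneg
    (g := fun p : Fin d × (Fin d → ℕ) => p.2 + (Pi.single p.1 1 : Fin d → ℕ))
    (f := fun β : Fin d → ℕ => (∏ i, (ξ i : ℝ) ^ β i) ^ 2) fun _ _ => sq_nonneg _).trans ?_
  rw [freqNorm_sq, weight, Finset.sum_mul_sum, Finset.sum_product]
  refine le_of_eq (Finset.sum_congr rfl fun j _ => Finset.sum_congr rfl fun α _ => ?_)
  simp only [Pi.add_apply, pow_add, Finset.prod_mul_distrib, mul_pow]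
  rw [mul_comm, Finset.prod_eq_single j (fun i _ hi => by simp [hi]) (by simp)]
  simp

theorem weight_le {d : ℕ} (s : ℕ) (ξ : Fin d → ℤ) : weight s ξ ≤ (freqNorm ξ ^ 2) ^ s := by
  induction s with
  | zero => simp [weight_zero]
  | succ s ih =>
    refine (weight_succ_le s ξ).trans ?_
    rw [pow_succ' (freqNorm ξ ^ 2)]
    exact mul_le_mul_of_nonneg_left ih (sq_nonneg _)

/-! ### Seminorms -/

theorem normL2_sq {d : ℕ} (φ : Space d → ℝ) : normL2 φ ^ 2 = ∫ x in cell d, φ x ^ 2 :=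
  Real.sq_sqrt (integral_nonneg fun _ => sq_nonneg _)

theorem normL2_nonneg {d : ℕ} (φ : Space d → ℝ) : 0 ≤ normL2 φ := Real.sqrt_nonneg _

theorem derivNorm_sq {d : ℕ} (s : ℕ) (φ : Space d → ℝ) :
    derivNorm s φ ^ 2 = ∑ α ∈ multiIndices d s, normL2 (multiDeriv α φ) ^ 2 :=
  Real.sq_sqrt (Finset.sum_nonneg fun _ _ => sq_nonneg _)

theorem derivNorm_nonneg {d : ℕ} (s : ℕ) (φ : Space d → ℝ) : 0 ≤ derivNorm s φ :=
  Real.sqrt_nonneg _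

theorem normL2_dirDeriv_sq {d : ℕ} {S : Finset (Fin d → ℤ)} {c : (Fin d → ℤ) → ℂ}
    {φ : Space d → ℝ} (h : ∀ x, (φ x : ℂ) = trig S c x) (l : List (Fin d)) :
    normL2 (dirDeriv l φ) ^ 2
      = (2 * Real.pi) ^ d * ∑ ξ ∈ S, (∏ i, (ξ i : ℝ) ^ l.count i) ^ 2 * ‖c ξ‖ ^ 2 := by
  rw [normL2_sq, integral_sq_of_eq_trig (dirDeriv_of_eq_trig h l)]
  simp only [norm_mul, mul_pow, norm_dirSymbol]

theorem normL2_multiDeriv_sq {d : ℕ} {S : Finset (Fin d → ℤ)} {c : (Fin d → ℤ) → ℂ}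
    {φ : Space d → ℝ} (h : ∀ x, (φ x : ℂ) = trig S c x) (α : Fin d → ℕ) :
    normL2 (multiDeriv α φ) ^ 2
      = (2 * Real.pi) ^ d * ∑ ξ ∈ S, (∏ i, (ξ i : ℝ) ^ α i) ^ 2 * ‖c ξ‖ ^ 2 := by
  rw [multiDeriv_eq_dirDeriv, normL2_dirDeriv_sq h]
  simp only [count_dirList]

theorem derivNorm_sq_of_eq_trig {d : ℕ} {S : Finset (Fin d → ℤ)} {c : (Fin d → ℤ) → ℂ}
    {φ : Space d → ℝ} (h : ∀ x, (φ x : ℂ) = trig S c x) (s : ℕ) :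
    derivNorm s φ ^ 2 = (2 * Real.pi) ^ d * ∑ ξ ∈ S, weight s ξ * ‖c ξ‖ ^ 2 := by
  rw [derivNorm_sq]
  simp only [normL2_multiDeriv_sq h, weight, Finset.sum_mul]
  rw [← Finset.mul_sum, Finset.sum_comm]

/-- Parseval sees a list only through its counts, which form one of the multi-indices in the sum. -/
theorem normL2_dirDeriv_le_derivNorm {d : ℕ} {S : Finset (Fin d → ℤ)} {c : (Fin d → ℤ) → ℂ}
    {φ : Space d → ℝ} (h : ∀ x, (φ x : ℂ) = trig S c x) (l : List (Fin d)) :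
    normL2 (dirDeriv l φ) ≤ derivNorm l.length φ := by
  refine le_of_sq_le_sq ?_ (derivNorm_nonneg _ _)
  rw [derivNorm_sq, normL2_dirDeriv_sq h, ← normL2_multiDeriv_sq h]
  refine Finset.single_le_sum (f := fun α => normL2 (multiDeriv α φ) ^ 2)
    (fun _ _ => sq_nonneg _) ?_
  rw [mem_multiIndices]
  simpa using Multiset.sum_count_eq_card (s := Finset.univ) (m := (l : Multiset (Fin d))) (by simp)

/-- Bessel's inequality for the `s`-th order seminorm. -/
theorem sum_weight_coeff_sq_le {d s : ℕ} (N : ℕ) {g : Space d → ℝ} (hg : ContDiff ℝ s g)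
    (hp : IsPeriodic g) :
    (2 * Real.pi) ^ d * ∑ ξ ∈ modes d N, weight s ξ * ‖coeff g ξ‖ ^ 2 ≤ derivNorm s g ^ 2 := by
  rw [derivNorm_sq]
  simp only [weight, Finset.sum_mul]
  rw [Finset.sum_comm, Finset.mul_sum]
  refine Finset.sum_le_sum fun α hα => ?_
  rw [mem_multiIndices] at hα
  have hl : (dirList α).length = s := by rw [length_dirList, hα]
  have hg' : ContDiff ℝ (0 + (dirList α).length : ℕ) g := by simpa [hl] using hg
  have := sum_coeff_sq_le N (memLp_two_of_continuous (contDiff_dirDeriv _ hg').continuous)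
  rw [multiDeriv_eq_dirDeriv, normL2_sq]
  refine le_trans (le_of_eq ?_) this
  congr 1
  refine Finset.sum_congr rfl fun ξ _ => ?_
  rw [coeff_dirDeriv _ (by simpa using hg') hp, norm_mul, mul_pow, norm_dirSymbol]
  simp only [count_dirList]

/-! ### Hölder's inequality and Gagliardo–Nirenberg interpolation on the torus -/

theorem integral_prod_rpow_le {d : ℕ} {ι : Type*} (s : Finset ι) {f : ι → Space d → ℝ}
    (hf : ∀ i ∈ s, Continuous (f i)) (h0 : ∀ i ∈ s, ∀ x, 0 ≤ f i x) {p : ι → ℝ}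
    (hp : ∑ i ∈ s, p i = 1) (hp0 : ∀ i ∈ s, 0 ≤ p i) :
    ∫ x in cell d, ∏ i ∈ s, f i x ^ p i ≤ ∏ i ∈ s, (∫ x in cell d, f i x) ^ p i := by
  have hc : Continuous fun x => ∏ i ∈ s, f i x ^ p i :=
    continuous_finsetProd _ fun i hi => (hf i hi).rpow_const fun x => Or.inr (hp0 i hi)
  have hI : ∀ i ∈ s, 0 ≤ ∫ x in cell d, f i x := fun i hi => integral_nonneg (h0 i hi)
  rw [← ENNReal.ofReal_le_ofReal_iff
    (Finset.prod_nonneg fun i hi => Real.rpow_nonneg (hI i hi) _),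
    ofReal_integral_eq_lintegral_ofReal (integrableOn_cell hc)
    (Filter.Eventually.of_forall fun x =>
      Finset.prod_nonneg fun i hi => Real.rpow_nonneg (h0 i hi x) _)]
  have h1 : ∀ x, ENNReal.ofReal (∏ i ∈ s, f i x ^ p i)
      = ∏ i ∈ s, ENNReal.ofReal (f i x) ^ p i := fun x => by
    rw [ENNReal.ofReal_prod_of_nonneg fun i hi => Real.rpow_nonneg (h0 i hi x) _]
    exact Finset.prod_congr rfl fun i hi =>
      (ENNReal.ofReal_rpow_of_nonneg (h0 i hi x) (hp0 i hi)).symm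
  simp only [h1]
  refine (ENNReal.lintegral_prod_norm_pow_le s
    (fun i hi => (hf i hi).measurable.ennreal_ofReal.aemeasurable) hp hp0).trans (le_of_eq ?_)
  rw [ENNReal.ofReal_prod_of_nonneg fun i hi => Real.rpow_nonneg (hI i hi) _]
  refine Finset.prod_congr rfl fun i hi => ?_
  rw [← ENNReal.ofReal_rpow_of_nonneg (hI i hi) (hp0 i hi),
    ofReal_integral_eq_lintegral_ofReal (integrableOn_cell (hf i hi))
    (Filter.Eventually.of_forall (h0 i hi))]

/-- The norm `‖g‖_{L^q(Λ)}`. -/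
def normLq {d : ℕ} (q : ℝ) (g : Space d → ℝ) : ℝ := (∫ x in cell d, |g x| ^ q) ^ (1 / q)

theorem normLq_nonneg {d : ℕ} (q : ℝ) (g : Space d → ℝ) : 0 ≤ normLq q g :=
  Real.rpow_nonneg (integral_nonneg fun _ => Real.rpow_nonneg (abs_nonneg _) _) _

theorem normLq_two {d : ℕ} (g : Space d → ℝ) : normLq 2 g = normL2 g := by
  simp [normLq, normL2, Real.sqrt_eq_rpow]

/-- Makes |∂_j g|^{p-2} ∂_j g a C¹ multiplier. At 0 the difference quotient is |y|^{p-2}, which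
tends to 0 because p > 2. -/
theorem hasDerivAt_abs_rpow_mul {p : ℝ} (hp : 2 < p) (x : ℝ) :
    HasDerivAt (fun x : ℝ => |x| ^ (p - 2) * x) ((p - 1) * |x| ^ (p - 2)) x := by
  rcases eq_or_ne x 0 with rfl | hx
  · rw [abs_zero, Real.zero_rpow (by linarith), mul_zero, hasDerivAt_iff_tendsto_slope]
    have h : Filter.Tendsto (fun y : ℝ => |y| ^ (p - 2)) (nhdsWithin 0 {0}ᶜ) (nhds 0) := by
      have : Continuous fun y : ℝ => |y| ^ (p - 2) :=
        continuous_abs.rpow_const fun _ => Or.inr (by linarith)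
      have h2 := this.tendsto 0
      rw [abs_zero, Real.zero_rpow (by linarith)] at h2
      exact h2.mono_left nhdsWithin_le_nhds
    refine h.congr' ?_
    filter_upwards [self_mem_nhdsWithin] with y hy
    have hy : y ≠ 0 := hy
    simp [slope_def_field, hy]
  · have h1 : HasDerivAt (fun x : ℝ => |x|) (SignType.sign x : ℝ) x := hasDerivAt_abs hx
    have h2 := (h1.rpow_const (p := p - 2) (Or.inl (abs_ne_zero.mpr hx))).mul (hasDerivAt_id x)
    refine h2.congr_deriv ?_
    have e : |x| ^ (p - 2 - 1) * |x| = |x| ^ (p - 2) := by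
      rw [Real.rpow_sub_one (abs_ne_zero.mpr hx)]
      field_simp
    have e2 : (SignType.sign x : ℝ) * x = |x| := sign_mul_self x
    simp only [id]
    linear_combination (p - 2) * |x| ^ (p - 2 - 1) * e2 + (p - 2) * e

/-- The derivative ∂_j(g |∂_j g|^{p-2} ∂_j g) integrates to zero over a period; one of its two terms
is |∂_j g|^p. -/
theorem integral_abs_pderiv_rpow_le {d : ℕ} {g : Space d → ℝ} (hg : ContDiff ℝ (2 : ℕ) g)
    (hper : IsPeriodic g) (j : Fin d) {p : ℝ} (hp : 2 < p) :
    ∫ x in cell d, |pderiv j g x| ^ p ≤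
      (p - 1) * ∫ x in cell d,
        |g x| * |pderiv j g x| ^ (p - 2) * |pderiv j (pderiv j g) x| := by
  have h1 : ContDiff ℝ (1 : ℕ) (pderiv j g) := ContDiff.pderiv (n := 1) hg j
  have h2 : ContDiff ℝ (0 : ℕ) (pderiv j (pderiv j g)) := ContDiff.pderiv (n := 0) h1 j
  have hgc := hg.continuous
  have h1c := h1.continuous
  have h2c := h2.continuous
  have hpc : Continuous fun y : ℝ => |y| ^ (p - 2) :=
    continuous_abs.rpow_const fun _ => Or.inr (by linarith)
  have hF : ContDiff ℝ 1 (fun x : ℝ => |x| ^ (p - 2) * x) := by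
    rw [contDiff_one_iff_deriv]
    refine ⟨fun x => (hasDerivAt_abs_rpow_mul hp x).differentiableAt, ?_⟩
    rw [show deriv (fun x : ℝ => |x| ^ (p - 2) * x) = fun x => (p - 1) * |x| ^ (p - 2) from
      funext fun x => (hasDerivAt_abs_rpow_mul hp x).deriv]
    exact hpc.const_mul _
  set w : Space d → ℝ := fun x => |pderiv j g x| ^ (p - 2) * pderiv j g x with hw
  have hwC : ContDiff ℝ 1 w := hF.comp (by exact_mod_cast h1)
  have hwd : ∀ x, pderiv j w x
      = (p - 1) * |pderiv j g x| ^ (p - 2) * pderiv j (pderiv j g) x := fun x => by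
    have := ((hasDerivAt_abs_rpow_mul hp (pderiv j g x)).comp_hasFDerivAt x
      ((h1.differentiable (by norm_num)) x).hasFDerivAt).fderiv
    rw [pderiv, show w = (fun x : ℝ => |x| ^ (p - 2) * x) ∘ pderiv j g from rfl, this]
    simp [pderiv]
  have hz := integral_pderiv_eq_zero (g := fun x => g x * w x)
    ((hg.of_le (by norm_num)).mul hwC)
    (fun x k => by simp only [hw]; rw [hper x k, hper.pderiv j x k]) j
  have hd : ∀ x, pderiv j (fun x => g x * w x) x = |pderiv j g x| ^ p
      + (p - 1) * (g x * |pderiv j g x| ^ (p - 2) * pderiv j (pderiv j g) x) := fun x => by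
    rw [pderiv_mul (hg.differentiable (by norm_num)) (hwC.differentiable (by norm_num)), hwd]
    have : |pderiv j g x| ^ p = pderiv j g x * w x := by
      rw [hw, show pderiv j g x * (|pderiv j g x| ^ (p - 2) * pderiv j g x)
        = |pderiv j g x| ^ (p - 2) * |pderiv j g x| ^ (2 : ℝ) by
          rw [Real.rpow_two, sq_abs]; ring, ← Real.rpow_add_of_nonneg (abs_nonneg _)
          (by linarith) (by norm_num)]
      congr 1; ring
    rw [this]; ring
  simp only [hd] at hz
  have hi1 : IntegrableOn (fun x => |pderiv j g x| ^ p) (cell d) :=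
    integrableOn_cell (h1c.abs.rpow_const fun _ => Or.inr (by linarith))
  have hi2 : IntegrableOn (fun x =>
      g x * |pderiv j g x| ^ (p - 2) * pderiv j (pderiv j g) x) (cell d) :=
    integrableOn_cell ((hgc.mul (hpc.comp h1c)).mul h2c)
  rw [integral_add hi1 (hi2.const_mul _), integral_const_mul] at hz
  have hle : -∫ x in cell d, g x * |pderiv j g x| ^ (p - 2) * pderiv j (pderiv j g) x
      ≤ ∫ x in cell d, |g x| * |pderiv j g x| ^ (p - 2) * |pderiv j (pderiv j g) x| := by
    rw [← integral_neg]
    refine integral_mono hi2.neg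
      (integrableOn_cell ((hgc.abs.mul (hpc.comp h1c)).mul h2c.abs)) fun x => ?_
    refine (neg_le_abs _).trans (le_of_eq ?_)
    rw [abs_mul, abs_mul, abs_of_nonneg (Real.rpow_nonneg (abs_nonneg (pderiv j g x)) _)]
  have : 0 ≤ p - 1 := by linarith
  nlinarith [mul_le_mul_of_nonneg_left hle this]

/-- Absorption step: X will be ∫ |∂_j g|^p, which Hölder's inequality reproduces on the right with a
smaller exponent. -/
theorem sq_le_of_le_mul_rpow {X K p : ℝ} (hX : 0 ≤ X) (hK : 0 ≤ K) (hp : 2 < p)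
    (h : X ≤ K * X ^ (1 - 2 / p)) : (X ^ (1 / p)) ^ 2 ≤ K := by
  rcases hX.eq_or_lt with rfl | hX
  · rw [Real.zero_rpow (by positivity)]; simpa using hK
  · rw [Real.rpow_sub hX, Real.rpow_one] at h
    have h2 : (X ^ (1 / p)) ^ 2 = X ^ (2 / p) := by
      rw [← Real.rpow_natCast, ← Real.rpow_mul hX.le]; congr 1; push_cast; ring
    rw [h2]
    have h3 : 0 < X ^ (2 / p) := Real.rpow_pos_of_pos hX _
    rw [← mul_div_assoc, le_div_iff₀ h3] at h
    nlinarith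

theorem abs_eq_rpow_rpow {q : ℝ} (hq : q ≠ 0) (a : ℝ) : |a| = (|a| ^ q) ^ (1 / q) := by
  rw [← Real.rpow_mul (abs_nonneg _), mul_one_div_cancel hq, Real.rpow_one]

/-- Hölder with the three weights 1/q, 1 - 2/p and 1/r in the integration by parts, followed by
absorption. -/
theorem normLq_pderiv_sq_le {d : ℕ} {g : Space d → ℝ} (hg : ContDiff ℝ (2 : ℕ) g)
    (hper : IsPeriodic g) (j : Fin d) {p q r : ℝ} (hp : 2 < p) (hq : 0 < q) (hr : 0 < r)
    (hpqr : 1 / q + 1 / r = 2 / p) :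
    normLq p (pderiv j g) ^ 2 ≤ (p - 1) * (normLq q g * normLq r (pderiv j (pderiv j g))) := by
  have h1 : ContDiff ℝ (1 : ℕ) (pderiv j g) := ContDiff.pderiv (n := 1) hg j
  have h2 : ContDiff ℝ (0 : ℕ) (pderiv j (pderiv j g)) := ContDiff.pderiv (n := 0) h1 j
  have hp0 : (0 : ℝ) ≤ 1 - 2 / p := by rw [sub_nonneg, div_le_one (by linarith)]; exact hp.le
  refine sq_le_of_le_mul_rpow (integral_nonneg fun _ => Real.rpow_nonneg (abs_nonneg _) _)
    (mul_nonneg (by linarith) (mul_nonneg (normLq_nonneg _ _) (normLq_nonneg _ _))) hp ?_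
  refine (integral_abs_pderiv_rpow_le hg hper j hp).trans ?_
  rw [mul_assoc (p - 1)]
  refine mul_le_mul_of_nonneg_left ?_ (by linarith)
  have key := integral_prod_rpow_le (d := d) (Finset.univ : Finset (Fin 3))
    (f := ![fun x => |g x| ^ q, fun x => |pderiv j g x| ^ p,
      fun x => |pderiv j (pderiv j g) x| ^ r]) (p := ![1 / q, 1 - 2 / p, 1 / r]) ?_ ?_ ?_ ?_
  · simp only [Fin.prod_univ_three, Matrix.cons_val_zero, Matrix.cons_val_one,
      Matrix.cons_val_two, Matrix.tail_cons, Matrix.head_cons] at key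
    refine le_trans (le_of_eq ?_) (key.trans (le_of_eq ?_))
    · congr 1; ext x
      rw [← abs_eq_rpow_rpow hq.ne', ← abs_eq_rpow_rpow hr.ne', ← Real.rpow_mul (abs_nonneg _)]
      congr 3
      field_simp
    · simp only [normLq]; ring
  · intro i _
    fin_cases i
    · exact hg.continuous.abs.rpow_const fun _ => Or.inr hq.le
    · exact h1.continuous.abs.rpow_const fun _ => Or.inr (by linarith)
    · exact h2.continuous.abs.rpow_const fun _ => Or.inr hr.le
  · intro i _ x
    fin_cases i <;> exact Real.rpow_nonneg (abs_nonneg _) _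
  · simp [Fin.sum_univ_three]; simp at hpqr; linarith
  · intro i _
    fin_cases i
    · simp [hq.le]
    · simpa using hp0
    · simp [hr.le]

/-- The endpoint q = ∞, where a pointwise bound replaces the L^q norm of g and Hölder has only two
factors. -/
theorem normLq_pderiv_sq_le_of_bound {d : ℕ} {g : Space d → ℝ} (hg : ContDiff ℝ (2 : ℕ) g)
    (hper : IsPeriodic g) (j : Fin d) {p r U : ℝ} (hp : 2 < p) (hr : 0 < r)
    (hpr : 1 / r = 2 / p) (hU : ∀ x, |g x| ≤ U) :
    normLq p (pderiv j g) ^ 2 ≤ (p - 1) * (U * normLq r (pderiv j (pderiv j g))) := by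
  have h1 : ContDiff ℝ (1 : ℕ) (pderiv j g) := ContDiff.pderiv (n := 1) hg j
  have h2 : ContDiff ℝ (0 : ℕ) (pderiv j (pderiv j g)) := ContDiff.pderiv (n := 0) h1 j
  have hU0 : 0 ≤ U := (abs_nonneg _).trans (hU 0)
  have hp0 : (0 : ℝ) ≤ 1 - 2 / p := by rw [sub_nonneg, div_le_one (by linarith)]; exact hp.le
  have hpc : Continuous fun x => |pderiv j g x| ^ (p - 2) :=
    h1.continuous.abs.rpow_const fun _ => Or.inr (by linarith)
  refine sq_le_of_le_mul_rpow (integral_nonneg fun _ => Real.rpow_nonneg (abs_nonneg _) _)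
    (mul_nonneg (by linarith) (mul_nonneg hU0 (normLq_nonneg _ _))) hp ?_
  refine (integral_abs_pderiv_rpow_le hg hper j hp).trans ?_
  rw [mul_assoc (p - 1)]
  refine mul_le_mul_of_nonneg_left ?_ (by linarith)
  have hle : ∫ x in cell d, |g x| * |pderiv j g x| ^ (p - 2) * |pderiv j (pderiv j g) x|
      ≤ U * ∫ x in cell d, |pderiv j g x| ^ (p - 2) * |pderiv j (pderiv j g) x| := by
    rw [← integral_const_mul]
    refine integral_mono (integrableOn_cell ((hg.continuous.abs.mul hpc).mul h2.continuous.abs))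
      ((integrableOn_cell (hpc.mul h2.continuous.abs)).const_mul _) fun x => ?_
    beta_reduce
    rw [mul_assoc]
    exact mul_le_mul_of_nonneg_right (hU x)
      (mul_nonneg (Real.rpow_nonneg (abs_nonneg _) _) (abs_nonneg _))
  refine hle.trans ?_
  rw [mul_assoc]
  refine mul_le_mul_of_nonneg_left ?_ hU0
  have key := integral_prod_rpow_le (d := d) (Finset.univ : Finset (Fin 2))
    (f := ![fun x => |pderiv j g x| ^ p, fun x => |pderiv j (pderiv j g) x| ^ r])
    (p := ![1 - 2 / p, 1 / r]) ?_ ?_ ?_ ?_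
  · simp only [Fin.prod_univ_two, Matrix.cons_val_zero, Matrix.cons_val_one] at key
    refine le_trans (le_of_eq ?_) (key.trans (le_of_eq ?_))
    · congr 1; ext x
      rw [← abs_eq_rpow_rpow hr.ne', ← Real.rpow_mul (abs_nonneg _)]
      congr 2
      field_simp
    · simp only [normLq]; ring
  · intro i _
    fin_cases i
    · exact h1.continuous.abs.rpow_const fun _ => Or.inr (by linarith)
    · exact h2.continuous.abs.rpow_const fun _ => Or.inr hr.le
  · intro i _ x
    fin_cases i <;> exact Real.rpow_nonneg (abs_nonneg _) _
  · simp [Fin.sum_univ_two]; simp at hpr; linarith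
  · intro i _
    fin_cases i
    · simpa using hp0
    · simp [hr.le]

/-! ### Logarithmically convex sequences -/

/-- Root-free form of b_j ≤ b_0^{1/(j+1)} b_{j+1}^{j/(j+1)}. In the induction a common factor
b_{j+1}^j is cancelled, so b_{j+1} = 0 is treated apart. -/
theorem pow_succ_le_of_logConvex {b : ℕ → ℝ} {k : ℕ} (h0 : ∀ j, 0 ≤ b j)
    (h : ∀ j, j + 1 < k → b (j + 1) ^ 2 ≤ b j * b (j + 2)) {j : ℕ} (hj : j < k) :
    b j ^ (j + 1) ≤ b 0 * b (j + 1) ^ j := by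
  induction j with
  | zero => simp
  | succ j ih =>
    have ih := ih (by omega)
    rcases (h0 (j + 1)).eq_or_lt with hz | hpos
    · rw [← hz, zero_pow (by omega)]
      exact mul_nonneg (h0 _) (pow_nonneg (h0 _) _)
    · have h1 : (b (j + 1) ^ 2) ^ (j + 1) ≤ (b j * b (j + 2)) ^ (j + 1) :=
        pow_le_pow_left₀ (sq_nonneg _) (h j hj) _
      rw [mul_pow] at h1
      have h2 : b (j + 1) ^ j * b (j + 1) ^ (j + 2)
          ≤ b (j + 1) ^ j * (b 0 * b (j + 2) ^ (j + 1)) := by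
        calc b (j + 1) ^ j * b (j + 1) ^ (j + 2) = (b (j + 1) ^ 2) ^ (j + 1) := by ring
          _ ≤ _ := h1
          _ ≤ (b 0 * b (j + 1) ^ j) * b (j + 2) ^ (j + 1) :=
            mul_le_mul_of_nonneg_right ih (pow_nonneg (h0 _) _)
          _ = _ := by ring
      exact le_of_mul_le_mul_left h2 (pow_pos hpos _)

theorem pow_le_of_logConvex {b : ℕ → ℝ} {k : ℕ} (h0 : ∀ j, 0 ≤ b j)
    (h : ∀ j, j + 1 < k → b (j + 1) ^ 2 ≤ b j * b (j + 2)) (j n : ℕ) (hj : 1 ≤ j)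
    (hn : j + n ≤ k) : b j ^ (j + n) ≤ b 0 ^ n * b (j + n) ^ j := by
  induction n with
  | zero => simp
  | succ n ih =>
    have ih := ih (by omega)
    have h1 := pow_succ_le_of_logConvex h0 h (j := j + n) (by omega)
    refine (pow_le_pow_iff_left₀ (pow_nonneg (h0 _) _)
      (mul_nonneg (pow_nonneg (h0 _) _) (pow_nonneg (h0 _) _)) (n := j + n) (by omega)).mp ?_
    calc (b j ^ (j + (n + 1))) ^ (j + n) = (b j ^ (j + n)) ^ (j + n + 1) := by ring
      _ ≤ (b 0 ^ n * b (j + n) ^ j) ^ (j + n + 1) :=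
        pow_le_pow_left₀ (pow_nonneg (h0 _) _) ih _
      _ = b 0 ^ (n * (j + n + 1)) * (b (j + n) ^ (j + n + 1)) ^ j := by ring
      _ ≤ b 0 ^ (n * (j + n + 1)) * (b 0 * b (j + n + 1) ^ (j + n)) ^ j := by
        refine mul_le_mul_of_nonneg_left ?_ (pow_nonneg (h0 _) _)
        exact pow_le_pow_left₀ (pow_nonneg (h0 _) _) h1 _
      _ = (b 0 ^ (n + 1) * b (j + (n + 1)) ^ j) ^ (j + n) := by
        rw [show j + (n + 1) = j + n + 1 by ring]; ring

/-- The rescaled sequence L^{j²} M_j is log-convex: the second difference of j² is 2, which accounts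
for the factor L². -/
theorem pow_le_of_almost_logConvex {M : ℕ → ℝ} {k : ℕ} {L : ℝ} (hL : 1 ≤ L) (h0 : ∀ j, 0 ≤ M j)
    (h : ∀ j, j + 1 < k → M (j + 1) ^ 2 ≤ L ^ 2 * (M j * M (j + 2))) {j : ℕ} (hj : 1 ≤ j)
    (hjk : j ≤ k) : M j ^ k ≤ L ^ (k ^ 2 * j) * (M 0 ^ (k - j) * M k ^ j) := by
  obtain ⟨n, rfl⟩ := Nat.exists_eq_add_of_le hjk
  have hL0 : 0 ≤ L := by linarith
  have key := pow_le_of_logConvex (b := fun i => L ^ (i ^ 2) * M i) (k := j + n)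
    (fun i => mul_nonneg (pow_nonneg hL0 _) (h0 i)) ?_ j n hj le_rfl
  · rw [Nat.add_sub_cancel_left]
    calc M j ^ (j + n) ≤ (L ^ (j ^ 2) * M j) ^ (j + n) := by
          refine pow_le_pow_left₀ (h0 _) ?_ _
          exact le_mul_of_one_le_left (h0 _) (one_le_pow₀ hL)
      _ ≤ _ := key
      _ = _ := by simp only [mul_pow]; ring
  · intro i hi
    calc (L ^ (i + 1) ^ 2 * M (i + 1)) ^ 2 = L ^ (2 * (i + 1) ^ 2) * M (i + 1) ^ 2 := by ring
      _ ≤ L ^ (2 * (i + 1) ^ 2) * (L ^ 2 * (M i * M (i + 2))) :=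
        mul_le_mul_of_nonneg_left (h i hi) (pow_nonneg hL0 _)
      _ = _ := by ring

/-! ### Interpolation of intermediate derivatives -/

theorem dirDeriv_cons {d : ℕ} (j : Fin d) (l : List (Fin d)) (φ : Space d → ℝ) :
    dirDeriv (j :: l) φ = pderiv j (dirDeriv l φ) := rfl

/-- The largest `L^{2k/j}` norm of a `j`-th order derivative, with the value `U` for `j = 0`. -/
def maxDeriv {d : ℕ} (k : ℕ) (U : ℝ) (φ : Space d → ℝ) (j : ℕ) : ℝ :=
  if j = 0 then U
  else ⨆ l : List.Vector (Fin d) j, normLq (2 * k / j) (dirDeriv l.toList φ)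

theorem normLq_le_maxDeriv {d k : ℕ} {U : ℝ} {φ : Space d → ℝ} {l : List (Fin d)} (hl : l ≠ []) :
    normLq (2 * k / l.length) (dirDeriv l φ) ≤ maxDeriv k U φ l.length := by
  rw [maxDeriv, if_neg (by simpa using hl)]
  exact le_ciSup (f := fun l' : List.Vector (Fin d) l.length =>
    normLq (2 * k / l.length) (dirDeriv l'.toList φ)) (Set.finite_range _).bddAbove ⟨l, rfl⟩

theorem maxDeriv_nonneg {d k : ℕ} {U : ℝ} (hU : 0 ≤ U) (φ : Space d → ℝ) (j : ℕ) :
    0 ≤ maxDeriv k U φ j := by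
  rw [maxDeriv]
  split_ifs
  · exact hU
  · exact Real.iSup_nonneg fun _ => normLq_nonneg _ _

/-- The exponents 2k/j have reciprocals linear in j, so three consecutive ones satisfy the Hölder
relation. Differentiating twice in the same direction suffices, since the maximum ranges over all
lists. -/
theorem maxDeriv_sq_le {d k j : ℕ} {U : ℝ} {S : Finset (Fin d → ℤ)} {c : (Fin d → ℤ) → ℂ}
    {φ : Space d → ℝ} (h : ∀ x, (φ x : ℂ) = trig S c x) (hU : ∀ x, |φ x| ≤ U) (hj : j + 1 < k) :
    maxDeriv k U φ (j + 1) ^ 2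
      ≤ (2 * k : ℝ) ^ 2 * (maxDeriv k U φ j * maxDeriv k U φ (j + 2)) := by
  have hU0 : 0 ≤ U := (abs_nonneg _).trans (hU 0)
  have hM := maxDeriv_nonneg (k := k) hU0 φ
  have hk : (0 : ℝ) < k := by exact_mod_cast (by omega : 0 < k)
  have hk1 : (1 : ℝ) ≤ k := by exact_mod_cast (by omega : 1 ≤ k)
  have hjk : ((j : ℝ) + 1) < k := by exact_mod_cast hj
  have hp : (2 : ℝ) < 2 * k / (j + 1 : ℕ) := by
    push_cast
    rw [lt_div_iff₀ (by positivity)]; linarith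
  have hp2 : (2 * k / (j + 1 : ℕ) : ℝ) - 1 ≤ (2 * k) ^ 2 := by
    have : (2 * k / (j + 1 : ℕ) : ℝ) ≤ 2 * k := by
      refine div_le_self (by positivity) ?_
      push_cast; linarith [(Nat.cast_nonneg j : (0 : ℝ) ≤ j)]
    nlinarith
  refine (Real.le_sqrt (hM _) (mul_nonneg (sq_nonneg _) (mul_nonneg (hM _) (hM _)))).mp ?_
  rw [maxDeriv, if_neg (by omega)]
  refine Real.iSup_le (fun l => Real.le_sqrt_of_sq_le ?_) (Real.sqrt_nonneg _)
  obtain ⟨l, hl⟩ := l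
  obtain _ | ⟨i, l⟩ := l
  · simp at hl
  simp only [List.length_cons, Nat.add_right_cancel_iff] at hl
  have ht := dirDeriv_of_eq_trig h l
  have hR : normLq (2 * k / (j + 2 : ℕ)) (pderiv i (pderiv i (dirDeriv l φ)))
      ≤ maxDeriv k U φ (j + 2) := by
    have := normLq_le_maxDeriv (k := k) (U := U) (φ := φ) (l := i :: i :: l) (by simp)
    simpa [hl, dirDeriv_cons, add_assoc, one_add_one_eq_two] using this
  change normLq (2 * k / (j + 1 : ℕ)) (pderiv i (dirDeriv l φ)) ^ 2 ≤ _
  have hstep : normLq (2 * k / (j + 1 : ℕ)) (pderiv i (dirDeriv l φ)) ^ 2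
      ≤ ((2 * k / (j + 1 : ℕ) : ℝ) - 1) * (maxDeriv k U φ j *
        normLq (2 * k / (j + 2 : ℕ)) (pderiv i (pderiv i (dirDeriv l φ)))) := by
    -- At j = 0 the lower neighbour is the supremum bound U, which requires the endpoint inequality.
    rcases Nat.eq_zero_or_pos j with rfl | hj0
    · rw [List.length_eq_zero_iff] at hl
      subst hl
      refine normLq_pderiv_sq_le_of_bound (contDiff_of_eq_trig ht) (isPeriodic_of_eq_trig ht) i
        hp (by positivity) (by push_cast; field_simp) ?_
      simpa [maxDeriv, dirDeriv] using hU
    · have hj0' : (0 : ℝ) < j := by exact_mod_cast hj0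
      refine (normLq_pderiv_sq_le (contDiff_of_eq_trig ht) (isPeriodic_of_eq_trig ht) i
        (q := 2 * k / j) (r := 2 * k / (j + 2 : ℕ)) hp (by positivity) (by positivity)
        (by push_cast; field_simp; ring)).trans ?_
      refine mul_le_mul_of_nonneg_left ?_ (by linarith)
      refine mul_le_mul_of_nonneg_right ?_ (normLq_nonneg _ _)
      have := normLq_le_maxDeriv (k := k) (U := U) (φ := φ) (l := l)
        (by rintro rfl; simp at hl; omega)
      rwa [hl] at this
  exact hstep.trans (mul_le_mul hp2 (mul_le_mul_of_nonneg_left hR (hM _))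
    (mul_nonneg (hM _) (normLq_nonneg _ _)) (by positivity))

/-- Gagliardo–Nirenberg interpolation between the supremum and the top order `L²` norm. -/
theorem normLq_dirDeriv_pow_le {d k : ℕ} {U : ℝ} {S : Finset (Fin d → ℤ)}
    {c : (Fin d → ℤ) → ℂ} {φ : Space d → ℝ} (h : ∀ x, (φ x : ℂ) = trig S c x)
    (hU : ∀ x, |φ x| ≤ U) {l : List (Fin d)} (hl : l ≠ []) (hlk : l.length ≤ k) :
    normLq (2 * k / l.length) (dirDeriv l φ) ^ k
      ≤ (2 * k : ℝ) ^ (k ^ 2 * l.length) * (U ^ (k - l.length) * derivNorm k φ ^ l.length) := by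
  have hU0 : 0 ≤ U := (abs_nonneg _).trans (hU 0)
  have hl0 : 0 < l.length := List.length_pos_iff.mpr hl
  have hk1 : (1 : ℝ) ≤ k := by exact_mod_cast (by omega : 1 ≤ k)
  have hM := maxDeriv_nonneg (k := k) hU0 φ
  have h1 := pow_le_of_almost_logConvex (L := 2 * k) (by linarith) hM
    (fun j hj => maxDeriv_sq_le h hU hj) hl0 hlk
  -- At the top index the exponent 2k/k is 2, so the maximum is over L² norms.
  have h2 : maxDeriv k U φ k ≤ derivNorm k φ := by
    rw [maxDeriv, if_neg (by omega)]
    refine Real.iSup_le (fun l' => ?_) (derivNorm_nonneg _ _)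
    rw [mul_div_cancel_right₀ _ (by positivity), normLq_two]
    simpa using normL2_dirDeriv_le_derivNorm h l'.toList
  refine (pow_le_pow_left₀ (normLq_nonneg _ _) (normLq_le_maxDeriv hl) _).trans (h1.trans ?_)
  refine mul_le_mul_of_nonneg_left ?_ (by positivity)
  rw [show maxDeriv k U φ 0 = U from if_pos rfl]
  exact mul_le_mul_of_nonneg_left (pow_le_pow_left₀ (hM _) h2 _) (pow_nonneg hU0 _)

/-! ### Iterated derivatives of a composition -/

/-- The product `∏_{β ∈ τ} ∂_β φ`. -/
def derivProd {d : ℕ} (φ : Space d → ℝ) (τ : List (List (Fin d))) (x : Space d) : ℝ :=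
  (τ.map fun β => dirDeriv β φ x).prod

/-- The index lists of the terms of `∂_i ∏_{β ∈ τ} ∂_β φ`. -/
def leibniz {d : ℕ} (i : Fin d) : List (List (Fin d)) → List (List (List (Fin d)))
  | [] => []
  | β :: τ => ((i :: β) :: τ) :: (leibniz i τ).map fun σ => β :: σ

/-- The index lists of the terms in the expansion of `∂_l (h ∘ φ)`. -/
def faaDiBruno {d : ℕ} : List (Fin d) → List (List (List (Fin d)))
  | [] => [[]]
  | i :: l => (faaDiBruno l).flatMap fun τ => ([i] :: τ) :: leibniz i τ

theorem leibniz_spec {d : ℕ} (i : Fin d) (τ : List (List (Fin d))) :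
    ∀ σ ∈ leibniz i τ, σ.length = τ.length
      ∧ (σ.map List.length).sum = (τ.map List.length).sum + 1
      ∧ ((∀ β ∈ τ, β ≠ []) → ∀ β ∈ σ, β ≠ []) := by
  induction τ with
  | nil => simp [leibniz]
  | cons β τ ih =>
    intro σ hσ
    simp only [leibniz, List.mem_cons, List.mem_map] at hσ
    rcases hσ with rfl | ⟨σ, hσ, rfl⟩
    · refine ⟨rfl, by simp; ring, ?_⟩
      intro h γ hγ
      rcases List.mem_cons.mp hγ with rfl | hγ
      · simp
      · exact h γ (List.mem_cons_of_mem _ hγ)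
    · obtain ⟨h1, h2, h3⟩ := ih σ hσ
      refine ⟨by simp [h1], by simp [h2]; ring, ?_⟩
      intro h γ hγ
      rcases List.mem_cons.mp hγ with rfl | hγ
      · exact h _ List.mem_cons_self
      · exact h3 (fun β' hβ' => h β' (List.mem_cons_of_mem _ hβ')) γ hγ

/-- These invariants make |β|/k admissible Hölder weights when |l| = k, and keep the number of
blocks at most |l|. -/
theorem faaDiBruno_spec {d : ℕ} (l : List (Fin d)) :
    ∀ τ ∈ faaDiBruno l, (τ.map List.length).sum = l.length ∧ (∀ β ∈ τ, β ≠ []) := by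
  induction l with
  | nil => simp [faaDiBruno]
  | cons i l ih =>
    intro τ hτ
    simp only [faaDiBruno, List.mem_flatMap, List.mem_cons] at hτ
    obtain ⟨σ, hσ, rfl | hτ⟩ := hτ
    · obtain ⟨h1, h2⟩ := ih σ hσ
      exact ⟨by simp [h1]; ring, by simpa using h2⟩
    · obtain ⟨h1, h2⟩ := ih σ hσ
      obtain ⟨-, h3, h4⟩ := leibniz_spec i σ τ hτ
      exact ⟨by simp [h3, h1], h4 h2⟩

theorem length_le_sum_length {α : Type*} {τ : List (List α)} (h : ∀ β ∈ τ, β ≠ []) :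
    τ.length ≤ (τ.map List.length).sum := by
  induction τ with
  | nil => simp
  | cons β τ ih =>
    have h1 := ih fun γ hγ => h γ (List.mem_cons_of_mem _ hγ)
    have h2 := List.length_pos_iff.mpr (h β List.mem_cons_self)
    simp; omega

theorem sum_map_flatMap {α β : Type*} (L : List α) (g : α → List β) (F : β → ℝ) :
    ((L.flatMap g).map F).sum = (L.map fun a => ((g a).map F).sum).sum := by
  induction L with
  | nil => simp
  | cons a L ih => simp [ih]

section

variable {d : ℕ} {S : Finset (Fin d → ℤ)} {c : (Fin d → ℤ) → ℂ} {φ : Space d → ℝ}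

theorem differentiable_dirDeriv (h : ∀ x, (φ x : ℂ) = trig S c x) (β : List (Fin d)) :
    Differentiable ℝ (dirDeriv β φ) :=
  (contDiff_of_eq_trig (dirDeriv_of_eq_trig h β) (n := 1)).differentiable (by norm_num)

theorem differentiable_derivProd (h : ∀ x, (φ x : ℂ) = trig S c x) (τ : List (List (Fin d))) :
    Differentiable ℝ (derivProd φ τ) := by
  induction τ with
  | nil =>
    rw [show derivProd φ [] = fun _ => 1 from rfl]
    exact differentiable_const _
  | cons β τ ih =>
    have : derivProd φ (β :: τ) = fun x => dirDeriv β φ x * derivProd φ τ x := by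
      ext x; simp [derivProd]
    rw [this]
    exact (differentiable_dirDeriv h β).mul ih

theorem pderiv_derivProd (h : ∀ x, (φ x : ℂ) = trig S c x) (i : Fin d)
    (τ : List (List (Fin d))) (x : Space d) :
    pderiv i (derivProd φ τ) x = ((leibniz i τ).map fun σ => derivProd φ σ x).sum := by
  induction τ with
  | nil =>
    rw [show derivProd φ [] = fun _ => 1 from rfl]
    simp [leibniz, pderiv]
  | cons β τ ih =>
    have : derivProd φ (β :: τ) = fun x => dirDeriv β φ x * derivProd φ τ x := by
      ext x; simp [derivProd]
    rw [this, pderiv_mul (differentiable_dirDeriv h β) (differentiable_derivProd h τ), ih]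
    simp [leibniz, derivProd, dirDeriv_cons, Function.comp_def, List.sum_map_mul_left]

theorem pderiv_list_sum {ι : Type*} (L : List ι) {F : ι → Space d → ℝ}
    (hF : ∀ τ ∈ L, Differentiable ℝ (F τ)) (i : Fin d) (x : Space d) :
    Differentiable ℝ (fun x => (L.map fun τ => F τ x).sum) ∧
    pderiv i (fun x => (L.map fun τ => F τ x).sum) x = (L.map fun τ => pderiv i (F τ) x).sum := by
  induction L with
  | nil => simp [pderiv]
  | cons τ L ih =>
    obtain ⟨h1, h2⟩ := ih fun σ hσ => hF σ (List.mem_cons_of_mem _ hσ)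
    have h3 := hF τ List.mem_cons_self
    simp only [List.map_cons, List.sum_cons]
    refine ⟨h3.add h1, ?_⟩
    rw [← h2]
    simp only [pderiv]
    rw [fderiv_fun_add (h3 x) (h1 x)]
    rfl

/-- A new derivative either hits the outer function, raising its order and opening a block [i], or
enlarges an existing block. Hence the number of blocks is the order of the outer derivative. -/
theorem dirDeriv_comp (h : ∀ x, (φ x : ℂ) = trig S c x) {H : ℕ → ℝ → ℝ} (l : List (Fin d))
    (hH : ∀ n < l.length, ∀ v, HasDerivAt (H n) (H (n + 1) v) v) (x : Space d) :
    dirDeriv l (fun y => H 0 (φ y)) x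
      = ((faaDiBruno l).map fun τ => H τ.length (φ x) * derivProd φ τ x).sum := by
  have hφ : Differentiable ℝ φ := differentiable_dirDeriv h []
  induction l generalizing x with
  | nil => simp [dirDeriv, faaDiBruno, derivProd]
  | cons i l ih =>
    have ih := ih fun n hn => hH n (by simp; omega)
    have hlen : ∀ τ ∈ faaDiBruno l, τ.length < (i :: l).length := fun τ hτ => by
      obtain ⟨h1, h2⟩ := faaDiBruno_spec l τ hτ
      have := length_le_sum_length h2
      simp; omega
    have hHd : ∀ τ ∈ faaDiBruno l, ∀ y, HasFDerivAt (fun y => H τ.length (φ y))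
        (H (τ.length + 1) (φ y) • fderiv ℝ φ y) y := fun τ hτ y =>
      (hH τ.length (hlen τ hτ) (φ y)).comp_hasFDerivAt y (hφ y).hasFDerivAt
    rw [dirDeriv_cons, show dirDeriv l (fun y => H 0 (φ y)) = fun y =>
      ((faaDiBruno l).map fun τ => H τ.length (φ y) * derivProd φ τ y).sum from funext ih]
    rw [(pderiv_list_sum (F := fun τ y => H τ.length (φ y) * derivProd φ τ y) _ (fun τ hτ => (fun y => (hHd τ hτ y).differentiableAt.mul
      (differentiable_derivProd h τ y))) i x).2]
    rw [faaDiBruno, sum_map_flatMap]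
    congr 1
    refine List.map_congr_left fun τ hτ => ?_
    rw [pderiv_mul (fun y => (hHd τ hτ y).differentiableAt) (differentiable_derivProd h τ),
      pderiv_derivProd h, pderiv, (hHd τ hτ x).fderiv]
    simp only [List.map_cons, List.sum_cons, List.length_cons]
    congr 1
    · simp [derivProd, dirDeriv, pderiv]; ring
    · rw [← List.sum_map_mul_left]
      congr 1
      refine List.map_congr_left fun σ hσ => ?_
      rw [(leibniz_spec i τ σ hσ).1]

/-! ### The composition inequality -/

/-- Collects the interpolation bounds of all blocks. The exponent n of U is determined by an
additive identity, which avoids truncated subtraction. -/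
theorem prod_length_pow {A L U : ℝ} {k : ℕ} (τ : List (List (Fin d)))
    (hτk : ∀ β ∈ τ, β.length ≤ k) :
    ∃ n, n + (τ.map List.length).sum = k * τ.length ∧
      (τ.map fun β => L ^ (k ^ 2 * β.length) * (U ^ (k - β.length) * A ^ β.length)).prod
        = L ^ (k ^ 2 * (τ.map List.length).sum) * (U ^ n * A ^ (τ.map List.length).sum) := by
  induction τ with
  | nil => exact ⟨0, by simp⟩
  | cons β τ ih =>
    obtain ⟨n, hn, ih⟩ := ih fun γ hγ => hτk γ (List.mem_cons_of_mem _ hγ)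
    have hk := hτk β List.mem_cons_self
    refine ⟨n + (k - β.length), ?_, ?_⟩
    · simp only [List.map_cons, List.sum_cons, List.length_cons, Nat.mul_add, mul_one]
      omega
    · simp only [List.map_cons, List.prod_cons, List.sum_cons, ih]
      ring

/-- The interpolation bounds are for k-th powers, so the product is compared after raising it to the
power k. The top order norm then appears exactly to the power k, because the block lengths add up to
k. -/
theorem normL2_derivProd_le {k : ℕ} {U : ℝ} (h : ∀ x, (φ x : ℂ) = trig S c x)
    (hU : ∀ x, |φ x| ≤ U) (hk : 1 ≤ k) {τ : List (List (Fin d))}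
    (hτ : (τ.map List.length).sum = k) (hne : ∀ β ∈ τ, β ≠ []) :
    normL2 (derivProd φ τ)
      ≤ (2 * k : ℝ) ^ (k ^ 2) * (U ^ (τ.length - 1) * derivNorm k φ) := by
  have hU0 : 0 ≤ U := (abs_nonneg _).trans (hU 0)
  have hk0 : (0 : ℝ) < k := by exact_mod_cast hk
  have hlen : ∀ β ∈ τ, β.length ≤ k := fun β hβ => by
    rw [← hτ]
    exact List.single_le_sum (by simp) _ (List.mem_map_of_mem hβ)
  have hτ1 : 1 ≤ τ.length := by
    rcases τ with _ | ⟨β, τ⟩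
    · simp at hτ; omega
    · simp
  -- Hölder's inequality bounds the product by the product of the norms
  have hold : normL2 (derivProd φ τ)
      ≤ (τ.map fun β => normLq (2 * k / β.length) (dirDeriv β φ)).prod := by
    have hpos : ∀ i : Fin τ.length, (0 : ℝ) < (τ[i.1]).length := fun i => by
      exact_mod_cast List.length_pos_iff.mpr (hne _ (List.getElem_mem _))
    refine le_of_sq_le_sq ?_ (List.prod_nonneg ?_)
    · rw [normL2_sq, ← Fin.prod_univ_fun_getElem, ← Finset.prod_pow]
      have key := integral_prod_rpow_le (d := d) (Finset.univ : Finset (Fin τ.length))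
        (f := fun i x => |dirDeriv τ[i.1] φ x| ^ (2 * k / (τ[i.1]).length : ℝ))
        (p := fun i => (τ[i.1]).length / k) ?_ ?_ ?_ ?_
      · refine le_trans (le_of_eq ?_) (key.trans (le_of_eq ?_))
        · congr 1; ext x
          rw [derivProd, ← Fin.prod_univ_fun_getElem, ← Finset.prod_pow]
          refine Finset.prod_congr rfl fun i _ => ?_
          rw [← Real.rpow_mul (abs_nonneg _), show (2 * k / (τ[i.1]).length * ((τ[i.1]).length / k)
            : ℝ) = 2 by have := hpos i; field_simp, Real.rpow_two, sq_abs]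
        · refine Finset.prod_congr rfl fun i _ => ?_
          rw [normLq, ← Real.rpow_natCast, ← Real.rpow_mul
            (integral_nonneg fun _ => Real.rpow_nonneg (abs_nonneg _) _)]
          congr 1
          have := hpos i
          push_cast; field_simp
      · intro i _
        exact (differentiable_dirDeriv h _).continuous.abs.rpow_const fun _ =>
          Or.inr (by have := hpos i; positivity)
      · exact fun i _ x => Real.rpow_nonneg (abs_nonneg _) _
      · rw [← Finset.sum_div, div_eq_one_iff_eq hk0.ne', ← Nat.cast_sum,
          Fin.sum_univ_fun_getElem, hτ]
      · exact fun i _ => by positivity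
    · intro a ha
      obtain ⟨β, -, rfl⟩ := List.mem_map.mp ha
      exact normLq_nonneg _ _
  refine hold.trans ?_
  have hA := derivNorm_nonneg k φ
  set A := derivNorm k φ
  have hpow : (τ.map fun β => normLq (2 * k / β.length) (dirDeriv β φ)).prod ^ k
      ≤ (τ.map fun β =>
        (2 * k : ℝ) ^ (k ^ 2 * β.length) * (U ^ (k - β.length) * A ^ β.length)).prod := by
    rw [← Fin.prod_univ_fun_getElem, ← Fin.prod_univ_fun_getElem, ← Finset.prod_pow]
    exact Finset.prod_le_prod (fun i _ => pow_nonneg (normLq_nonneg _ _) _) fun i _ =>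
      normLq_dirDeriv_pow_le h hU (hne _ (List.getElem_mem _)) (hlen _ (List.getElem_mem _))
  have hrhs : 0 ≤ (2 * k : ℝ) ^ (k ^ 2) * (U ^ (τ.length - 1) * A) := by positivity
  refine (pow_le_pow_iff_left₀ (List.prod_nonneg ?_) hrhs (n := k) (by omega)).mp ?_
  · intro a ha
    obtain ⟨β, -, rfl⟩ := List.mem_map.mp ha
    exact normLq_nonneg _ _
  refine hpow.trans (le_of_eq ?_)
  obtain ⟨n, hn, e⟩ := prod_length_pow (A := A) (L := (2 * k : ℝ)) (U := U) τ hlen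
  rw [hτ] at e hn
  obtain ⟨m, hm⟩ := Nat.exists_eq_add_of_le hτ1
  -- With m = |τ| - 1 the power of U is a multiple of k, so the k-th root is exact.
  have hnm : n = m * k := by
    rw [hm, Nat.mul_add] at hn
    linarith
  rw [e, hm, Nat.add_sub_cancel_left, hnm]
  ring

theorem normL2_sum_le {ι : Type*} (L : Finset ι) {F : ι → Space d → ℝ}
    (hF : ∀ i ∈ L, Continuous (F i)) {B : ℝ} (hB : ∀ i ∈ L, normL2 (F i) ≤ B) (hB0 : 0 ≤ B) :
    normL2 (fun x => ∑ i ∈ L, F i x) ≤ L.card * B := by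
  refine le_of_sq_le_sq ?_ (by positivity)
  rw [normL2_sq]
  have hc : ∀ i ∈ L, IntegrableOn (fun x => F i x ^ 2) (cell d) := fun i hi =>
    integrableOn_cell ((hF i hi).pow 2)
  calc ∫ x in cell d, (∑ i ∈ L, F i x) ^ 2
      ≤ ∫ x in cell d, (L.card : ℝ) * ∑ i ∈ L, F i x ^ 2 :=
        integral_mono (integrableOn_cell ((continuous_finsetSum _ hF).pow 2))
          ((integrable_finsetSum _ hc).const_mul _) fun x => sq_sum_le_card_mul_sum_sq
    _ = L.card * ∑ i ∈ L, normL2 (F i) ^ 2 := by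
        rw [integral_const_mul, integral_finsetSum _ hc]
        simp only [normL2_sq]
    _ ≤ L.card * ∑ _i ∈ L, B ^ 2 := by
        refine mul_le_mul_of_nonneg_left (Finset.sum_le_sum fun i hi => ?_) (Nat.cast_nonneg _)
        exact pow_le_pow_left₀ (normL2_nonneg _) (hB i hi) 2
    _ = (L.card * B) ^ 2 := by rw [Finset.sum_const, nsmul_eq_mul]; ring

theorem normL2_mono {g h : Space d → ℝ} (hg : Continuous g) (hh : Continuous h)
    (hgh : ∀ x, |g x| ≤ |h x|) : normL2 g ≤ normL2 h :=
  Real.sqrt_le_sqrt (integral_mono (integrableOn_cell (hg.pow 2)) (integrableOn_cell (hh.pow 2))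
    fun x => sq_le_sq.mpr (hgh x))

theorem normL2_const_mul (a : ℝ) (g : Space d → ℝ) :
    normL2 (fun x => a * g x) = |a| * normL2 g := by
  simp only [normL2, mul_pow, integral_const_mul]
  rw [Real.sqrt_mul (sq_nonneg a), Real.sqrt_sq_eq_abs]

theorem normL2_dirDeriv_comp_le {k : ℕ} {U : ℝ} (h : ∀ x, (φ x : ℂ) = trig S c x)
    (hU : ∀ x, |φ x| ≤ U) (hk : 1 ≤ k) {H : ℕ → ℝ → ℝ} {l : List (Fin d)} (hl : l.length = k)
    (hH : ∀ n < k, ∀ v, HasDerivAt (H n) (H (n + 1) v) v) (hHc : Continuous (H k)) {F : ℕ → ℝ}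
    (hF : ∀ n ∈ Finset.Icc 1 k, ∀ v, |v| ≤ U → |H n v| ≤ F n) :
    normL2 (dirDeriv l (fun y => H 0 (φ y))) ≤ (faaDiBruno l).length *
      ((2 * k : ℝ) ^ (k ^ 2) * (∑ n ∈ Finset.Icc 1 k, F n * U ^ (n - 1)) * derivNorm k φ) := by
  have hU0 : 0 ≤ U := (abs_nonneg _).trans (hU 0)
  have hF0 : ∀ n ∈ Finset.Icc 1 k, 0 ≤ F n := fun n hn =>
    (abs_nonneg _).trans (hF n hn 0 (by simpa using hU0))
  have hφ : Continuous φ := (differentiable_dirDeriv h []).continuous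
  have hHcont : ∀ n ≤ k, Continuous (H n) := fun n hn => by
    rcases hn.eq_or_lt with rfl | hn
    · exact hHc
    · exact continuous_iff_continuousAt.mpr fun v => (hH n hn v).continuousAt
  have hspec : ∀ τ ∈ faaDiBruno l, (τ.map List.length).sum = k ∧ (∀ β ∈ τ, β ≠ []) ∧
      τ.length ∈ Finset.Icc 1 k := fun τ hτ => by
    obtain ⟨h1, h2⟩ := faaDiBruno_spec l τ hτ
    have h3 := length_le_sum_length h2
    refine ⟨h1.trans hl, h2, Finset.mem_Icc.mpr ⟨?_, by omega⟩⟩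
    rcases τ with _ | ⟨β, τ⟩
    · simp at h1; omega
    · simp
  have hcont : ∀ τ ∈ faaDiBruno l,
      Continuous fun x => H τ.length (φ x) * derivProd φ τ x := fun τ hτ =>
    ((hHcont _ (Finset.mem_Icc.mp (hspec τ hτ).2.2).2).comp hφ).mul
      (differentiable_derivProd h τ).continuous
  rw [show dirDeriv l (fun y => H 0 (φ y)) = fun x => ∑ i : Fin (faaDiBruno l).length,
      H (faaDiBruno l)[i.1].length (φ x) * derivProd φ (faaDiBruno l)[i.1] x from
    funext fun x => by
      rw [dirDeriv_comp h l (by rwa [hl]) x, ← Fin.sum_univ_fun_getElem]]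
  refine (normL2_sum_le _ (fun i _ => hcont _ (List.getElem_mem _)) (B :=
    (2 * k : ℝ) ^ (k ^ 2) * (∑ n ∈ Finset.Icc 1 k, F n * U ^ (n - 1)) * derivNorm k φ)
    (fun i _ => ?_) ?_).trans (by simp)
  · obtain ⟨h1, h2, h3⟩ := hspec _ (List.getElem_mem i.2)
    set τ := (faaDiBruno l)[i.1]
    have hcτ := (differentiable_derivProd h τ).continuous
    calc normL2 (fun x => H τ.length (φ x) * derivProd φ τ x)
        ≤ normL2 (fun x => F τ.length * derivProd φ τ x) := by
          refine normL2_mono (hcont _ (List.getElem_mem _)) (hcτ.const_mul _) fun x => ?_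
          rw [abs_mul, abs_mul, abs_of_nonneg (hF0 _ h3)]
          exact mul_le_mul_of_nonneg_right (hF _ h3 _ (hU x)) (abs_nonneg _)
      _ = F τ.length * normL2 (derivProd φ τ) := by
          rw [normL2_const_mul, abs_of_nonneg (hF0 _ h3)]
      _ ≤ F τ.length * ((2 * k : ℝ) ^ (k ^ 2) * (U ^ (τ.length - 1) * derivNorm k φ)) :=
          mul_le_mul_of_nonneg_left (normL2_derivProd_le h hU hk h1 h2) (hF0 _ h3)
      _ = (2 * k : ℝ) ^ (k ^ 2) * (F τ.length * U ^ (τ.length - 1)) * derivNorm k φ := by ring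
      _ ≤ _ := by
          refine mul_le_mul_of_nonneg_right (mul_le_mul_of_nonneg_left ?_ (by positivity))
            (derivNorm_nonneg _ _)
          exact Finset.single_le_sum (f := fun n => F n * U ^ (n - 1))
            (fun n hn => mul_nonneg (hF0 n hn) (pow_nonneg hU0 _)) h3
  · refine mul_nonneg (mul_nonneg (by positivity) (Finset.sum_nonneg fun n hn =>
      mul_nonneg (hF0 n hn) (pow_nonneg hU0 _))) (derivNorm_nonneg _ _)

end

theorem norm_iteratedDeriv_le_fluxNorm {d k n : ℕ} {f : ℝ → Space d} (hf : ContDiff ℝ k f)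
    (hn : n ≤ k) {U v : ℝ} (hv : |v| ≤ U) : ‖iteratedDeriv n f v‖ ≤ fluxNorm f n U := by
  refine le_csSup ?_ ⟨v, hv, rfl⟩
  have hc : Continuous fun v => ‖iteratedDeriv n f v‖ :=
    (hf.continuous_iteratedDeriv n (by exact_mod_cast hn)).norm
  obtain ⟨C, hC⟩ := (isCompact_Icc (a := -U) (b := U)).bddAbove_image hc.continuousOn
  refine ⟨C, ?_⟩
  rintro r ⟨w, hw, rfl⟩
  exact hC ⟨w, abs_le.mp hw, rfl⟩

theorem fluxNorm_nonneg {d : ℕ} (f : ℝ → Space d) (k : ℕ) (U : ℝ) : 0 ≤ fluxNorm f k U :=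
  Real.sSup_nonneg fun _ ⟨_, _, h⟩ => h ▸ norm_nonneg _

/-- The composition inequality, with a constant that depends only on `d` and `k`. -/
theorem exists_derivNormVec_le (d k : ℕ) (hk : 1 ≤ k) :
    ∃ C : ℝ, 0 < C ∧ ∀ (N : ℕ) (f : ℝ → Space d) (φ : Space d → ℝ) (U : ℝ),
      ContDiff ℝ k f → IsTrigPoly N φ → (∀ x, |φ x| ≤ U) →
      derivNormVec k f φ
        ≤ C * (∑ j ∈ Finset.Icc 1 k, fluxNorm f j U * U ^ (j - 1)) * derivNorm k φ := by
  set a : (Fin d → ℕ) → ℝ := fun α =>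
    (faaDiBruno (dirList α)).length * (2 * k : ℝ) ^ (k ^ 2) with ha
  -- The summand 1 only secures strict positivity of the constant.
  refine ⟨1 + Real.sqrt (∑ _j : Fin d, ∑ α ∈ multiIndices d k, a α ^ 2), by positivity, ?_⟩
  intro N f φ U hf hφ hU
  have hU0 : 0 ≤ U := (abs_nonneg _).trans (hU 0)
  set B := (∑ j ∈ Finset.Icc 1 k, fluxNorm f j U * U ^ (j - 1)) * derivNorm k φ with hB
  have hB0 : 0 ≤ B := mul_nonneg (Finset.sum_nonneg fun n _ =>
    mul_nonneg (fluxNorm_nonneg _ _ _) (pow_nonneg hU0 _)) (derivNorm_nonneg _ _)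
  have hterm : ∀ j, ∀ α ∈ multiIndices d k,
      normL2 (multiDeriv α fun x => f (φ x) j) ≤ a α * B := by
    intro j α hα
    rw [mem_multiIndices] at hα
    rw [multiDeriv_eq_dirDeriv]
    refine (normL2_dirDeriv_comp_le (H := fun n v => iteratedDeriv n f v j) hφ hU hk
      (l := dirList α) ((length_dirList α).trans hα) ?_ ?_
      (F := fun n => fluxNorm f n U) ?_).trans (le_of_eq ?_)
    · intro n hn v
      have h1 : HasDerivAt (iteratedDeriv n f) (iteratedDeriv (n + 1) f v) v := by
        rw [iteratedDeriv_succ]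
        exact ((hf.differentiable_iteratedDeriv n (by exact_mod_cast hn)) v).hasDerivAt
      exact ((EuclideanSpace.proj (𝕜 := ℝ) j).hasFDerivAt.comp_hasDerivAt v h1)
    · exact (EuclideanSpace.proj (𝕜 := ℝ) j).continuous.comp
        (hf.continuous_iteratedDeriv k le_rfl)
    · intro n hn v hv
      refine le_trans ?_ (norm_iteratedDeriv_le_fluxNorm hf (Finset.mem_Icc.mp hn).2 hv)
      exact PiLp.norm_apply_le (iteratedDeriv n f v) j
    · rw [ha, hB]; ring
  rw [mul_assoc, ← hB, derivNormVec]
  refine Real.sqrt_le_iff.mpr ⟨by positivity, ?_⟩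
  simp only [derivNorm_sq]
  calc ∑ j, ∑ α ∈ multiIndices d k, normL2 (multiDeriv α fun x => f (φ x) j) ^ 2
      ≤ ∑ _j : Fin d, ∑ α ∈ multiIndices d k, (a α * B) ^ 2 :=
        Finset.sum_le_sum fun j _ => Finset.sum_le_sum fun α hα =>
          pow_le_pow_left₀ (normL2_nonneg _) (hterm j α hα) 2
    _ = (∑ _j : Fin d, ∑ α ∈ multiIndices d k, a α ^ 2) * B ^ 2 := by
        simp only [mul_pow, Finset.sum_mul]
    _ = (Real.sqrt (∑ _j : Fin d, ∑ α ∈ multiIndices d k, a α ^ 2) * B) ^ 2 := by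
        rw [mul_pow (Real.sqrt _), Real.sq_sqrt (by positivity)]
    _ ≤ _ := by gcongr; linarith

/-! ### The Lévy operator on trigonometric polynomials -/

section

variable {d : ℕ} {μ : Measure (Space d)}

/-- The integrand of the Lévy symbol. -/
def levyIntegrand {d : ℕ} (ξ : Fin d → ℤ) (z : Space d) : ℂ :=
  character ξ z - 1 - (Metric.ball 0 1).indicator (fun z => Complex.I * (phase ξ z : ℂ)) z

/-- Taylor's bound for |θ| ≤ 1; for larger |θ| the crude bound 2 + |θ| is already below 3θ². -/
theorem norm_exp_I_sub_le (θ : ℝ) :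
    ‖Complex.exp (Complex.I * θ) - 1 - Complex.I * θ‖ ≤ 3 * θ ^ 2 := by
  have hn : ‖Complex.I * (θ : ℂ)‖ = |θ| := by simp
  rcases le_or_gt |θ| 1 with h | h
  · have := Complex.norm_exp_sub_one_sub_id_le (x := Complex.I * θ) (by rwa [hn])
    rw [hn, sq_abs] at this
    nlinarith [sq_nonneg θ]
  · have h1 : ‖Complex.exp (Complex.I * θ)‖ = 1 := by
      rw [mul_comm, Complex.norm_exp_ofReal_mul_I]
    calc _ ≤ ‖Complex.exp (Complex.I * θ)‖ + ‖(1 : ℂ)‖ + ‖Complex.I * (θ : ℂ)‖ :=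
          (norm_sub_le _ _).trans (add_le_add_left (norm_sub_le _ _) _)
      _ = 2 + |θ| := by rw [h1, hn]; norm_num
      _ ≤ 3 * θ ^ 2 := by rw [← sq_abs]; nlinarith

theorem norm_levyIntegrand_le (ξ : Fin d → ℤ) (z : Space d) :
    ‖levyIntegrand ξ z‖ ≤ (3 * ‖phaseL ξ‖ ^ 2 + 2) * min (‖z‖ ^ 2) 1 := by
  rw [levyIntegrand]
  by_cases hz : z ∈ Metric.ball (0 : Space d) 1
  · rw [Set.indicator_of_mem hz]
    rw [mem_ball_zero_iff] at hz
    rw [min_eq_left (by nlinarith [norm_nonneg z])]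
    have h1 : phase ξ z ^ 2 ≤ (‖phaseL ξ‖ * ‖z‖) ^ 2 := by
      rw [← phaseL_apply, ← sq_abs]
      exact pow_le_pow_left₀ (abs_nonneg _) ((phaseL ξ).le_opNorm z) 2
    have h2 := norm_exp_I_sub_le (phase ξ z)
    refine h2.trans ?_
    nlinarith [sq_nonneg ‖z‖]
  · rw [Set.indicator_of_notMem hz, sub_zero]
    rw [mem_ball_zero_iff, not_lt] at hz
    rw [min_eq_right (by nlinarith [norm_nonneg z])]
    have := norm_sub_le (character ξ z) 1
    rw [norm_character, norm_one] at this
    nlinarith [sq_nonneg ‖phaseL ξ‖]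

theorem integrable_levyIntegrand (hμ : IsLevy μ) (ξ : Fin d → ℤ) :
    Integrable (levyIntegrand ξ) (μ.restrict {0}ᶜ) := by
  have hmin : Integrable (fun z : Space d => min (‖z‖ ^ 2) 1) (μ.restrict {0}ᶜ) := by
    refine ⟨((continuous_norm.pow 2).min continuous_const).aestronglyMeasurable, ?_⟩
    rw [hasFiniteIntegral_iff_ofReal (Filter.Eventually.of_forall fun z => by positivity)]
    exact hμ
  refine (hmin.const_mul (3 * ‖phaseL ξ‖ ^ 2 + 2)).mono' ?_
    (Filter.Eventually.of_forall fun z => norm_levyIntegrand_le ξ z)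
  have hph : Continuous fun z : Space d => Complex.I * (phase ξ z : ℂ) := by
    simp only [← phaseL_apply]
    exact continuous_const.mul (Complex.continuous_ofReal.comp (phaseL ξ).continuous)
  exact ((continuous_character ξ).sub continuous_const).aestronglyMeasurable.sub
    (hph.aestronglyMeasurable.indicator Metric.isOpen_ball.measurableSet)

/-- The compensator is purely imaginary, so the real part of the integrand is cos(ξ·z) - 1. -/
theorem levySymbol_re_nonpos (hμ : IsLevy μ) (ξ : Fin d → ℤ) : (levySymbol μ ξ).re ≤ 0 := by
  have h : (levySymbol μ ξ).re = ∫ z in {0}ᶜ, (levyIntegrand ξ z).re ∂μ :=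
    (Complex.reCLM.integral_comp_comm (integrable_levyIntegrand hμ ξ)).symm
  rw [h]
  refine integral_nonpos fun z => ?_
  have h1 : (character ξ z).re ≤ 1 := (Complex.re_le_norm _).trans (norm_character ξ z).le
  by_cases hz : z ∈ Metric.ball (0 : Space d) 1
  · simpa [levyIntegrand, Set.indicator_of_mem hz] using h1
  · simpa [levyIntegrand, Set.indicator_of_notMem hz] using h1

variable {S : Finset (Fin d → ℤ)} {c : (Fin d → ℤ) → ℂ} {φ : Space d → ℝ}

theorem fderiv_ofReal_of_eq_trig (h : ∀ x, (φ x : ℂ) = trig S c x) (x z : Space d) :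
    ((fderiv ℝ φ x z : ℝ) : ℂ)
      = ∑ ξ ∈ S, c ξ * character ξ x * (Complex.I * (phase ξ z : ℂ)) := by
  have hd : DifferentiableAt ℝ φ x := (contDiff_of_eq_trig h (n := 1)).differentiable (by norm_num) x
  have h1 := Complex.ofRealCLM.hasFDerivAt.comp x hd.hasFDerivAt
  rw [show (Complex.ofRealCLM ∘ φ) = trig S c from funext h] at h1
  have h2 := congrArg (fun L => L z) (h1.unique (hasFDerivAt_trig S c x))
  simp only [sum_apply] at h2
  refine h2.trans (Finset.sum_congr rfl fun ξ _ => ?_)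
  simp [phaseL_apply]
  ring

/-- Characters are eigenfunctions, and integrability of the symbol's integrand lets the finite sum
leave the integral. -/
theorem levy_of_eq_trig (hμ : IsLevy μ) (h : ∀ x, (φ x : ℂ) = trig S c x) (x : Space d) :
    (levy μ φ x : ℂ) = trig S (fun ξ => levySymbol μ ξ * c ξ) x := by
  have hpt : ∀ z, ((φ (x + z) - φ x
      - (Metric.ball 0 1).indicator (fun z => fderiv ℝ φ x z) z : ℝ) : ℂ)
      = ∑ ξ ∈ S, c ξ * character ξ x * levyIntegrand ξ z := by
    intro z
    have e : (((Metric.ball (0 : Space d) 1).indicator (fun z => fderiv ℝ φ x z) z : ℝ) : ℂ)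
        = ∑ ξ ∈ S, c ξ * character ξ x *
          (Metric.ball 0 1).indicator (fun z => Complex.I * (phase ξ z : ℂ)) z := by
      by_cases hz : z ∈ Metric.ball (0 : Space d) 1
      · simp only [Set.indicator_of_mem hz]
        exact fderiv_ofReal_of_eq_trig h x z
      · simp [Set.indicator_of_notMem hz]
    rw [Complex.ofReal_sub, Complex.ofReal_sub, e, h, h, trig, trig, ← Finset.sum_sub_distrib,
      ← Finset.sum_sub_distrib]
    refine Finset.sum_congr rfl fun ξ _ => ?_
    rw [levyIntegrand, character_add]
    ring
  rw [levy, ← integral_complex_ofReal]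
  simp only [hpt]
  rw [integral_finsetSum _ fun ξ _ => (integrable_levyIntegrand hμ ξ).const_mul _]
  refine Finset.sum_congr rfl fun ξ _ => ?_
  rw [integral_const_mul]
  change _ = (∫ z in {0}ᶜ, levyIntegrand ξ z ∂μ) * c ξ * character ξ x
  ring

/-! ### The viscosity kernel -/

theorem conv_kernel (N : ℕ) (m : ℝ) (q : (Fin d → ℤ) → ℝ) (hφ : Continuous φ) :
    conv (kernel N m q) φ
      = trig (modes d N) fun ξ => ((if m ≤ freqNorm ξ then q ξ else 0 : ℝ) : ℂ) * coeff φ ξ := by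
  ext x
  have h : ∀ y, kernel N m q (x - y) * (φ y : ℂ) = ∑ ξ ∈ modes d N,
      ((if m ≤ freqNorm ξ then q ξ else 0 : ℝ) : ℂ) * character ξ x *
        ((φ y : ℂ) * character (-ξ) y) := by
    intro y
    rw [kernel, Finset.sum_filter, Finset.sum_mul]
    refine Finset.sum_congr rfl fun ξ _ => ?_
    split_ifs
    · rw [sub_eq_add_neg, character_add, character_neg_right]; ring
    · simp
  simp only [conv, h]
  rw [integral_finsetSum]
  · rw [trig, Finset.mul_sum]
    refine Finset.sum_congr rfl fun ξ _ => ?_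
    rw [integral_const_mul, coeff]
    ring
  · intro ξ _
    exact (integrableOn_cell ((Complex.continuous_ofReal.comp hφ).mul
      (continuous_character _))).const_mul _

/-- For |ξ| ≥ m each of the d² deviations from the identity costs at most |CQ| m², since |ξ_j ξ_k| ≤
|ξ|². Below m the form is zero while |ξ|² ≤ m², which explains the summand 1. -/
theorem viscosity_lower_bound {N : ℕ} {T m CQ t : ℝ} {Q : Fin d → Fin d → ℝ → (Fin d → ℤ) → ℝ}
    (hQ : IsViscosity N T m CQ Q) (hm : 0 < m) (ht : t ∈ Set.Icc 0 T) {ξ : Fin d → ℤ}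
    (hξ : ξ ∈ modes d N) :
    freqNorm ξ ^ 2 - (1 + d ^ 2 * |CQ|) * m ^ 2
      ≤ ∑ j, ∑ k, (ξ j : ℝ) * ξ k * (if m ≤ freqNorm ξ then Q j k t ξ else 0) := by
  have hd : (0 : ℝ) ≤ d ^ 2 * |CQ| := by positivity
  split_ifs with h
  · have hpos : 0 < freqNorm ξ := hm.trans_le h
    have hcomp : ∀ j, |(ξ j : ℝ)| ≤ freqNorm ξ := fun j =>
      abs_le.mpr (abs_le_of_sq_le_sq' (by
        rw [freqNorm_sq]
        exact Finset.single_le_sum (f := fun i => (ξ i : ℝ) ^ 2) (fun _ _ => sq_nonneg _)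
          (Finset.mem_univ j)) hpos.le)
    have hdiag : ∑ j, ∑ k, (ξ j : ℝ) * ξ k * (if j = k then 1 else 0) = freqNorm ξ ^ 2 := by
      rw [freqNorm_sq]
      refine Finset.sum_congr rfl fun j _ => ?_
      simp [sq]
    have hterm : ∀ j k, (ξ j : ℝ) * ξ k * (if j = k then 1 else 0) - |CQ| * m ^ 2
        ≤ (ξ j : ℝ) * ξ k * Q j k t ξ := by
      intro j k
      have hb := hQ.bound j k t ht ξ h (mem_modes.mp hξ)
      have h1 : |(ξ j : ℝ) * ξ k * (Q j k t ξ - if j = k then 1 else 0)| ≤ |CQ| * m ^ 2 := by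
        rw [abs_mul, abs_mul]
        calc |(ξ j : ℝ)| * |(ξ k : ℝ)| * |Q j k t ξ - if j = k then 1 else 0|
            ≤ (freqNorm ξ * freqNorm ξ) * (CQ * m ^ 2 / freqNorm ξ ^ 2) := by
              gcongr
              · exact hcomp j
              · exact hcomp k
          _ = CQ * m ^ 2 := by field_simp
          _ ≤ |CQ| * m ^ 2 := by gcongr; exact le_abs_self _
      have := (abs_le.mp h1).1
      linarith
    have hsum : ∑ j : Fin d, ∑ k : Fin d,
        ((ξ j : ℝ) * ξ k * (if j = k then 1 else 0) - |CQ| * m ^ 2)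
        = freqNorm ξ ^ 2 - d ^ 2 * (|CQ| * m ^ 2) := by
      simp only [Finset.sum_sub_distrib, hdiag, Finset.sum_const, Finset.card_univ,
        Fintype.card_fin, nsmul_eq_mul]
      ring
    have hle := Finset.sum_le_sum (s := Finset.univ) fun j (_ : j ∈ Finset.univ) =>
      Finset.sum_le_sum (s := Finset.univ) fun k (_ : k ∈ Finset.univ) => hterm j k
    rw [hsum] at hle
    nlinarith [sq_nonneg m]
  · have h1 : freqNorm ξ ^ 2 ≤ m ^ 2 :=
      pow_le_pow_left₀ (Real.sqrt_nonneg _) (not_le.mp h).le 2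
    simp only [mul_zero, Finset.sum_const_zero]
    nlinarith [sq_nonneg m]

end

/-! ### The equation in Fourier space -/

theorem trig_add {d : ℕ} (S : Finset (Fin d → ℤ)) (a b : (Fin d → ℤ) → ℂ) (x : Space d) :
    trig S a x + trig S b x = trig S (fun ξ => a ξ + b ξ) x := by
  simp only [trig, add_mul, Finset.sum_add_distrib]

theorem mul_trig {d : ℕ} (S : Finset (Fin d → ℤ)) (r : ℂ) (a : (Fin d → ℤ) → ℂ) (x : Space d) :
    r * trig S a x = trig S (fun ξ => r * a ξ) x := by
  simp only [trig, Finset.mul_sum, mul_assoc]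

theorem trig_sum {d : ℕ} {ι : Type*} (s : Finset ι) (S : Finset (Fin d → ℤ))
    (a : ι → (Fin d → ℤ) → ℂ) (x : Space d) :
    ∑ i ∈ s, trig S (a i) x = trig S (fun ξ => ∑ i ∈ s, a i ξ) x := by
  simp only [trig, Finset.sum_mul]
  exact Finset.sum_comm

theorem IsPeriodic.comp {d : ℕ} {E F : Type*} {g : Space d → E} (hg : IsPeriodic g) (f : E → F) :
    IsPeriodic fun x => f (g x) := fun x j => congrArg f (hg x j)

section

variable {d N : ℕ} {T ε m : ℝ} {μ : Measure (Space d)} {f : ℝ → Space d}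
  {Q : Fin d → Fin d → ℝ → (Fin d → ℤ) → ℝ} {u₀ : Space d → ℝ} {u : ℝ → Space d → ℝ}

/-- Every term of the equation is a trigonometric polynomial on the same set of modes, so
coefficients can be compared. -/
theorem deriv_coeff (hu : IsSolution N T ε m μ f Q u₀ u) (hμ : IsLevy μ)
    {t : ℝ} (ht : t ∈ Set.Ioo 0 T) {ξ : Fin d → ℤ} (hξ : ξ ∈ modes d N) :
    deriv (fun τ => coeff (u τ) ξ) t =
      -(∑ j, Complex.I * ξ j * coeff (fun y => f (u t y) j) ξ)
      + levySymbol μ ξ * coeff (u t) ξ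
      - ε * ((∑ j, ∑ k, (ξ j : ℝ) * ξ k *
          (if m ≤ freqNorm ξ then Q j k t ξ else 0) : ℝ) : ℂ) * coeff (u t) ξ := by
  have htI : t ∈ Set.Icc 0 T := ⟨ht.1.le, ht.2.le⟩
  have hut := hu.trigPoly t htI
  have hutc : Continuous (u t) := (contDiff_of_eq_trig hut (n := 0)).continuous
  have hderiv : ∀ x, ((deriv (fun τ => u τ x) t : ℝ) : ℂ)
      = trig (modes d N) (fun ξ => deriv (fun τ => coeff (u τ) ξ) t) x := by
    intro x
    have h1 : HasDerivAt (fun τ => trig (modes d N) (coeff (u τ)) x)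
        (trig (modes d N) (fun ξ => deriv (fun τ => coeff (u τ) ξ) t) x) t :=
      HasDerivAt.fun_sum fun ξ _ => (hu.differentiableAt ξ t ht).hasDerivAt.mul_const _
    have h2 : (fun τ => u τ x) =ᶠ[nhds t] fun τ => (trig (modes d N) (coeff (u τ)) x).re := by
      filter_upwards [Icc_mem_nhds ht.1 ht.2] with τ hτ
      rw [← proj_eq_trig, ← hu.trigPoly τ hτ x, Complex.ofReal_re]
    have h3 : HasDerivAt (fun τ => trig (modes d N) (coeff (u τ)) x)
        ((deriv (fun τ => u τ x) t : ℝ) : ℂ) t := by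
      have h4 : HasDerivAt (fun τ => u τ x) (deriv (fun τ => u τ x) t) t :=
        ((Complex.reCLM.hasFDerivAt.comp_hasDerivAt t h1).congr_of_eventuallyEq
          h2).differentiableAt.hasDerivAt
      refine h4.ofReal_comp.congr_of_eventuallyEq ?_
      filter_upwards [Icc_mem_nhds ht.1 ht.2] with τ hτ
      rw [← proj_eq_trig, ← hu.trigPoly τ hτ x]
    exact h3.unique h1
  have hall : ∀ x, trig (modes d N) (fun ξ => deriv (fun τ => coeff (u τ) ξ) t
        + ∑ j, Complex.I * ξ j * coeff (fun y => f (u t y) j) ξ) x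
      = trig (modes d N) (fun ξ => levySymbol μ ξ * coeff (u t) ξ
        + ε * ∑ j, ∑ k, Complex.I * ξ j * (Complex.I * ξ k *
          (((if m ≤ freqNorm ξ then Q j k t ξ else 0 : ℝ) : ℂ) * coeff (u t) ξ))) x := by
    intro x
    have he := hu.equation t ht x
    rw [hderiv, levy_of_eq_trig hμ hut] at he
    simp only [proj_eq_trig, pderiv_trig, conv_kernel N m _ hutc] at he
    simp only [trig_sum, mul_trig, trig_add] at he
    exact he
  have h := trig_coeff_eq hall hξ
  rw [eq_sub_of_add_eq h]
  have hI : ∀ j k, Complex.I * ξ j * (Complex.I * ξ k *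
      (((if m ≤ freqNorm ξ then Q j k t ξ else 0 : ℝ) : ℂ) * coeff (u t) ξ))
      = -(((ξ j : ℝ) * ξ k * (if m ≤ freqNorm ξ then Q j k t ξ else 0) : ℝ) : ℂ)
        * coeff (u t) ξ := by
    intro j k
    have := Complex.I_mul_I
    push_cast
    linear_combination ((ξ j : ℂ) * ξ k *
      ((if m ≤ freqNorm ξ then Q j k t ξ else 0 : ℝ) : ℂ) * coeff (u t) ξ) * this
  simp only [hI, neg_mul, Finset.sum_neg_distrib, ← Finset.sum_mul, ← Complex.ofReal_sum]
  ring

end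

/-! ### The flux term -/

section

variable {d N : ℕ} {f : ℝ → Space d} {φ : Space d → ℝ}

/-- The `s`-th order energy flux `Re ∑_ξ w_s(ξ) conj(φ̂_ξ) ∑_j i ξ_j (f_j(φ))^_ξ`. -/
def flux (s N : ℕ) (f : ℝ → Space d) (φ : Space d → ℝ) : ℝ :=
  ∑ ξ ∈ modes d N, weight s ξ * ((starRingEnd ℂ) (coeff φ ξ) *
    ∑ j, Complex.I * ξ j * coeff (fun y => f (φ y) j) ξ).re

theorem contDiff_component_comp {n : ℕ} (hf : ContDiff ℝ n f) (hφ : IsTrigPoly N φ) (j : Fin d) :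
    ContDiff ℝ n fun y => f (φ y) j :=
  (EuclideanSpace.proj (𝕜 := ℝ) j).contDiff.comp (hf.comp (contDiff_of_eq_trig hφ))

/-- The integrand is ∂_j of Φ(φ), where Φ is the primitive of v g'(v). -/
theorem integral_mul_pderiv_comp_eq_zero {g : ℝ → ℝ} (hg : ContDiff ℝ 1 g)
    (hφ : IsTrigPoly N φ) (j : Fin d) :
    ∫ x in cell d, pderiv j (fun y => g (φ y)) x * φ x = 0 := by
  have hφc : ContDiff ℝ 1 φ := contDiff_of_eq_trig hφ
  have hgd : Differentiable ℝ g := hg.differentiable (by norm_num)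
  have hc : Continuous fun v => v * deriv g v :=
    continuous_id.mul (hg.continuous_deriv (by norm_num))
  have hF : ∀ v, HasDerivAt (fun v => ∫ r in (0 : ℝ)..v, r * deriv g r) (v * deriv g v) v :=
    fun v => hc.integral_hasStrictDerivAt 0 v |>.hasDerivAt
  have hFc : ContDiff ℝ 1 fun v => ∫ r in (0 : ℝ)..v, r * deriv g r := by
    rw [contDiff_one_iff_deriv]
    refine ⟨fun v => (hF v).differentiableAt, ?_⟩
    rw [show deriv (fun v => ∫ r in (0 : ℝ)..v, r * deriv g r) = fun v => v * deriv g v from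
      funext fun v => (hF v).deriv]
    exact hc
  have hz := integral_pderiv_eq_zero (hFc.comp hφc)
    ((isPeriodic_of_eq_trig hφ).comp fun v => ∫ r in (0 : ℝ)..v, r * deriv g r) j
  refine Eq.trans ?_ hz
  congr 1; ext x
  have hφd := (hφc.differentiable (by norm_num) x).hasFDerivAt
  have h1 := ((hF (φ x)).comp_hasFDerivAt x hφd).fderiv
  have h2 := ((hgd (φ x)).hasDerivAt.comp_hasFDerivAt x hφd).fderiv
  rw [pderiv, pderiv, h1, show (fun y => g (φ y)) = g ∘ φ from rfl, h2]
  simp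
  ring

/-- Tested against φ, which has only modes up to N, the projection P_N drops out and the unprojected
exact derivative remains. -/
theorem flux_zero (hf : ContDiff ℝ (1 : ℕ) f) (hφ : IsTrigPoly N φ) : flux 0 N f φ = 0 := by
  have hj : ∀ j, ∑ ξ ∈ modes d N, (Complex.I * ξ j * coeff (fun y => f (φ y) j) ξ)
      * (starRingEnd ℂ) (coeff φ ξ) = 0 := by
    intro j
    have hg : ContDiff ℝ (1 : ℕ) fun y => f (φ y) j := contDiff_component_comp hf hφ j
    have hp : IsPeriodic fun y => f (φ y) j := (isPeriodic_of_eq_trig hφ).comp fun v => f v j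
    have hgp := (ContDiff.pderiv (n := 0) hg j).continuous
    have h1 := integral_mul_star_trig (modes d N) (coeff φ) (integrableOn_cell hgp)
    have h2 : ∀ x, ((pderiv j (fun y => f (φ y) j) x : ℝ) : ℂ)
        * (starRingEnd ℂ) (trig (modes d N) (coeff φ) x)
        = ((pderiv j (fun y => f (φ y) j) x * φ x : ℝ) : ℂ) := by
      intro x
      rw [← proj_eq_trig, ← hφ x, Complex.conj_ofReal, Complex.ofReal_mul]
    simp only [h2] at h1
    have hfj : ContDiff ℝ 1 fun v => f v j :=
      (EuclideanSpace.proj (𝕜 := ℝ) j).contDiff.comp (by exact_mod_cast hf)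
    rw [integral_complex_ofReal, integral_mul_pderiv_comp_eq_zero hfj hφ j] at h1
    have h3 := (mul_eq_zero.mp h1.symm).resolve_left (two_pi_pow_ne_zero d)
    rw [← h3]
    refine Finset.sum_congr rfl fun ξ _ => ?_
    rw [coeff_pderiv (by exact_mod_cast hg) hp]
  have hsum : ∑ ξ ∈ modes d N, (starRingEnd ℂ) (coeff φ ξ) *
      ∑ j, Complex.I * ξ j * coeff (fun y => f (φ y) j) ξ = 0 := by
    simp only [Finset.mul_sum]
    rw [Finset.sum_comm]
    refine Finset.sum_eq_zero fun j _ => ?_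
    rw [← hj j]
    exact Finset.sum_congr rfl fun ξ _ => mul_comm _ _
  simp only [flux, weight_zero, one_mul]
  rw [← Complex.re_sum, hsum, Complex.zero_re]

/-- Young's inequality in each mode puts the factor ξ_j of the divergence on φ; Bessel and the
composition bound control f(φ). The parameter θ is free: ε serves the recursion over orders, ε/2 the
direct estimate. -/
theorem abs_flux_le {s : ℕ} (hf : ContDiff ℝ s f) (hφ : IsTrigPoly N φ) {K θ : ℝ} (hθ : 0 < θ)
    (hK : derivNormVec s f φ ≤ K * derivNorm s φ) :
    2 * |flux s N f φ| ≤ θ * ∑ ξ ∈ modes d N, freqNorm ξ ^ 2 * weight s ξ * ‖coeff φ ξ‖ ^ 2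
      + K ^ 2 / θ * ∑ ξ ∈ modes d N, weight s ξ * ‖coeff φ ξ‖ ^ 2 := by
  have hpt : ∀ ξ, 2 * |((starRingEnd ℂ) (coeff φ ξ) *
      ∑ j, Complex.I * ξ j * coeff (fun y => f (φ y) j) ξ).re|
      ≤ θ * (freqNorm ξ ^ 2 * ‖coeff φ ξ‖ ^ 2) + 1 / θ *
        ∑ j, ‖coeff (fun y => f (φ y) j) ξ‖ ^ 2 := by
    intro ξ
    calc _ ≤ 2 * ‖(starRingEnd ℂ) (coeff φ ξ) *
          ∑ j, Complex.I * ξ j * coeff (fun y => f (φ y) j) ξ‖ := by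
          gcongr; exact Complex.abs_re_le_norm _
      _ ≤ 2 * (‖coeff φ ξ‖ * ∑ j, |(ξ j : ℝ)| * ‖coeff (fun y => f (φ y) j) ξ‖) := by
          rw [norm_mul, RCLike.norm_conj]
          gcongr
          refine (norm_sum_le _ _).trans (Finset.sum_le_sum fun j _ => ?_)
          simp
      _ = ∑ j, 2 * ((|(ξ j : ℝ)| * ‖coeff φ ξ‖) * ‖coeff (fun y => f (φ y) j) ξ‖) := by
          rw [Finset.mul_sum, Finset.mul_sum]
          exact Finset.sum_congr rfl fun j _ => by ring
      _ ≤ ∑ j, (θ * ((ξ j : ℝ) ^ 2 * ‖coeff φ ξ‖ ^ 2)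
            + 1 / θ * ‖coeff (fun y => f (φ y) j) ξ‖ ^ 2) := by
          refine Finset.sum_le_sum fun j _ => ?_
          rw [← sq_abs (ξ j : ℝ)]
          generalize ‖coeff (fun y => f (φ y) j) ξ‖ = b
          have h : 0 ≤ 1 / θ * (θ * (|(ξ j : ℝ)| * ‖coeff φ ξ‖) - b) ^ 2 := by positivity
          have e : 1 / θ * (θ * (|(ξ j : ℝ)| * ‖coeff φ ξ‖) - b) ^ 2
              = θ * (|(ξ j : ℝ)| ^ 2 * ‖coeff φ ξ‖ ^ 2) + 1 / θ * b ^ 2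
                - 2 * ((|(ξ j : ℝ)| * ‖coeff φ ξ‖) * b) := by field_simp; ring
          linarith
      _ = _ := by
          rw [Finset.sum_add_distrib, ← Finset.mul_sum, ← Finset.mul_sum, ← Finset.sum_mul,
            freqNorm_sq]
  have hB : ∑ ξ ∈ modes d N, weight s ξ * ∑ j, ‖coeff (fun y => f (φ y) j) ξ‖ ^ 2
      ≤ K ^ 2 * ∑ ξ ∈ modes d N, weight s ξ * ‖coeff φ ξ‖ ^ 2 := by
    have h2π : (0 : ℝ) < (2 * Real.pi) ^ d := by positivity
    refine le_of_mul_le_mul_left ?_ h2π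
    have h1 := derivNorm_sq_of_eq_trig hφ s
    calc (2 * Real.pi) ^ d * ∑ ξ ∈ modes d N,
          weight s ξ * ∑ j, ‖coeff (fun y => f (φ y) j) ξ‖ ^ 2
        = ∑ j, (2 * Real.pi) ^ d * ∑ ξ ∈ modes d N,
          weight s ξ * ‖coeff (fun y => f (φ y) j) ξ‖ ^ 2 := by
          rw [← Finset.mul_sum, Finset.sum_comm]
          simp only [Finset.mul_sum]
      _ ≤ ∑ j, derivNorm s (fun y => f (φ y) j) ^ 2 := Finset.sum_le_sum fun j _ =>
          sum_weight_coeff_sq_le N (contDiff_component_comp hf hφ j)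
            ((isPeriodic_of_eq_trig hφ).comp fun v => f v j)
      _ = derivNormVec s f φ ^ 2 :=
          (Real.sq_sqrt (Finset.sum_nonneg fun _ _ => sq_nonneg _)).symm
      _ ≤ (K * derivNorm s φ) ^ 2 := pow_le_pow_left₀ (Real.sqrt_nonneg _) hK 2
      _ = _ := by rw [mul_pow, h1]; ring
  calc 2 * |flux s N f φ|
      ≤ ∑ ξ ∈ modes d N, weight s ξ * (2 * |((starRingEnd ℂ) (coeff φ ξ) *
          ∑ j, Complex.I * ξ j * coeff (fun y => f (φ y) j) ξ).re|) := by
        rw [flux]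
        refine (mul_le_mul_of_nonneg_left (Finset.abs_sum_le_sum_abs _ _) zero_le_two).trans
          (le_of_eq ?_)
        rw [Finset.mul_sum]
        refine Finset.sum_congr rfl fun ξ _ => ?_
        rw [abs_mul, abs_of_nonneg (weight_nonneg s ξ)]; ring
    _ ≤ ∑ ξ ∈ modes d N, weight s ξ * (θ * (freqNorm ξ ^ 2 * ‖coeff φ ξ‖ ^ 2) + 1 / θ *
        ∑ j, ‖coeff (fun y => f (φ y) j) ξ‖ ^ 2) :=
        Finset.sum_le_sum fun ξ _ => mul_le_mul_of_nonneg_left (hpt ξ) (weight_nonneg s ξ)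
    _ = θ * ∑ ξ ∈ modes d N, freqNorm ξ ^ 2 * weight s ξ * ‖coeff φ ξ‖ ^ 2
        + 1 / θ * ∑ ξ ∈ modes d N, weight s ξ * ∑ j, ‖coeff (fun y => f (φ y) j) ξ‖ ^ 2 := by
        rw [Finset.mul_sum, Finset.mul_sum, ← Finset.sum_add_distrib]
        exact Finset.sum_congr rfl fun ξ _ => by ring
    _ ≤ _ := by
        have := mul_le_mul_of_nonneg_left hB (by positivity : 0 ≤ 1 / θ)
        rw [← mul_assoc, show 1 / θ * K ^ 2 = K ^ 2 / θ by ring] at this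
        linarith

end

/-! ### Integration of the energy inequality -/

/-- The derivative exists only in the open interval and is not known to be integrable, so
monotonicity of the difference replaces the fundamental theorem of calculus. -/
theorem le_add_sum_integral {ι : Type*} {S : Finset ι} {y : ι → ℝ → ℝ} {T : ℝ}
    (hy : ∀ i ∈ S, ContinuousOn (y i) (Set.Icc 0 T)) {w a : ι → ℝ}
    (hd : ∀ t ∈ Set.Ioo 0 T, ∃ D, HasDerivAt (fun t => ∑ i ∈ S, w i * y i t) D t ∧
      D ≤ ∑ i ∈ S, a i * y i t) {t : ℝ} (ht : t ∈ Set.Icc 0 T) :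
    ∑ i ∈ S, w i * y i t ≤ ∑ i ∈ S, w i * y i 0 + ∑ i ∈ S, a i * (∫ τ in (0 : ℝ)..t, y i τ) := by
  have hT : 0 ≤ T := ht.1.trans ht.2
  have hint : ∀ i ∈ S, ∀ r ∈ Set.Icc 0 T, IntervalIntegrable (y i) volume 0 r := fun i hi r hr =>
    ((hy i hi).mono (by rw [Set.uIcc_of_le hr.1]; exact Set.Icc_subset_Icc_right hr.2))
      |>.intervalIntegrable
  have hder : ∀ r ∈ Set.Ioo 0 T, HasDerivAt (fun t => ∑ i ∈ S, a i * (∫ τ in (0 : ℝ)..t, y i τ))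
      (∑ i ∈ S, a i * y i r) r := by
    intro r hr
    refine HasDerivAt.fun_sum fun i hi => HasDerivAt.const_mul _ ?_
    have hnhds : Set.Icc 0 T ∈ nhds r := Icc_mem_nhds hr.1 hr.2
    refine intervalIntegral.integral_hasDerivAt_right (hint i hi r ⟨hr.1.le, hr.2.le⟩) ?_
      ((hy i hi).continuousAt hnhds)
    exact (hy i hi).mono Set.Ioo_subset_Icc_self |>.stronglyMeasurableAtFilter isOpen_Ioo r hr
  have hanti : AntitoneOn (fun t => ∑ i ∈ S, w i * y i t
      - ∑ i ∈ S, a i * (∫ τ in (0 : ℝ)..t, y i τ)) (Set.Icc 0 T) := by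
    refine antitoneOn_of_deriv_nonpos (convex_Icc 0 T) ?_ ?_ ?_
    · refine ContinuousOn.sub (continuousOn_finsetSum _ fun i hi => (hy i hi).const_mul _)
        (continuousOn_finsetSum _ fun i hi => ContinuousOn.const_mul ?_ _)
      have := intervalIntegral.continuousOn_primitive_interval (μ := volume) (f := y i)
        (a := 0) (b := T) (by rw [Set.uIcc_of_le hT]; exact (hy i hi).integrableOn_Icc)
      rwa [Set.uIcc_of_le hT] at this
    · intro r hr
      rw [interior_Icc] at hr
      obtain ⟨D, hD, -⟩ := hd r hr
      exact (hD.sub (hder r hr)).differentiableAt.differentiableWithinAt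
    · intro r hr
      rw [interior_Icc] at hr
      obtain ⟨D, hD, hle⟩ := hd r hr
      have := (hD.sub (hder r hr)).deriv
      change deriv (fun t => ∑ i ∈ S, w i * y i t
        - ∑ i ∈ S, a i * (∫ τ in (0 : ℝ)..t, y i τ)) r = _ at this
      rw [this]; linarith
  have := hanti ⟨le_rfl, hT⟩ ht ht.1
  simp only [intervalIntegral.integral_same, mul_zero, Finset.sum_const_zero, sub_zero] at this
  linarith

/-- In place of Grönwall, the growth term is bounded by βT times the maximal energy M, hence by M/4.
At the time of the maximum this gives M ≤ 3B/4 + M/4, whence the factor 4/3 in B. -/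
theorem energy_inequality {ι : Type*} {S : Finset ι} {y : ι → ℝ → ℝ} {T : ℝ} (hT : 0 ≤ T)
    (hy : ∀ i ∈ S, ContinuousOn (y i) (Set.Icc 0 T)) (hy0 : ∀ i t, 0 ≤ y i t)
    {w g p r : ι → ℝ} (hw : ∀ i, 0 ≤ w i) (hg : ∀ i, 0 ≤ g i) (hp : ∀ i, 0 ≤ p i)
    (hr : ∀ i, 0 ≤ r i) {β : ℝ} (hβ : 0 ≤ β) (hβT : β * T ≤ 1 / 4)
    (hd : ∀ t ∈ Set.Ioo 0 T, ∃ D, HasDerivAt (fun t => ∑ i ∈ S, w i * y i t) D t ∧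
      D ≤ ∑ i ∈ S, (-(2 * g i) - p i + β * w i + r i) * y i t) {t : ℝ} (ht : t ∈ Set.Icc 0 T)
    {B : ℝ} (hB : B = 4 / 3 * (∑ i ∈ S, w i * y i 0 + ∑ i ∈ S, r i * (∫ τ in (0 : ℝ)..T, y i τ))) :
    ∑ i ∈ S, w i * y i t ≤ B ∧ 2 * ∑ i ∈ S, g i * (∫ τ in (0 : ℝ)..t, y i τ) ≤ B ∧
      ∑ i ∈ S, p i * (∫ τ in (0 : ℝ)..T, y i τ) ≤ B := by
  have hint : ∀ i ∈ S, ∀ r ∈ Set.Icc 0 T, IntervalIntegrable (y i) volume 0 r := fun i hi r hr =>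
    ((hy i hi).mono (by rw [Set.uIcc_of_le hr.1]; exact Set.Icc_subset_Icc_right hr.2))
      |>.intervalIntegrable
  have hI0 : ∀ i, ∀ t ∈ Set.Icc 0 T, 0 ≤ ∫ τ in (0 : ℝ)..t, y i τ := fun i t ht =>
    intervalIntegral.integral_nonneg ht.1 fun _ _ => hy0 _ _
  have hsum0 : ∀ {q : ι → ℝ}, (∀ i, 0 ≤ q i) → ∀ t ∈ Set.Icc 0 T,
      0 ≤ ∑ i ∈ S, q i * (∫ τ in (0 : ℝ)..t, y i τ) := fun hq t ht =>
    Finset.sum_nonneg fun i _ => mul_nonneg (hq i) (hI0 i t ht)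
  obtain ⟨t₀, ht₀, hmax⟩ := isCompact_Icc.exists_isMaxOn (Set.nonempty_Icc.mpr hT)
    (continuousOn_finsetSum S fun i hi => (hy i hi).const_mul (w i))
  set M := ∑ i ∈ S, w i * y i t₀ with hM
  have hM0 : 0 ≤ M := Finset.sum_nonneg fun i _ => mul_nonneg (hw i) (hy0 _ _)
  have hmain : ∀ t ∈ Set.Icc 0 T, ∑ i ∈ S, w i * y i t
      + 2 * ∑ i ∈ S, g i * (∫ τ in (0 : ℝ)..t, y i τ) + ∑ i ∈ S, p i * (∫ τ in (0 : ℝ)..t, y i τ)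
      ≤ 3 / 4 * B + M / 4 := by
    intro t ht
    have h1 := le_add_sum_integral hy hd ht
    have h2 : ∑ i ∈ S, (-(2 * g i) - p i + β * w i + r i) * (∫ τ in (0 : ℝ)..t, y i τ)
        = -(2 * ∑ i ∈ S, g i * (∫ τ in (0 : ℝ)..t, y i τ)) - ∑ i ∈ S, p i * (∫ τ in (0 : ℝ)..t, y i τ)
          + β * ∑ i ∈ S, w i * (∫ τ in (0 : ℝ)..t, y i τ)
          + ∑ i ∈ S, r i * (∫ τ in (0 : ℝ)..t, y i τ) := by
      simp only [Finset.mul_sum, ← Finset.sum_neg_distrib, ← Finset.sum_sub_distrib,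
        ← Finset.sum_add_distrib]
      exact Finset.sum_congr rfl fun i _ => by ring
    have h3 : ∑ i ∈ S, w i * (∫ τ in (0 : ℝ)..t, y i τ) ≤ T * M := by
      calc ∑ i ∈ S, w i * (∫ τ in (0 : ℝ)..t, y i τ)
          = ∫ τ in (0 : ℝ)..t, ∑ i ∈ S, w i * y i τ := by
            rw [intervalIntegral.integral_finsetSum fun i hi => (hint i hi t ht).const_mul _]
            simp only [intervalIntegral.integral_const_mul]
        _ ≤ ∫ _τ in (0 : ℝ)..t, M := by
            refine intervalIntegral.integral_mono_on ht.1 ?_ (by simp) fun τ hτ =>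
              hmax ⟨hτ.1, hτ.2.trans ht.2⟩
            have := IntervalIntegrable.sum S fun i hi => (hint i hi t ht).const_mul (w i)
            simpa only [Finset.sum_fn] using this
        _ = t * M := by simp
        _ ≤ T * M := mul_le_mul_of_nonneg_right ht.2 hM0
    have h4 : ∑ i ∈ S, r i * (∫ τ in (0 : ℝ)..t, y i τ) ≤ ∑ i ∈ S, r i * (∫ τ in (0 : ℝ)..T, y i τ) := by
      refine Finset.sum_le_sum fun i hi => mul_le_mul_of_nonneg_left ?_ (hr i)
      exact intervalIntegral.integral_mono_interval le_rfl ht.1 ht.2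
        (Filter.Eventually.of_forall fun τ => hy0 i τ) (hint i hi T ⟨hT, le_rfl⟩)
    have h5 : β * ∑ i ∈ S, w i * (∫ τ in (0 : ℝ)..t, y i τ) ≤ M / 4 :=
      calc _ ≤ β * (T * M) := mul_le_mul_of_nonneg_left h3 hβ
        _ = β * T * M := by ring
        _ ≤ 1 / 4 * M := mul_le_mul_of_nonneg_right hβT hM0
        _ = M / 4 := by ring
    rw [h2] at h1
    linarith
  have hMB : M ≤ B := by
    have := hmain t₀ ht₀
    have h1 := hsum0 hg t₀ ht₀
    have h2 := hsum0 hp t₀ ht₀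
    linarith
  have hw0 : ∀ t, 0 ≤ ∑ i ∈ S, w i * y i t := fun t =>
    Finset.sum_nonneg fun i _ => mul_nonneg (hw i) (hy0 _ _)
  have hTI : T ∈ Set.Icc 0 T := ⟨hT, le_rfl⟩
  refine ⟨?_, ?_, ?_⟩
  · linarith [hmain t ht, hsum0 hg t ht, hsum0 hp t ht]
  · linarith [hmain t ht, hw0 t, hsum0 hp t ht]
  · linarith [hmain T hTI, hw0 T, hsum0 hg T hTI]

/-! ### The energy estimate at a fixed order -/

section

variable {d N : ℕ} {T ε m CQ : ℝ} {μ : Measure (Space d)} {f : ℝ → Space d}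
  {Q : Fin d → Fin d → ℝ → (Fin d → ℤ) → ℝ} {u₀ : Space d → ℝ} {u : ℝ → Space d → ℝ}

/-- Differentiating |û_ξ|² gives 2 Re(conj(û_ξ) û_ξ'); the Fourier form of the equation and the
lower bound for the viscosity are inserted. -/
theorem exists_hasDerivAt_sum_weight (hu : IsSolution N T ε m μ f Q u₀ u) (hμ : IsLevy μ)
    (hQ : IsViscosity N T m CQ Q) (hm : 0 < m) (hε : 0 < ε) (s : ℕ) {t : ℝ}
    (ht : t ∈ Set.Ioo 0 T) :
    ∃ D, HasDerivAt (fun t => ∑ ξ ∈ modes d N, weight s ξ * ‖coeff (u t) ξ‖ ^ 2) D t ∧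
      D ≤ ∑ ξ ∈ modes d N, (-(2 * (-(levySymbol μ ξ).re * weight s ξ))
        - 2 * (ε * (freqNorm ξ ^ 2 * weight s ξ))
        + 2 * ε * ((1 + d ^ 2 * |CQ|) * m ^ 2) * weight s ξ) * ‖coeff (u t) ξ‖ ^ 2
        + 2 * |flux s N f (u t)| := by
  set A := (1 + d ^ 2 * |CQ|) * m ^ 2
  have htI : t ∈ Set.Icc 0 T := ⟨ht.1.le, ht.2.le⟩
  refine ⟨∑ ξ ∈ modes d N, weight s ξ * (2 * inner ℝ (coeff (u t) ξ)
    (deriv (fun τ => coeff (u τ) ξ) t)), HasDerivAt.fun_sum fun ξ _ =>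
      ((hu.differentiableAt ξ t ht).hasDerivAt.norm_sq).const_mul _, ?_⟩
  have hterm : ∀ ξ ∈ modes d N, weight s ξ * (2 * inner ℝ (coeff (u t) ξ)
      (deriv (fun τ => coeff (u τ) ξ) t)) ≤
      (-(2 * (-(levySymbol μ ξ).re * weight s ξ)) - 2 * (ε * (freqNorm ξ ^ 2 * weight s ξ))
        + 2 * ε * A * weight s ξ) * ‖coeff (u t) ξ‖ ^ 2
      - 2 * (weight s ξ * ((starRingEnd ℂ) (coeff (u t) ξ) *
        ∑ j, Complex.I * ξ j * coeff (fun y => f (u t y) j) ξ).re) := by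
    intro ξ hξ
    have hv := viscosity_lower_bound hQ hm htI hξ
    rw [deriv_coeff hu hμ ht hξ, Complex.inner]
    set a := coeff (u t) ξ
    set F := ∑ j, Complex.I * ξ j * coeff (fun y => f (u t y) j) ξ
    set V := ∑ j, ∑ k, (ξ j : ℝ) * ξ k * (if m ≤ freqNorm ξ then Q j k t ξ else 0)
    have e : ((starRingEnd ℂ) a * (-F + levySymbol μ ξ * a - ε * (V : ℂ) * a)).re
        = -((starRingEnd ℂ) a * F).re + (levySymbol μ ξ).re * ‖a‖ ^ 2 - ε * V * ‖a‖ ^ 2 := by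
      have hn : (starRingEnd ℂ) a * a = ((‖a‖ ^ 2 : ℝ) : ℂ) := by
        rw [mul_comm, Complex.mul_conj, Complex.normSq_eq_norm_sq]
      have : (starRingEnd ℂ) a * (-F + levySymbol μ ξ * a - ε * (V : ℂ) * a)
          = -((starRingEnd ℂ) a * F) + levySymbol μ ξ * ((starRingEnd ℂ) a * a)
            - ((ε * V : ℝ) : ℂ) * ((starRingEnd ℂ) a * a) := by push_cast; ring
      rw [this, hn, Complex.sub_re, Complex.add_re, Complex.neg_re, Complex.re_mul_ofReal,
        ← Complex.ofReal_mul, Complex.ofReal_re]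
    rw [mul_comm (-F + _ - _), e]
    have h1 : weight s ξ * ‖a‖ ^ 2 * ε * (freqNorm ξ ^ 2 - A) ≤ weight s ξ * ‖a‖ ^ 2 * ε * V :=
      mul_le_mul_of_nonneg_left hv (by have := weight_nonneg s ξ; positivity)
    linarith
  refine (Finset.sum_le_sum hterm).trans ?_
  rw [Finset.sum_sub_distrib, ← Finset.mul_sum]
  have := neg_abs_le (flux s N f (u t))
  rw [flux] at this ⊢
  linarith

/-- The dissipation `ε^{2s+1} ∑_{|α| = s} ‖∂_x ∂_x^α u‖²_{L²(D_T)}`. -/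
def dissipation (s N : ℕ) (T ε : ℝ) (u : ℝ → Space d → ℝ) : ℝ :=
  ε ^ (2 * s + 1) * ((2 * Real.pi) ^ d * ∑ ξ ∈ modes d N,
    freqNorm ξ ^ 2 * weight s ξ * ∫ τ in (0 : ℝ)..T, ‖coeff (u τ) ξ‖ ^ 2)

theorem continuousOn_norm_coeff_sq (hu : IsSolution N T ε m μ f Q u₀ u) (ξ : Fin d → ℤ) :
    ContinuousOn (fun t => ‖coeff (u t) ξ‖ ^ 2) (Set.Icc 0 T) :=
  (hu.continuousOn ξ).norm.pow 2

theorem derivNormDT_sq_le (hu : IsSolution N T ε m μ f Q u₀ u) (hT : 0 ≤ T) (hε : 0 < ε) (s : ℕ) :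
    (ε ^ ((s : ℝ) + 1 / 2) * derivNormDT (s + 1) T u) ^ 2 ≤ dissipation s N T ε u := by
  have hint : ∀ ξ, IntervalIntegrable (fun t => ‖coeff (u t) ξ‖ ^ 2) volume 0 T := fun ξ =>
    ((continuousOn_norm_coeff_sq hu ξ).mono (by rw [Set.uIcc_of_le hT])).intervalIntegrable
  have h1 : ∀ α : Fin d → ℕ, ∫ t in (0 : ℝ)..T, normL2 (multiDeriv α (u t)) ^ 2
      = (2 * Real.pi) ^ d * ∑ ξ ∈ modes d N, (∏ i, (ξ i : ℝ) ^ α i) ^ 2 *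
        ∫ τ in (0 : ℝ)..T, ‖coeff (u τ) ξ‖ ^ 2 := by
    intro α
    have : ∫ t in (0 : ℝ)..T, normL2 (multiDeriv α (u t)) ^ 2 = ∫ t in (0 : ℝ)..T,
        (2 * Real.pi) ^ d * ∑ ξ ∈ modes d N, (∏ i, (ξ i : ℝ) ^ α i) ^ 2 * ‖coeff (u t) ξ‖ ^ 2 := by
      refine intervalIntegral.integral_congr fun t ht => ?_
      rw [Set.uIcc_of_le hT] at ht
      exact normL2_multiDeriv_sq (hu.trigPoly t ht) α
    rw [this, intervalIntegral.integral_const_mul,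
      intervalIntegral.integral_finsetSum fun ξ _ => (hint ξ).const_mul _]
    simp only [intervalIntegral.integral_const_mul]
  have h2 : derivNormDT (s + 1) T u ^ 2 = (2 * Real.pi) ^ d * ∑ ξ ∈ modes d N,
      weight (s + 1) ξ * ∫ τ in (0 : ℝ)..T, ‖coeff (u τ) ξ‖ ^ 2 := by
    rw [derivNormDT, Real.sq_sqrt (Finset.sum_nonneg fun α _ =>
      intervalIntegral.integral_nonneg hT fun _ _ => sq_nonneg _)]
    simp only [h1, weight, Finset.sum_mul]
    rw [← Finset.mul_sum, Finset.sum_comm]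
  have h3 : (ε ^ ((s : ℝ) + 1 / 2)) ^ 2 = ε ^ (2 * s + 1) := by
    rw [← Real.rpow_natCast, ← Real.rpow_mul hε.le, ← Real.rpow_natCast]
    congr 1; push_cast; ring
  rw [mul_pow, h2, h3, dissipation]
  gcongr with ξ
  · exact intervalIntegral.integral_nonneg hT fun _ _ => sq_nonneg _
  · exact weight_succ_le s ξ

/-- Half of the viscous dissipation pays for the flux up to a remainder r, and the other half is
what the estimate retains. The number ρ bounds the rescaled time integral of r. -/
theorem energy_le_and_dissipation_le (hd : 1 ≤ d) (hT : 0 ≤ T)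
    (hu : IsSolution N T ε m μ f Q u₀ u) (hμ : IsLevy μ)
    (hQ : IsViscosity N T m CQ Q) (hm : 0 < m) (hε : 0 < ε)
    (hsmall : 2 * ε * ((1 + d ^ 2 * |CQ|) * m ^ 2) * T ≤ 1 / 4) (s : ℕ)
    {r : (Fin d → ℤ) → ℝ} (hr : ∀ ξ, 0 ≤ r ξ)
    (hflux : ∀ t ∈ Set.Ioo 0 T, 2 * |flux s N f (u t)| ≤ ∑ ξ ∈ modes d N,
      (ε * (freqNorm ξ ^ 2 * weight s ξ) + r ξ) * ‖coeff (u t) ξ‖ ^ 2)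
    {ρ : ℝ} (hρ : ε ^ (2 * s) * ((2 * Real.pi) ^ d * ∑ ξ ∈ modes d N,
      r ξ * ∫ τ in (0 : ℝ)..T, ‖coeff (u τ) ξ‖ ^ 2) ≤ ρ) :
    (∀ t ∈ Set.Icc 0 T, energy s N T ε μ u t
      ≤ 3 * (ε ^ s * derivNorm s (u 0)) + 3 * Real.sqrt ρ) ∧
    dissipation s N T ε u ≤ 4 / 3 * ((ε ^ s * derivNorm s (u 0)) ^ 2 + ρ) := by
  set y : (Fin d → ℤ) → ℝ → ℝ := fun ξ t => ‖coeff (u t) ξ‖ ^ 2 with hy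
  have hw := fun ξ : Fin d → ℤ => weight_nonneg s ξ
  set B := 4 / 3 * (∑ ξ ∈ modes d N, weight s ξ * y ξ 0
    + ∑ ξ ∈ modes d N, r ξ * ∫ τ in (0 : ℝ)..T, y ξ τ) with hB
  have key := fun t (ht : t ∈ Set.Icc 0 T) => energy_inequality hT (S := modes d N) (y := y)
    (fun ξ _ => continuousOn_norm_coeff_sq hu ξ) (fun ξ t => sq_nonneg _) (w := weight s)
    (g := fun ξ => -(levySymbol μ ξ).re * weight s ξ)
    (p := fun ξ => ε * (freqNorm ξ ^ 2 * weight s ξ)) (r := r) hw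
    (fun ξ => mul_nonneg (neg_nonneg.mpr (levySymbol_re_nonpos hμ ξ)) (hw ξ))
    (fun ξ => mul_nonneg hε.le (mul_nonneg (sq_nonneg _) (hw ξ))) hr
    (β := 2 * ε * ((1 + d ^ 2 * |CQ|) * m ^ 2)) (by positivity) hsmall (by
      intro t ht
      obtain ⟨D, hD, hle⟩ := exists_hasDerivAt_sum_weight hu hμ hQ hm hε s ht
      refine ⟨D, hD, hle.trans ?_⟩
      refine (add_le_add_right (hflux t ht) _).trans (le_of_eq ?_)
      rw [← Finset.sum_add_distrib]
      exact Finset.sum_congr rfl fun ξ _ => by simp only [hy]; ring) ht hB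
  have h2π : (0 : ℝ) < (2 * Real.pi) ^ d := by positivity
  -- The Lévy term of the energy lacks the Parseval factor (2π)^d; since this factor is at least 2,
  -- that term is at most E/2.
  have h2π2 : (2 : ℝ) ≤ (2 * Real.pi) ^ d :=
    calc (2 : ℝ) ≤ 2 * Real.pi := by linarith [Real.pi_gt_three]
      _ ≤ (2 * Real.pi) ^ d := le_self_pow₀ (by linarith [Real.pi_gt_three]) (by omega)
  set a := ε ^ s * derivNorm s (u 0) with ha
  have ha0 : 0 ≤ a := mul_nonneg (pow_nonneg hε.le _) (derivNorm_nonneg _ _)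
  have hε2 : 0 < ε ^ (2 * s) := pow_pos hε _
  have hBρ : ε ^ (2 * s) * ((2 * Real.pi) ^ d * B) ≤ 4 / 3 * (a ^ 2 + ρ) := by
    rw [hB, ha, mul_pow (ε ^ s), derivNorm_sq_of_eq_trig (hu.trigPoly 0 ⟨le_rfl, hT⟩), ← pow_mul,
      mul_comm s 2]
    simp only [hy] at hρ ⊢
    linarith
  have hρ0 : 0 ≤ ρ := by
    refine le_trans ?_ hρ
    refine mul_nonneg hε2.le (mul_nonneg h2π.le (Finset.sum_nonneg fun ξ _ => mul_nonneg (hr ξ) ?_))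
    exact intervalIntegral.integral_nonneg hT fun _ _ => sq_nonneg _
  have hdis : dissipation s N T ε u ≤ 4 / 3 * (a ^ 2 + ρ) := by
    refine le_trans ?_ hBρ
    have h3 := (key 0 ⟨le_rfl, hT⟩).2.2
    have e : ∑ ξ ∈ modes d N, ε * (freqNorm ξ ^ 2 * weight s ξ) * (∫ τ in (0 : ℝ)..T, y ξ τ)
        = ε * ∑ ξ ∈ modes d N, freqNorm ξ ^ 2 * weight s ξ * ∫ τ in (0 : ℝ)..T, y ξ τ := by
      rw [Finset.mul_sum]
      exact Finset.sum_congr rfl fun ξ _ => by ring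
    rw [e] at h3
    calc dissipation s N T ε u = ε ^ (2 * s) * ((2 * Real.pi) ^ d * (ε *
          ∑ ξ ∈ modes d N, freqNorm ξ ^ 2 * weight s ξ * ∫ τ in (0 : ℝ)..T, y ξ τ)) := by
          rw [dissipation, pow_succ]; ring
      _ ≤ _ := by gcongr
  refine ⟨fun t ht => ?_, hdis⟩
  obtain ⟨k1, k2, -⟩ := key t ht
  set E := Real.sqrt (4 / 3 * (a ^ 2 + ρ)) with hE
  have hEsq : E ^ 2 = 4 / 3 * (a ^ 2 + ρ) := Real.sq_sqrt (by positivity)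
  have hE0 : 0 ≤ E := Real.sqrt_nonneg _
  have t1 : ε ^ s * derivNorm s (u t) ≤ E := by
    refine Real.le_sqrt_of_sq_le ?_
    rw [mul_pow, derivNorm_sq_of_eq_trig (hu.trigPoly t ht), ← pow_mul, mul_comm s 2]
    refine le_trans ?_ hBρ
    gcongr
  have t2 : ε ^ s * Real.sqrt (-∑ α ∈ multiIndices d s, ∑ ξ ∈ modes d N,
      (levySymbol μ ξ).re * (∏ i, (ξ i : ℝ) ^ α i) ^ 2 * ∫ τ in (0 : ℝ)..t, ‖coeff (u τ) ξ‖ ^ 2)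
      ≤ 1 / 2 * E := by
    have e : (-∑ α ∈ multiIndices d s, ∑ ξ ∈ modes d N,
      (levySymbol μ ξ).re * (∏ i, (ξ i : ℝ) ^ α i) ^ 2 * ∫ τ in (0 : ℝ)..t, ‖coeff (u τ) ξ‖ ^ 2)
      = ∑ ξ ∈ modes d N, -(levySymbol μ ξ).re * weight s ξ * ∫ τ in (0 : ℝ)..t, y ξ τ := by
      rw [Finset.sum_comm, ← Finset.sum_neg_distrib]
      refine Finset.sum_congr rfl fun ξ _ => ?_
      rw [weight, Finset.mul_sum, Finset.sum_mul, ← Finset.sum_neg_distrib]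
      exact Finset.sum_congr rfl fun α _ => by simp only [hy]; ring
    rw [e]
    set X := ∑ ξ ∈ modes d N, -(levySymbol μ ξ).re * weight s ξ * ∫ τ in (0 : ℝ)..t, y ξ τ
    have hX0 : 0 ≤ X := Finset.sum_nonneg fun ξ _ => mul_nonneg
      (mul_nonneg (neg_nonneg.mpr (levySymbol_re_nonpos hμ ξ)) (hw ξ))
      (intervalIntegral.integral_nonneg ht.1 fun _ _ => sq_nonneg _)
    refine le_of_sq_le_sq ?_ (by positivity)
    rw [mul_pow, Real.sq_sqrt hX0, mul_pow, hEsq, ← pow_mul, mul_comm s 2]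
    have h1 : ε ^ (2 * s) * (2 * (2 * X)) ≤ ε ^ (2 * s) * ((2 * Real.pi) ^ d * B) := by gcongr
    linarith
  have t3 : ε ^ ((s : ℝ) + 1 / 2) * derivNormDT (s + 1) T u ≤ E :=
    Real.le_sqrt_of_sq_le ((derivNormDT_sq_le hu hT hε s).trans hdis)
  -- The three terms add up to (1 + 1/2 + 1)E, and (5/2)² · 4/3 = 25/3 ≤ 9: this is the origin of
  -- the prefactor 3.
  have hfin : 5 / 2 * E ≤ 3 * a + 3 * Real.sqrt ρ := by
    refine le_of_sq_le_sq ?_ (by positivity)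
    rw [mul_pow, hEsq]
    have := Real.sq_sqrt hρ0
    nlinarith [mul_nonneg ha0 (Real.sqrt_nonneg ρ), sq_nonneg a]
  rw [energy]
  linarith

end

/-! ### The supremum of the solution -/

section

variable {d N : ℕ} {T ε m CQ : ℝ} {μ : Measure (Space d)} {f : ℝ → Space d}
  {Q : Fin d → Fin d → ℝ → (Fin d → ℤ) → ℝ} {u₀ : Space d → ℝ} {u : ℝ → Space d → ℝ}

/-- Reduction modulo 2π may land on the boundary of the open cell; moving towards the centre (π, …,
π) shows that the point is in the closure. -/
theorem exists_mem_closure_cell {d : ℕ} (x : Space d) :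
    ∃ y ∈ closure (cell d), ∀ ξ : Fin d → ℤ, character ξ x = character ξ y := by
  have hπ := Real.two_pi_pos
  set y : Space d := WithLp.toLp 2 fun i => toIcoMod hπ 0 (x i) with hy
  have hyi : ∀ i, 0 ≤ y i ∧ y i < 2 * Real.pi := fun i => by
    have := toIcoMod_mem_Ico hπ 0 (x i)
    simpa [hy] using this
  refine ⟨y, ?_, fun ξ => ?_⟩
  · have hc : Continuous fun δ : ℝ => y + δ • (WithLp.toLp 2 (fun _ => Real.pi) - y) := by fun_prop
    have ht : Filter.Tendsto (fun δ : ℝ => y + δ • (WithLp.toLp 2 (fun _ => Real.pi) - y))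
        (nhdsWithin 0 (Set.Ioi 0)) (nhds y) := by
      have := hc.tendsto 0
      simp only [zero_smul, add_zero] at this
      exact this.mono_left nhdsWithin_le_nhds
    refine mem_closure_of_tendsto ht ?_
    filter_upwards [Ioo_mem_nhdsGT (zero_lt_one' ℝ)] with δ hδ
    intro i
    have h := hyi i
    have e : (y + δ • (WithLp.toLp 2 (fun _ => Real.pi) - y) : Space d) i
        = (1 - δ) * y i + δ * Real.pi := by simp; ring
    rw [e]
    have h1 : 0 < 1 - δ := by linarith [hδ.2]
    have h2 := Real.pi_pos
    constructor
    · have := mul_nonneg h1.le h.1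
      have := mul_pos hδ.1 h2
      linarith
    · nlinarith [mul_lt_mul_of_pos_left h.2 h1, mul_pos hδ.1 h2]
  · have hx : ∀ i, x i = y i + toIcoDiv hπ 0 (x i) * (2 * Real.pi) := fun i => by
      have := toIcoMod_add_toIcoDiv_zsmul hπ 0 (x i)
      rw [zsmul_eq_mul] at this
      exact this.symm
    have hphase : phase ξ x = phase ξ y
        + (∑ i, ξ i * toIcoDiv hπ 0 (x i) : ℤ) * (2 * Real.pi) := by
      rw [phase, phase]
      push_cast
      rw [Finset.sum_mul, ← Finset.sum_add_distrib]
      exact Finset.sum_congr rfl fun i _ => by linear_combination (ξ i : ℝ) * hx i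
    rw [character, character, hphase, Complex.exp_eq_exp_iff_exists_int]
    refine ⟨∑ i, ξ i * toIcoDiv hπ 0 (x i), ?_⟩
    push_cast
    ring

/-- The set of values is bounded, because ∑ |û_ξ(t)| is continuous on [0,T]. Continuity and
periodicity in x then pass from the open cell to all of space. -/
theorem abs_le_supNormDT (hu : IsSolution N T ε m μ f Q u₀ u) {t : ℝ} (ht : t ∈ Set.Ioo 0 T)
    (x : Space d) : |u t x| ≤ supNormDT T u := by
  have hbdd : BddAbove {r | ∃ t ∈ Set.Ioo 0 T, ∃ x ∈ cell d, r = |u t x|} := by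
    have hc : ContinuousOn (fun t => ∑ ξ ∈ modes d N, ‖coeff (u t) ξ‖) (Set.Icc 0 T) :=
      continuousOn_finsetSum _ fun ξ _ => (hu.continuousOn ξ).norm
    obtain ⟨C, hC⟩ := isCompact_Icc.bddAbove_image hc
    refine ⟨C, ?_⟩
    rintro r ⟨t, ht, x, -, rfl⟩
    have htI := Set.Ioo_subset_Icc_self ht
    refine le_trans ?_ (hC ⟨t, htI, rfl⟩)
    rw [← Real.norm_eq_abs, ← Complex.norm_real, hu.trigPoly t htI x]
    refine (norm_sum_le _ _).trans (Finset.sum_le_sum fun ξ _ => ?_)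
    rw [norm_mul, norm_character, mul_one]
  have hut := hu.trigPoly t (Set.Ioo_subset_Icc_self ht)
  have hcl : IsClosed {x | |u t x| ≤ supNormDT T u} :=
    isClosed_le (contDiff_of_eq_trig hut (n := 0)).continuous.abs continuous_const
  have hsub : closure (cell d) ⊆ {x | |u t x| ≤ supNormDT T u} :=
    closure_minimal (fun x hx => le_csSup hbdd ⟨t, ht, x, hx, rfl⟩) hcl
  obtain ⟨y, hy, hxy⟩ := exists_mem_closure_cell x
  have e : u t x = u t y := by
    have : (u t x : ℂ) = u t y := by
      rw [hut, hut, proj, proj]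
      simp only [hxy]
    exact_mod_cast this
  rw [e]
  exact hsub hy

/-! ### Elementary bounds for the constants and the initial value -/

theorem supNormDT_nonneg (T : ℝ) (u : ℝ → Space d → ℝ) : 0 ≤ supNormDT T u :=
  Real.sSup_nonneg fun _ ⟨_, _, _, _, h⟩ => h ▸ abs_nonneg _

theorem composConst_nonneg {c : ℕ → ℝ} (hc : ∀ k, 0 < c k) (f : ℝ → Space d) {U : ℝ}
    (hU : 0 ≤ U) (k : ℕ) : 0 ≤ composConst c f U k :=
  mul_nonneg (hc k).le (Finset.sum_nonneg fun _ _ =>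
    mul_nonneg (fluxNorm_nonneg _ _ _) (pow_nonneg hU _))

/-- The term j = 1 occurs in every 𝒦_k, so a lower bound on 𝒦_1 propagates to all orders. -/
theorem composConst_one_le {c : ℕ → ℝ} (hc : ∀ k, 0 < c k) (f : ℝ → Space d) {U : ℝ}
    (hU : 0 ≤ U) {k : ℕ} (hk : 1 ≤ k) :
    c k / c 1 * composConst c f U 1 ≤ composConst c f U k := by
  rw [composConst, composConst, ← mul_assoc, div_mul_cancel₀ _ (hc 1).ne']
  refine mul_le_mul_of_nonneg_left ?_ (hc k).le
  exact Finset.sum_le_sum_of_subset_of_nonneg (Finset.Icc_subset_Icc_right hk)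
    fun _ _ _ => mul_nonneg (fluxNorm_nonneg _ _ _) (pow_nonneg hU _)

theorem derivNorm_zero_initial_le (hu : IsSolution N T ε m μ f Q u₀ u) (hT : 0 ≤ T)
    (hu₀ : MemLp u₀ ⊤ (volume.restrict (cell d))) : derivNorm 0 (u 0) ≤ normL2 u₀ := by
  refine le_of_sq_le_sq ?_ (normL2_nonneg _)
  rw [derivNorm_sq_of_eq_trig (hu.trigPoly 0 ⟨le_rfl, hT⟩), normL2_sq]
  refine le_trans (le_of_eq ?_) (sum_coeff_sq_le N (hu₀.mono_exponent le_top))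
  congr 1
  refine Finset.sum_congr rfl fun ξ hξ => ?_
  rw [weight_zero, one_mul, coeff_eq_of_eq_trig hu.initial hξ]

/-! ### The energy estimate at the orders `0` and `s ≥ 1` -/

/-- The assumptions shared by the estimates of all orders up to `s`. -/
structure IsSVV (s N : ℕ) (T ε m CQ : ℝ) (c : ℕ → ℝ) (μ : Measure (Space d)) (f : ℝ → Space d)
    (Q : Fin d → Fin d → ℝ → (Fin d → ℤ) → ℝ) (u₀ : Space d → ℝ) (u : ℝ → Space d → ℝ) :
    Prop where
  one_le_d : 1 ≤ d
  T_nonneg : 0 ≤ T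
  solution : IsSolution N T ε m μ f Q u₀ u
  levy : IsLevy μ
  viscosity : IsViscosity N T m CQ Q
  m_pos : 0 < m
  ε_pos : 0 < ε
  small : 2 * ε * ((1 + d ^ 2 * |CQ|) * m ^ 2) * T ≤ 1 / 4
  c_pos : ∀ k, 0 < c k
  contDiff : ContDiff ℝ (s + 1 : ℕ) f
  compos : ∀ (k N : ℕ) (f : ℝ → Space d) (φ : Space d → ℝ) (U : ℝ), 1 ≤ k →
    ContDiff ℝ k f → IsTrigPoly N φ → (∀ x, |φ x| ≤ U) →
    derivNormVec k f φ ≤ composConst c f U k * derivNorm k φ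

variable {s : ℕ} {c : ℕ → ℝ}

theorem IsSVV.order_zero (h : IsSVV s N T ε m CQ c μ f Q u₀ u) :
    (∀ t ∈ Set.Icc 0 T, energy 0 N T ε μ u t ≤ 3 * (ε ^ 0 * derivNorm 0 (u 0))) ∧
    dissipation 0 N T ε u ≤ 4 / 3 * derivNorm 0 (u 0) ^ 2 := by
  have := energy_le_and_dissipation_le h.one_le_d h.T_nonneg h.solution h.levy h.viscosity h.m_pos
    h.ε_pos h.small 0 (r := fun _ => 0) (fun _ => le_rfl) (fun t ht => by
      rw [flux_zero (h.contDiff.of_le (by norm_cast; omega))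
        (h.solution.trigPoly t (Set.Ioo_subset_Icc_self ht)), abs_zero, mul_zero]
      have := h.ε_pos
      exact Finset.sum_nonneg fun ξ _ => by have := weight_nonneg 0 ξ; positivity)
    (ρ := 0) (by simp)
  simpa using this

theorem IsSVV.abs_flux_le (h : IsSVV s N T ε m CQ c μ f Q u₀ u) {n : ℕ} (hn : 1 ≤ n)
    (hns : n ≤ s) {θ : ℝ} (hθ : 0 < θ) {t : ℝ} (ht : t ∈ Set.Ioo 0 T) :
    2 * |flux n N f (u t)|
      ≤ ∑ ξ ∈ modes d N, (θ * (freqNorm ξ ^ 2 * weight n ξ)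
        + composConst c f (supNormDT T u) n ^ 2 / θ * weight n ξ) * ‖coeff (u t) ξ‖ ^ 2 := by
  have hf : ContDiff ℝ n f := h.contDiff.of_le (by norm_cast; omega)
  have hφ := h.solution.trigPoly t (Set.Ioo_subset_Icc_self ht)
  refine (SVV.abs_flux_le hf hφ hθ
    (h.compos n N f (u t) _ hn hf hφ (abs_le_supNormDT h.solution ht))).trans (le_of_eq ?_)
  rw [Finset.mul_sum, Finset.mul_sum, ← Finset.sum_add_distrib]
  exact Finset.sum_congr rfl fun ξ _ => by ring

/-- Young's inequality with θ = ε leaves K²/ε w_{n+1} ≤ K²/ε |ξ|² w_n. As ε^{2(n+1)}/ε = ε^{2n+1},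
its scaling is exactly that of the dissipation of order n. -/
theorem IsSVV.order_succ (h : IsSVV s N T ε m CQ c μ f Q u₀ u) {n : ℕ} (hns : n + 1 ≤ s) :
    (∀ t ∈ Set.Icc 0 T, energy (n + 1) N T ε μ u t ≤ 3 * (ε ^ (n + 1) * derivNorm (n + 1) (u 0))
      + 3 * (composConst c f (supNormDT T u) (n + 1) * Real.sqrt (dissipation n N T ε u))) ∧
    dissipation (n + 1) N T ε u ≤ 4 / 3 * ((ε ^ (n + 1) * derivNorm (n + 1) (u 0)) ^ 2
      + composConst c f (supNormDT T u) (n + 1) ^ 2 * dissipation n N T ε u) := by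
  set K := composConst c f (supNormDT T u) (n + 1)
  have hK : 0 ≤ K := composConst_nonneg h.c_pos f (supNormDT_nonneg T u) _
  have hε := h.ε_pos
  have := energy_le_and_dissipation_le h.one_le_d h.T_nonneg h.solution h.levy h.viscosity h.m_pos
    h.ε_pos h.small (n + 1) (r := fun ξ => K ^ 2 / ε * weight (n + 1) ξ)
    (fun ξ => mul_nonneg (by positivity) (weight_nonneg _ ξ))
    (fun t ht => h.abs_flux_le (by omega) hns hε ht) (ρ := K ^ 2 * dissipation n N T ε u) ?_
  · rwa [Real.sqrt_mul (sq_nonneg K), Real.sqrt_sq hK] at this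
  · have e : ∑ ξ ∈ modes d N, K ^ 2 / ε * weight (n + 1) ξ *
        (∫ τ in (0 : ℝ)..T, ‖coeff (u τ) ξ‖ ^ 2) = K ^ 2 / ε * ∑ ξ ∈ modes d N, weight (n + 1) ξ *
        (∫ τ in (0 : ℝ)..T, ‖coeff (u τ) ξ‖ ^ 2) := by
      rw [Finset.mul_sum]
      exact Finset.sum_congr rfl fun ξ _ => by ring
    calc _ = K ^ 2 * (ε ^ (2 * n + 1) * ((2 * Real.pi) ^ d * ∑ ξ ∈ modes d N,
          weight (n + 1) ξ * ∫ τ in (0 : ℝ)..T, ‖coeff (u τ) ξ‖ ^ 2)) := by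
          rw [e]; field_simp; ring
      _ ≤ _ := by
          rw [dissipation]
          gcongr with ξ
          · exact intervalIntegral.integral_nonneg h.T_nonneg fun _ _ => sq_nonneg _
          · exact weight_succ_le n ξ

/-- Split at ε|ξ| = 2K. Above, K²/(ε/2) ≤ (ε/2)|ξ|²; below, n of the n+1 factors |ξ|² in the bound
for the weight are replaced by 4K²/ε². -/
theorem weight_interpolation {K : ℝ} (hε : 0 < ε) (n : ℕ) (ξ : Fin d → ℤ) :
    K ^ 2 / (ε / 2) * weight (n + 1) ξ ≤ ε / 2 * (freqNorm ξ ^ 2 * weight (n + 1) ξ)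
      + 2 * 4 ^ n * K ^ (2 * (n + 1)) * ε / ε ^ (2 * (n + 1)) * freqNorm ξ ^ 2 := by
  have hw := weight_nonneg (n + 1) ξ
  rcases le_or_gt (4 * K ^ 2) (ε ^ 2 * freqNorm ξ ^ 2) with h | h
  · have h1 : K ^ 2 / (ε / 2) ≤ ε / 2 * freqNorm ξ ^ 2 := by
      rw [div_le_iff₀ (by positivity)]; linarith
    have h2 := mul_le_mul_of_nonneg_right h1 hw
    have h3 : 0 ≤ 2 * 4 ^ n * K ^ (2 * (n + 1)) * ε / ε ^ (2 * (n + 1)) * freqNorm ξ ^ 2 := by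
      rw [pow_mul]; positivity
    linarith
  · have h1 : freqNorm ξ ^ 2 ≤ 4 * K ^ 2 / ε ^ 2 := by
      rw [le_div_iff₀ (by positivity)]; linarith
    have h2 : K ^ 2 / (ε / 2) * weight (n + 1) ξ
        ≤ K ^ 2 / (ε / 2) * ((4 * K ^ 2 / ε ^ 2) ^ n * freqNorm ξ ^ 2) := by
      refine mul_le_mul_of_nonneg_left ?_ (by positivity)
      refine (weight_le (n + 1) ξ).trans ?_
      rw [pow_succ]
      gcongr
    have h3 : K ^ 2 / (ε / 2) * ((4 * K ^ 2 / ε ^ 2) ^ n * freqNorm ξ ^ 2)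
        = 2 * 4 ^ n * K ^ (2 * (n + 1)) * ε / ε ^ (2 * (n + 1)) * freqNorm ξ ^ 2 := by
      rw [div_pow, mul_pow, ← pow_mul, ← pow_mul]
      field_simp
      ring
    have h4 : 0 ≤ ε / 2 * (freqNorm ξ ^ 2 * weight (n + 1) ξ) := by positivity
    linarith

theorem IsSVV.order_succ_direct (h : IsSVV s N T ε m CQ c μ f Q u₀ u) {n : ℕ} (hns : n + 1 ≤ s) :
    ∀ t ∈ Set.Icc 0 T, energy (n + 1) N T ε μ u t ≤ 3 * (ε ^ (n + 1) * derivNorm (n + 1) (u 0))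
      + 3 * (2 ^ (n + 1) * composConst c f (supNormDT T u) (n + 1) ^ (n + 1)
        * derivNorm 0 (u 0)) := by
  set K := composConst c f (supNormDT T u) (n + 1)
  have hK : 0 ≤ K := composConst_nonneg h.c_pos f (supNormDT_nonneg T u) _
  have hε := h.ε_pos
  have hD := h.order_zero.2
  have := energy_le_and_dissipation_le h.one_le_d h.T_nonneg h.solution h.levy h.viscosity h.m_pos
    h.ε_pos h.small (n + 1)
    (r := fun ξ => 2 * 4 ^ n * K ^ (2 * (n + 1)) * ε / ε ^ (2 * (n + 1)) * freqNorm ξ ^ 2)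
    (fun ξ => by rw [pow_mul]; positivity)
    -- One ε/2 of viscosity is spent in Young's inequality, the other on the high frequencies of the
    -- remainder.
    (fun t ht => (h.abs_flux_le (by omega) hns (half_pos hε) ht).trans
      (Finset.sum_le_sum fun ξ _ => mul_le_mul_of_nonneg_right
        (by have := weight_interpolation (K := K) hε n ξ; linarith) (sq_nonneg _)))
    (ρ := (2 ^ (n + 1) * K ^ (n + 1) * derivNorm 0 (u 0)) ^ 2) ?_
  · rw [Real.sqrt_sq (mul_nonneg (by positivity) (derivNorm_nonneg _ _))] at this
    exact this.1
  · have e : ∑ ξ ∈ modes d N, 2 * 4 ^ n * K ^ (2 * (n + 1)) * ε / ε ^ (2 * (n + 1))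
        * freqNorm ξ ^ 2 * (∫ τ in (0 : ℝ)..T, ‖coeff (u τ) ξ‖ ^ 2)
        = 2 * 4 ^ n * K ^ (2 * (n + 1)) * ε / ε ^ (2 * (n + 1)) * ∑ ξ ∈ modes d N,
        freqNorm ξ ^ 2 * weight 0 ξ * (∫ τ in (0 : ℝ)..T, ‖coeff (u τ) ξ‖ ^ 2) := by
      rw [Finset.mul_sum]
      exact Finset.sum_congr rfl fun ξ _ => by rw [weight_zero]; ring
    calc _ = 2 * 4 ^ n * K ^ (2 * (n + 1)) * dissipation 0 N T ε u := by
          rw [e, dissipation]; field_simp; ring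
      _ ≤ 2 * 4 ^ n * K ^ (2 * (n + 1)) * (4 / 3 * derivNorm 0 (u 0) ^ 2) := by
          refine mul_le_mul_of_nonneg_left hD (by positivity)
      _ = 2 / 3 * (4 ^ (n + 1) * K ^ (2 * (n + 1)) * derivNorm 0 (u 0) ^ 2) := by ring
      _ ≤ 1 * (4 ^ (n + 1) * K ^ (2 * (n + 1)) * derivNorm 0 (u 0) ^ 2) := by
          gcongr; norm_num
      _ = _ := by
          rw [one_mul, mul_pow, mul_pow, ← pow_mul, ← pow_mul, mul_comm (n + 1) 2, pow_mul 2]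
          norm_num

/-! ### Recursion over the orders -/

/-- The inhomogeneity A is itself at most a multiple of the product, because each factor has a
positive lower bound. D is fixed before X and K, which makes the final constant uniform. -/
theorem exists_le_mul_prod {κ : ℕ → ℝ} (hκ : ∀ k, 0 < κ k) {A : ℝ} (hA : 0 ≤ A) (n : ℕ) :
    ∃ D, 0 ≤ D ∧ ∀ X K : ℕ → ℝ, X 0 ≤ A → (∀ k < n, X (k + 1) ≤ A + 2 * (K (k + 1) * X k)) →
      (∀ k ∈ Finset.Icc 1 n, κ k ≤ K k) → X n ≤ D * ∏ k ∈ Finset.Icc 1 n, K k := by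
  induction n with
  | zero => exact ⟨A, hA, fun X K h0 _ _ => by simpa using h0⟩
  | succ n ih =>
    obtain ⟨D, hD, ih⟩ := ih
    have hP : 0 < ∏ k ∈ Finset.Icc 1 (n + 1), κ k := Finset.prod_pos fun k _ => hκ k
    refine ⟨A / (∏ k ∈ Finset.Icc 1 (n + 1), κ k) + 2 * D, by positivity, fun X K h0 h1 h2 => ?_⟩
    have hX := ih X K h0 (fun k hk => h1 k (by omega))
      fun k hk => h2 k (Finset.Icc_subset_Icc_right (by omega) hk)
    have hK : 0 ≤ K (n + 1) := (hκ _).le.trans (h2 _ (by simp))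
    have hle : ∏ k ∈ Finset.Icc 1 (n + 1), κ k ≤ ∏ k ∈ Finset.Icc 1 (n + 1), K k :=
      Finset.prod_le_prod (fun k _ => (hκ k).le) h2
    have hA' : A ≤ A / (∏ k ∈ Finset.Icc 1 (n + 1), κ k) * ∏ k ∈ Finset.Icc 1 (n + 1), K k := by
      rw [div_mul_eq_mul_div, le_div_iff₀ hP]
      exact mul_le_mul_of_nonneg_left hle hA
    have hprod : ∏ k ∈ Finset.Icc 1 (n + 1), K k = (∏ k ∈ Finset.Icc 1 n, K k) * K (n + 1) :=
      Finset.prod_Icc_succ_top (by omega) K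
    calc X (n + 1) ≤ A + 2 * (K (n + 1) * X n) := h1 n (by omega)
      _ ≤ A + 2 * (K (n + 1) * (D * ∏ k ∈ Finset.Icc 1 n, K k)) := by gcongr
      _ = A + 2 * D * ∏ k ∈ Finset.Icc 1 (n + 1), K k := by rw [hprod]; ring
      _ ≤ _ := by rw [add_mul]; linarith

theorem dissipation_nonneg (n N : ℕ) (hT : 0 ≤ T) (hε : 0 < ε) (u : ℝ → Space d → ℝ) :
    0 ≤ dissipation n N T ε u := by
  refine mul_nonneg (by positivity) (mul_nonneg (by positivity) (Finset.sum_nonneg fun ξ _ => ?_))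
  exact mul_nonneg (mul_nonneg (sq_nonneg _) (weight_nonneg _ _))
    (intervalIntegral.integral_nonneg hT fun _ _ => sq_nonneg _)

theorem IsSVV.sqrt_dissipation_succ_le (h : IsSVV s N T ε m CQ c μ f Q u₀ u) {n : ℕ}
    (hns : n + 1 ≤ s) {C₀ : ℝ} (hC₀ : ε ^ (n + 1) * derivNorm (n + 1) (u 0) ≤ C₀) :
    Real.sqrt (dissipation (n + 1) N T ε u) ≤ 2 * |C₀|
      + 2 * (composConst c f (supNormDT T u) (n + 1) * Real.sqrt (dissipation n N T ε u)) := by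
  set K := composConst c f (supNormDT T u) (n + 1)
  have hK : 0 ≤ K := composConst_nonneg h.c_pos f (supNormDT_nonneg T u) _
  have hX := Real.sq_sqrt (dissipation_nonneg n N h.T_nonneg h.ε_pos u)
  set X := Real.sqrt (dissipation n N T ε u)
  have hX0 : 0 ≤ X := Real.sqrt_nonneg _
  have h1 := (h.order_succ hns).2
  refine Real.sqrt_le_iff.mpr ⟨by positivity, h1.trans ?_⟩
  rw [← hX]
  have ha : 0 ≤ ε ^ (n + 1) * derivNorm (n + 1) (u 0) :=
    mul_nonneg (pow_nonneg h.ε_pos.le _) (derivNorm_nonneg _ _)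
  have h2 : (ε ^ (n + 1) * derivNorm (n + 1) (u 0)) ^ 2 ≤ |C₀| ^ 2 :=
    pow_le_pow_left₀ ha (hC₀.trans (le_abs_self _)) 2
  have h3 : 0 ≤ |C₀| * (K * X) := by positivity
  nlinarith [sq_nonneg |C₀|, sq_nonneg (K * X)]

theorem IsSVV.sqrt_dissipation_zero_le (h : IsSVV s N T ε m CQ c μ f Q u₀ u) {C₀ : ℝ}
    (hC₀ : ε ^ 0 * derivNorm 0 (u 0) ≤ C₀) :
    Real.sqrt (dissipation 0 N T ε u) ≤ 2 * |C₀| := by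
  have h1 := h.order_zero.2
  refine Real.sqrt_le_iff.mpr ⟨by positivity, h1.trans ?_⟩
  rw [pow_zero, one_mul] at hC₀
  have h2 : derivNorm 0 (u 0) ^ 2 ≤ |C₀| ^ 2 :=
    pow_le_pow_left₀ (derivNorm_nonneg _ _) (hC₀.trans (le_abs_self _)) 2
  nlinarith [sq_nonneg |C₀|]

end

/-! ### Choice of N₀ and of the constants c_k -/

theorem exists_small_viscosity_free_spectrum {d : ℕ} (hd : 1 ≤ d) {T CQ CA : ℝ} (hT : 0 < T) :
    ∃ N₀ : ℕ, ∀ (N : ℕ) (ε m : ℝ), N₀ ≤ N → 0 < ε → ε * m ^ 2 * Real.log N ^ d ≤ CA →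
      2 * ε * ((1 + d ^ 2 * |CQ|) * m ^ 2) * T ≤ 1 / 4 := by
  set b := 8 * (1 + d ^ 2 * |CQ|) * T with hb
  have hb0 : 0 < b := by positivity
  have hlim : Filter.Tendsto (fun N : ℕ => Real.log N) Filter.atTop Filter.atTop :=
    Real.tendsto_log_atTop.comp tendsto_natCast_atTop_atTop
  obtain ⟨N₀, hN₀⟩ := Filter.eventually_atTop.mp
    -- The last summand 1 gives log N ≥ 1, so that (log N)^d ≥ log N; |CA| + 1 is a positive upper
    -- bound for CA.
    (hlim.eventually_ge_atTop (b * (|CA| + 1) + 1))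
  refine ⟨N₀, fun N ε m hN hε hA => ?_⟩
  have hlog := hN₀ N hN
  have hbA : 0 < b * (|CA| + 1) := by positivity
  have h1 : b * (|CA| + 1) ≤ Real.log N ^ d :=
    calc b * (|CA| + 1) ≤ Real.log N := by linarith
      _ ≤ Real.log N ^ d := le_self_pow₀ (by linarith) (by omega)
  have h2 : ε * m ^ 2 * (b * (|CA| + 1)) ≤ |CA| + 1 :=
    calc ε * m ^ 2 * (b * (|CA| + 1)) ≤ ε * m ^ 2 * Real.log N ^ d := by gcongr
      _ ≤ CA := hA
      _ ≤ |CA| + 1 := by linarith [le_abs_self CA]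
  have h3 : ε * m ^ 2 * b ≤ 1 := by
    refine le_of_mul_le_mul_right ?_ (by positivity : 0 < |CA| + 1)
    linarith
  rw [hb] at h3
  linarith

theorem exists_composConst (d : ℕ) :
    ∃ c : ℕ → ℝ, (∀ k, 0 < c k) ∧
      ∀ (k N : ℕ) (f : ℝ → Space d) (φ : Space d → ℝ) (U : ℝ), 1 ≤ k →
        ContDiff ℝ k f → IsTrigPoly N φ → (∀ x, |φ x| ≤ U) →
        derivNormVec k f φ ≤ composConst c f U k * derivNorm k φ := by
  have h : ∀ k : ℕ, ∃ C : ℝ, 0 < C ∧ (1 ≤ k → ∀ (N : ℕ) (f : ℝ → Space d) (φ : Space d → ℝ)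
      (U : ℝ), ContDiff ℝ k f → IsTrigPoly N φ → (∀ x, |φ x| ≤ U) → derivNormVec k f φ
        ≤ C * (∑ j ∈ Finset.Icc 1 k, fluxNorm f j U * U ^ (j - 1)) * derivNorm k φ) := by
    intro k
    by_cases hk : 1 ≤ k
    · obtain ⟨C, hC, h⟩ := exists_derivNormVec_le d k hk
      exact ⟨C, hC, fun _ => h⟩
    · exact ⟨1, one_pos, fun h => absurd h hk⟩
  choose c hc hcomp using h
  exact ⟨c, hc, fun k N f φ U hk => hcomp k hk N f φ U⟩

end SVV

end

theorem mainTheorem5 (d : ℕ) (hd : 1 ≤ d) :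
    ∃ c : ℕ → ℝ, (∀ k, 0 < c k) ∧
      -- the composition inequality that characterizes the constants `𝒦_k`
      (∀ (k N : ℕ) (f : ℝ → SVV.Space d) (φ : SVV.Space d → ℝ) (U : ℝ), 1 ≤ k →
        ContDiff ℝ k f → SVV.IsTrigPoly N φ → (∀ x, |φ x| ≤ U) →
        SVV.derivNormVec k f φ ≤ SVV.composConst c f U k * SVV.derivNorm k φ) ∧
      -- the energy estimate
      ∀ (s : ℕ) (T CQ CA : ℝ), 0 < T → ∃ (N₀ : ℕ) (C : ℝ), 0 < C ∧
        ∀ (C₀ κ : ℝ), 0 < κ → ∃ C' : ℝ, 0 < C' ∧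
          ∀ (N : ℕ) (ε m : ℝ) (μ : MeasureTheory.Measure (SVV.Space d)) (f : ℝ → SVV.Space d)
            (Q : Fin d → Fin d → ℝ → (Fin d → ℤ) → ℝ) (u₀ : SVV.Space d → ℝ)
            (u : ℝ → SVV.Space d → ℝ),
            N₀ ≤ N → 0 < m →
            SVV.IsLevy μ → SVV.IsSymm μ →
            ContDiff ℝ (s + 1 : ℕ) f →
            MeasureTheory.MemLp u₀ ⊤ (MeasureTheory.volume.restrict (SVV.cell d)) →
            SVV.IsViscosity N T m CQ Q →
            SVV.IsSolution N T ε m μ f Q u₀ u →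
            8 * (d : ℝ) ^ ((s : ℝ) / 2)
              * SVV.composConst c f (SVV.supNormDT T u) (s + 1) / N < ε →
            ε * m ^ 2 * Real.log N ^ d ≤ CA →
            (∀ t ∈ Set.Icc 0 T, SVV.energy s N T ε μ u t ≤
              (if s = 0 then C * SVV.supNormDT T u
                else C * SVV.normL2 u₀ *
                  ∏ _k ∈ Finset.Icc 1 s, SVV.composConst c f (SVV.supNormDT T u) s)
              + 3 * (ε ^ s * SVV.derivNorm s (u 0))) ∧
            (1 ≤ s → κ ≤ SVV.composConst c f (SVV.supNormDT T u) 1 →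
              (∀ k < s, ε ^ k * SVV.derivNorm k (u 0) ≤ C₀) →
              ∀ t ∈ Set.Icc 0 T, SVV.energy s N T ε μ u t ≤
                C' * ∏ k ∈ Finset.Icc 1 s, SVV.composConst c f (SVV.supNormDT T u) k
                + 3 * (ε ^ s * SVV.derivNorm s (u 0))) := by
  obtain ⟨c, hc, hcomp⟩ := SVV.exists_composConst d
  refine ⟨c, hc, hcomp, fun s T CQ CA hT => ?_⟩
  obtain ⟨N₀, hN₀⟩ := SVV.exists_small_viscosity_free_spectrum hd (CQ := CQ) (CA := CA) hT
  -- This is the constant of `IsSVV.order_succ_direct`; at order 0 the estimate even holds without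
  -- the term 𝓑_0.
  refine ⟨N₀, 3 * 2 ^ s, by positivity, fun C₀ κ hκ => ?_⟩
  -- The recursion for the square roots of the dissipations has inhomogeneity 2|C₀|. It stops at
  -- order s - 1, because the last step is the energy estimate itself.
  obtain ⟨D, hD, hrec⟩ := SVV.exists_le_mul_prod (κ := fun k => c k / c 1 * κ)
    (fun k => mul_pos (div_pos (hc k) (hc 1)) hκ) (A := 2 * |C₀|) (by positivity) (s - 1)
  -- The factor 3 comes from the last energy estimate; the 1 covers D = 0.
  refine ⟨3 * D + 1, by positivity, ?_⟩
  intro N ε m μ f Q u₀ u hN hm hμ _ hf hu₀ hQ hu hεK hA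
  have hU := SVV.supNormDT_nonneg T u
  have hK := fun k => SVV.composConst_nonneg hc f hU k
  -- The lower threshold for ε is nonnegative, and the inequality is strict.
  have hε : 0 < ε := lt_of_le_of_lt
    (div_nonneg (mul_nonneg (by positivity) (hK _)) (Nat.cast_nonneg N)) hεK
  have hS : SVV.IsSVV s N T ε m CQ c μ f Q u₀ u :=
    ⟨hd, hT.le, hu, hμ, hQ, hm, hε, hN₀ N ε m hN hε hA, hc, hf, hcomp⟩
  obtain _ | n := s
  · refine ⟨fun t ht => ?_, fun h => absurd h (by norm_num)⟩
    have h1 := hS.order_zero.1 t ht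
    rw [if_pos rfl]
    have : 0 ≤ 3 * 2 ^ 0 * SVV.supNormDT T u := mul_nonneg (by norm_num) hU
    linarith
  · refine ⟨fun t ht => ?_, fun _ hκK hC₀ t ht => ?_⟩
    · have h1 := hS.order_succ_direct le_rfl t ht
      have h2 := SVV.derivNorm_zero_initial_le hu hT.le hu₀
      rw [if_neg (by omega), Finset.prod_const, Nat.card_Icc, Nat.add_sub_cancel]
      have h3 := mul_le_mul_of_nonneg_left h2
        (mul_nonneg (by positivity : (0 : ℝ) ≤ 2 ^ (n + 1)) (pow_nonneg (hK (n + 1)) (n + 1)))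
      linarith
    · have h1 := (hS.order_succ le_rfl).1 t ht
      have h2 := hrec (fun k => Real.sqrt (SVV.dissipation k N T ε u))
        (SVV.composConst c f (SVV.supNormDT T u))
        (hS.sqrt_dissipation_zero_le (hC₀ 0 (by omega)))
        (fun k hk => hS.sqrt_dissipation_succ_le (by omega) (hC₀ (k + 1) (by omega)))
        (fun k hk => (mul_le_mul_of_nonneg_left hκK (div_nonneg (hc k).le (hc 1).le)).trans
          (SVV.composConst_one_le hc f hU (Finset.mem_Icc.mp hk).1))
      rw [Nat.add_sub_cancel] at h2
      have h3 := mul_le_mul_of_nonneg_left h2 (hK (n + 1))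
      have h4 : 0 ≤ ∏ k ∈ Finset.Icc 1 (n + 1), SVV.composConst c f (SVV.supNormDT T u) k :=
        Finset.prod_nonneg fun k _ => hK k
      rw [Finset.prod_Icc_succ_top (by omega)] at h4 ⊢
      linarith
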